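/- Let $A=(a_{ij})_{i,j\in I}$, $I=\{1,\dots,n\}$, be a Cartan matrix of finite type, with relatively prime positive integers $d_i$ such that $d_ia_{ij}=d_ja_{ji}$, and let $r,s\in\mathbb C^*$ be such that $rs^{-1}$ is not a root of unity. Put $r_i=r^{d_i}$, $s_i=s^{d_i}$, and let $\langle\cdot,\cdot\rangle$ be the bilinear form on $Q=\bigoplus_i\mathbb Z\alpha_i$ with $\langle i,j\rangle:=\langle\alpha_i,\alpha_j\rangle=d_ia_{ij}$ for $i<j$, $=d_i$ for $i=j$, and $=0$ for $i>j$. Write $(m)_v=1+v+\dots+v^{m-1}$, $(m)_v^!=(1)_v\cdots(m)_v$, $\binom mk_v=\frac{(m)_v^!}{(k)_v^!(m-k)_v^!}$ and $c_{ij}^{k}=(r_is_i^{-1})^{k(k-1)/2}r^{k\langle j,i\rangle}s^{-k\langle i,j\rangle}$. Let $U^{\geq}$ be the algebra with generators $E_i,K_i'^{\pm1}$ and relations $K_i'K_i'^{-1}=K_i'^{-1}K_i'=1$, $K_i'K_j'=K_j'K_i'$, $K_i'E_jK_i'^{-1}=r^{-\langle i,j\rangle}s^{\langle j,i\rangle}E_j$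 and, for $i\ne j$, $\sum_{k=0}^{1-a_{ij}}(-1)^k\binom{1-a_{ij}}{k}_{r_is_i^{-1}}c_{ij}^kE_i^{1-a_{ij}-k}E_jE_i^k=0$. Let $U^{\leq}$ be the algebra with generators $F_i,K_i^{\pm1}$ and relations $K_iK_i^{-1}=K_i^{-1}K_i=1$, $K_iK_j=K_jK_i$, $K_iF_jK_i^{-1}=r^{-\langle j,i\rangle}s^{\langle i,j\rangle}F_j$ and, for $i\neq j$, $\sum_{k=0}^{1-a_{ij}}(-1)^k\binom{1-a_{ij}}{k}_{r_is_i^{-1}}c_{ij}^kF_i^kF_jF_i^{1-a_{ij}-k}=0$. There are Hopf algebra structures with invertible antipode on $U^{\ge}$ and $U^{\le}$ in which $K_i',K_i$ are group-like with $S(K_i')=K_i'^{-1}$, $S(K_i)=K_i^{-1}$, and $\Delta(E_i)=E_i\otimes K_i'+1\otimes E_i$, $\varepsilon(E_i)=0$, $S(E_i)=-E_iK_i'^{-1}$, $\Delta(F_i)=F_i\otimes1+K_i\otimes F_i$, $\varepsilon(F_i)=0$, $S(F_i)=-K_i^{-1}F_i$; and there is a bilinear form $\varphi:U^{\ge}\times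 U^{\le}\to\mathbb C$ that is a skew Hopf pairing, that is, $\varphi(a,bb')=\sum\varphi(a_{(1)},b)\varphi(a_{(2)},b')$, $\varphi(aa',b)=\sum\varphi(a',b_{(1)})\varphi(a,b_{(2)})$, $\varphi(a,1)=\varepsilon(a)$, $\varphi(1,b)=\varepsilon(b)$, with $\varphi(E_i,F_j)=\frac{\delta_{ij}}{s_i-r_i}$, $\varphi(K'_\lambda,K_\mu)=r^{\langle\lambda,\mu\rangle}s^{-\langle\mu,\lambda\rangle}$ for $\lambda,\mu\in Q$, and $\varphi(E_i,K_j)=\varphi(K_i',F_j)=0$; here $K_\mu=\prod_iK_i^{\mu_i}$ and $K'_\mu=\prod_iK_i'^{\mu_i}$ for $\mu=\sum_i\mu_i\alpha_i$. Let $U_{r,s}$ be the quantum double: the space $U^{\geq}\otimes U^{\leq}$ with the tensor product coalgebra structure, unit $1\otimes1$ and product $$(a\otimes b)(a'\otimes b')=\sum\varphi(S^{-1}(a'_{(1)}),b_{(1)})\,\varphi(a'_{(3)},b_{(3)})\,aa'_{(2)}\otimes b_{(2)}b'.$$ Let $B_{r,s}$ (the two-parameter Kashiwara algebra) be the Heisenberg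 double: the space $U^{\leq}\otimes U^{\geq}$, with pure tensors written $b\sharp a$, unit $1\sharp1$ and product $$(b\sharp a)(b'\sharp a')=\sum\varphi(a_{(1)},b'_{(1)})\,bb'_{(2)}\sharp a_{(2)}a'.$$ Let $W_{r,s}$ (the two-parameter quantized Weyl algebra) be the subalgebra of $B_{r,s}$ generated by $1\sharp e_i'$, with $e_i'=(s_i-r_i)K_i'^{-1}E_i\in U^{\ge}$, and $F_i\sharp1$ $(i\in I)$. Let $U_{r,s}$ act on $U^{\ge}$ by $(a\otimes1)\cdot x=\sum a_{(1)}xS(a_{(2)})$, $(1\otimes b)\cdot x=\sum\varphi(x_{(1)},S(b))x_{(2)}$, on $U^{\le}$ by $(a\otimes1)\cdot y=\sum\varphi(a,y_{(1)})y_{(2)}$, $(1\otimes b)\cdot y=\sum b_{(1)}yS(b_{(2)})$, where $a\otimes b$ acts as $a\otimes1$ after $1\otimes b$, and on $B_{r,s}$ diagonally, $$(a\otimes b)\cdot(b'\sharp a')=\sum(a_{(1)}\otimes b_{(1)})\cdot b'\,\sharp\,(a_{(2)}\otimes b_{(2)})\cdot a';$$ and let $\delta:B_{r,s}\to U_{r,s}\otimes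 B_{r,s}$ be $\delta(b\sharp a)=\sum\big((1\otimes b_{(1)})(a_{(1)}\otimes1)\big)\otimes\big(b_{(2)}\sharp a_{(2)}\big)$. **Proposition 3.1.** $U_{r,s}$ is a Hopf algebra. With this action, $B_{r,s}$ is an (associative unital) $U_{r,s}$-module algebra, and with this action and the coaction $\delta$ it is a left $U_{r,s}$-Yetter–Drinfel'd module, i.e. a left module and a left comodule with $$\sum h_{(1)}v_{(-1)}\otimes h_{(2)}\cdot v_{(0)}=\sum(h_{(1)}\cdot v)_{(-1)}h_{(2)}\otimes(h_{(1)}\cdot v)_{(0)}.$$ Moreover $U_{r,s}\cdot W_{r,s}\subseteq W_{r,s}$ and $\delta(W_{r,s})\subseteq U_{r,s}\otimes W_{r,s}$, and with the restricted structures $W_{r,s}$ is a $U_{r,s}$-module algebra and a left $U_{r,s}$-Yetter–Drinfel'd module. -/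

import Mathlib

open scoped TensorProduct

noncomputable section

namespace TwoParam

/-! ### Algebras, bialgebras, modules and comodules on complex vector spaces

The multiplication of an algebra on a vector space `X` is recorded as a linear map
`X ⊗ X → X`; this is convenient for algebras whose underlying space is a tensor product but whose
multiplication is not the componentwise one. -/

section Linear

variable {X V : Type*} [AddCommMonoid X] [Module ℂ X] [AddCommMonoid V] [Module ℂ V]

/-- `mul` and `one` make the vector space `V` an associative unital algebra. -/
structure IsAlgebra (mul : V ⊗[ℂ] V →ₗ[ℂ] V) (one : V) : Prop where
  one_mul : ∀ x, mul (one ⊗ₜ x) = x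
  mul_one : ∀ x, mul (x ⊗ₜ one) = x
  mul_assoc : ∀ x y z, mul (mul (x ⊗ₜ y) ⊗ₜ z) = mul (x ⊗ₜ mul (y ⊗ₜ z))

/-- The componentwise product `(x ⊗ y) ⊗ (x' ⊗ y') ↦ x x' ⊗ y y'` on `V ⊗ V`. -/
def squareMul (mul : V ⊗[ℂ] V →ₗ[ℂ] V) :
    (V ⊗[ℂ] V) ⊗[ℂ] (V ⊗[ℂ] V) →ₗ[ℂ] V ⊗[ℂ] V :=
  TensorProduct.map mul mul ∘ₗ (TensorProduct.tensorTensorTensorComm ℂ V V V V).toLinearMap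

/-- The structure maps of a bialgebra on a vector space (the laws are `BialgData.IsBialgebra`). -/
structure BialgData (X : Type*) [AddCommMonoid X] [Module ℂ X] where
  mul : X ⊗[ℂ] X →ₗ[ℂ] X
  one : X
  comul : X →ₗ[ℂ] X ⊗[ℂ] X
  counit : X →ₗ[ℂ] ℂ

/-- `comul` and `counit` make `X` a coassociative counital coalgebra. -/
structure IsCoalgebra (comul : X →ₗ[ℂ] X ⊗[ℂ] X) (counit : X →ₗ[ℂ] ℂ) : Prop where
  coassoc : ∀ x, TensorProduct.assoc ℂ X X X (comul.rTensor X (comul x)) =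
    comul.lTensor X (comul x)
  counit_left : ∀ x, TensorProduct.lid ℂ X (counit.rTensor X (comul x)) = x
  counit_right : ∀ x, TensorProduct.rid ℂ X (counit.lTensor X (comul x)) = x

/-- The bialgebra axioms: an algebra and a coalgebra such that comultiplication and counit are
homomorphisms of unital algebras. -/
structure BialgData.IsBialgebra (H : BialgData X) : Prop where
  isAlgebra : IsAlgebra H.mul H.one
  isCoalgebra : IsCoalgebra H.comul H.counit
  comul_one : H.comul H.one = H.one ⊗ₜ H.one
  comul_mul : ∀ x y, H.comul (H.mul (x ⊗ₜ y)) = squareMul H.mul (H.comul x ⊗ₜ H.comul y)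
  counit_one : H.counit H.one = 1
  counit_mul : ∀ x y, H.counit (H.mul (x ⊗ₜ y)) = H.counit x * H.counit y

/-- `S` is an antipode: a two-sided convolution inverse of the identity. -/
structure BialgData.IsAntipode (H : BialgData X) (S : X →ₗ[ℂ] X) : Prop where
  left : ∀ x, H.mul (S.rTensor X (H.comul x)) = H.counit x • H.one
  right : ∀ x, H.mul (S.lTensor X (H.comul x)) = H.counit x • H.one

/-- A Hopf algebra: a bialgebra that has an antipode. -/
def BialgData.IsHopfAlgebra (H : BialgData X) : Prop :=
  H.IsBialgebra ∧ ∃ S : X →ₗ[ℂ] X, H.IsAntipode S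

/-- `act` makes `V` a left `H`-module. -/
structure IsModule (H : BialgData X) (act : X →ₗ[ℂ] V →ₗ[ℂ] V) : Prop where
  one_act : ∀ v, act H.one v = v
  mul_act : ∀ x y v, act (H.mul (x ⊗ₜ y)) v = act x (act y v)

/-- `δ` makes `V` a left `H`-comodule. -/
structure IsComodule (H : BialgData X) (δ : V →ₗ[ℂ] X ⊗[ℂ] V) : Prop where
  coassoc : ∀ v, TensorProduct.assoc ℂ X X V (H.comul.rTensor V (δ v)) = δ.lTensor X (δ v)
  counit : ∀ v, TensorProduct.lid ℂ V (H.counit.rTensor V (δ v)) = v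

/-- `V`, with product `mul`, unit `one` and action `act`, is a left `H`-module algebra: it is an
algebra and a left `H`-module, `h · (x y) = ∑ (h₁ · x) (h₂ · y)` and `h · 1 = ε(h) 1`. -/
structure IsModuleAlgebra (H : BialgData X) (mul : V ⊗[ℂ] V →ₗ[ℂ] V) (one : V)
    (act : X →ₗ[ℂ] V →ₗ[ℂ] V) : Prop where
  isAlgebra : IsAlgebra mul one
  isModule : IsModule H act
  act_mul : ∀ h x y, act h (mul (x ⊗ₜ y)) =
    mul (TensorProduct.lift ((TensorProduct.mapBilinear (RingHom.id ℂ) V V V V).compl₁₂ act act)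
      (H.comul h) (x ⊗ₜ y))
  act_one : ∀ h, act h one = H.counit h • one

/-- The map `h ⊗ v ↦ ∑ h₁ v₍₋₁₎ ⊗ h₂ · v₍₀₎`. -/
def ydLeft (H : BialgData X) (act : X →ₗ[ℂ] V →ₗ[ℂ] V) (δ : V →ₗ[ℂ] X ⊗[ℂ] V) :
    X ⊗[ℂ] V →ₗ[ℂ] X ⊗[ℂ] V :=
  TensorProduct.map H.mul (TensorProduct.lift act) ∘ₗ
    (TensorProduct.tensorTensorTensorComm ℂ X X X V).toLinearMap ∘ₗ
    TensorProduct.map H.comul δ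

/-- The map `h ⊗ v ↦ ∑ (h₁ · v)₍₋₁₎ h₂ ⊗ (h₁ · v)₍₀₎`. -/
def ydRight (H : BialgData X) (act : X →ₗ[ℂ] V →ₗ[ℂ] V) (δ : V →ₗ[ℂ] X ⊗[ℂ] V) :
    X ⊗[ℂ] V →ₗ[ℂ] X ⊗[ℂ] V :=
  H.mul.rTensor V ∘ₗ (TensorProduct.rightComm ℂ X V X).toLinearMap ∘ₗ
    (δ ∘ₗ TensorProduct.lift act).rTensor X ∘ₗ
    (TensorProduct.rightComm ℂ X X V).toLinearMap ∘ₗ H.comul.rTensor V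

/-- `V` is a left `H`-Yetter-Drinfeld module: a left module and a left comodule with
`∑ h₁ v₍₋₁₎ ⊗ h₂ · v₍₀₎ = ∑ (h₁ · v)₍₋₁₎ h₂ ⊗ (h₁ · v)₍₀₎`. -/
structure IsYetterDrinfeld (H : BialgData X) (act : X →ₗ[ℂ] V →ₗ[ℂ] V)
    (δ : V →ₗ[ℂ] X ⊗[ℂ] V) : Prop where
  isModule : IsModule H act
  isComodule : IsComodule H δ
  compat : ∀ h v, ydLeft H act δ (h ⊗ₜ v) = ydRight H act δ (h ⊗ₜ v)

/-- The subalgebra of `(V, mul, one)` generated by a set `G`, as a linear subspace: the smallest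
subspace that contains `one` and `G` and is closed under `mul`. -/
def subalgebraGenerated (mul : V ⊗[ℂ] V →ₗ[ℂ] V) (one : V) (G : Set V) : Submodule ℂ V :=
  sInf {p | one ∈ p ∧ G ⊆ p ∧ ∀ x ∈ p, ∀ y ∈ p, mul (x ⊗ₜ y) ∈ p}

/-- For a comultiplication `Δ` on `X`, the map that sends a functional `f` to the operator
`x ↦ ∑ f(x₁) x₂`. -/
def slice (Δ : X →ₗ[ℂ] X ⊗[ℂ] X) : (X →ₗ[ℂ] ℂ) →ₗ[ℂ] (X →ₗ[ℂ] X) where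
  toFun f := (TensorProduct.lid ℂ X).toLinearMap ∘ₗ f.rTensor X ∘ₗ Δ
  map_add' f g := by
    rw [LinearMap.rTensor_add, LinearMap.add_comp, LinearMap.comp_add]
  map_smul' c f := by
    rw [LinearMap.rTensor_smul, LinearMap.smul_comp, LinearMap.comp_smul, RingHom.id_apply]

end Linear

/-! ### Hopf algebras with invertible antipode, skew Hopf pairings and the two doubles -/

/-- A Hopf algebra structure with invertible antipode on the algebra `A`. -/
structure HopfStructure (A : Type*) [Ring A] [Algebra ℂ A] where
  comul : A →ₐ[ℂ] A ⊗[ℂ] A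
  counit : A →ₐ[ℂ] ℂ
  antipode : A ≃ₗ[ℂ] A
  isCoalgebra : IsCoalgebra comul.toLinearMap counit.toLinearMap
  antipode_left : ∀ x,
    LinearMap.mul' ℂ A (antipode.toLinearMap.rTensor A (comul x)) = algebraMap ℂ A (counit x)
  antipode_right : ∀ x,
    LinearMap.mul' ℂ A (antipode.toLinearMap.lTensor A (comul x)) = algebraMap ℂ A (counit x)

section Doubles

variable {A B : Type*} [Ring A] [Algebra ℂ A] [Ring B] [Algebra ℂ B]

/-- A skew Hopf pairing:
`φ(a, b b') = ∑ φ(a₁, b) φ(a₂, b')`, `φ(a a', b) = ∑ φ(a', b₁) φ(a, b₂)`,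
`φ(a, 1) = ε(a)` and `φ(1, b) = ε(b)`. -/
structure IsSkewHopfPairing (hA : HopfStructure A) (hB : HopfStructure B)
    (φ : A →ₗ[ℂ] B →ₗ[ℂ] ℂ) : Prop where
  apply_mul : ∀ a b b',
    φ a (b * b') = LinearMap.mul' ℂ ℂ (TensorProduct.map (φ.flip b) (φ.flip b') (hA.comul a))
  mul_apply : ∀ a a' b,
    φ (a * a') b = LinearMap.mul' ℂ ℂ (TensorProduct.map (φ a') (φ a) (hB.comul b))
  apply_one : ∀ a, φ a 1 = hA.counit a
  one_apply : ∀ b, φ 1 b = hB.counit b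

/-- Given a linear map `T : Y ⊗ X → X ⊗ Y`, the product
`(x ⊗ y)(x' ⊗ y') = x T(y ⊗ x') y'` on `X ⊗ Y`. -/
def twistedMul {X Y : Type*} [Ring X] [Algebra ℂ X] [Ring Y] [Algebra ℂ Y]
    (T : Y ⊗[ℂ] X →ₗ[ℂ] X ⊗[ℂ] Y) :
    (X ⊗[ℂ] Y) ⊗[ℂ] (X ⊗[ℂ] Y) →ₗ[ℂ] X ⊗[ℂ] Y :=
  TensorProduct.map (LinearMap.mul' ℂ X) (LinearMap.mul' ℂ Y) ∘ₗ
    (TensorProduct.tensorTensorTensorAssoc ℂ X X Y Y).symm.toLinearMap ∘ₗ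
    (T.lTensor X).rTensor Y ∘ₗ
    (TensorProduct.tensorTensorTensorAssoc ℂ X Y X Y).toLinearMap

/-- The comultiplication `a ⊗ b ↦ ∑ (a₁ ⊗ b₁) ⊗ (a₂ ⊗ b₂)` of the tensor product of the coalgebras
`A` and `B`. -/
def tensorComul (hA : HopfStructure A) (hB : HopfStructure B) :
    A ⊗[ℂ] B →ₗ[ℂ] (A ⊗[ℂ] B) ⊗[ℂ] (A ⊗[ℂ] B) :=
  (TensorProduct.tensorTensorTensorComm ℂ A A B B).toLinearMap ∘ₗ
    TensorProduct.map hA.comul.toLinearMap hB.comul.toLinearMap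

/-- The map `b ⊗ a ↦ ∑ φ(S⁻¹(a₁), b₁) φ(a₃, b₃) a₂ ⊗ b₂`. -/
def doubleTwist (hA : HopfStructure A) (hB : HopfStructure B) (φ : A →ₗ[ℂ] B →ₗ[ℂ] ℂ) :
    B ⊗[ℂ] A →ₗ[ℂ] A ⊗[ℂ] B :=
  (TensorProduct.lid ℂ (A ⊗[ℂ] B)).toLinearMap ∘ₗ
    TensorProduct.map
      (TensorProduct.lift φ ∘ₗ hA.antipode.symm.toLinearMap.rTensor B)
      ((TensorProduct.rid ℂ (A ⊗[ℂ] B)).toLinearMap ∘ₗ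
        (TensorProduct.lift φ).lTensor (A ⊗[ℂ] B)) ∘ₗ
    (tensorComul hA hB).lTensor (A ⊗[ℂ] B) ∘ₗ tensorComul hA hB ∘ₗ
    (TensorProduct.comm ℂ B A).toLinearMap

/-- The quantum double on `A ⊗ B`: the tensor product coalgebra, with unit `1 ⊗ 1` and product
`(a ⊗ b)(a' ⊗ b') = ∑ φ(S⁻¹(a'₁), b₁) φ(a'₃, b₃) a a'₂ ⊗ b₂ b'`. -/
def quantumDouble (hA : HopfStructure A) (hB : HopfStructure B) (φ : A →ₗ[ℂ] B →ₗ[ℂ] ℂ) :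
    BialgData (A ⊗[ℂ] B) where
  mul := twistedMul (doubleTwist hA hB φ)
  one := 1 ⊗ₜ 1
  comul := tensorComul hA hB
  counit := LinearMap.mul' ℂ ℂ ∘ₗ
    TensorProduct.map hA.counit.toLinearMap hB.counit.toLinearMap

/-- The product `(b ♯ a)(b' ♯ a') = ∑ φ(a₁, b'₁) b b'₂ ♯ a₂ a'` of the Heisenberg double, whose
underlying space is `B ⊗ A` and whose unit is `1 ♯ 1`. -/
def heisenbergMul (hA : HopfStructure A) (hB : HopfStructure B) (φ : A →ₗ[ℂ] B →ₗ[ℂ] ℂ) :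
    (B ⊗[ℂ] A) ⊗[ℂ] (B ⊗[ℂ] A) →ₗ[ℂ] B ⊗[ℂ] A :=
  twistedMul ((TensorProduct.lid ℂ (B ⊗[ℂ] A)).toLinearMap ∘ₗ
    TensorProduct.map (TensorProduct.lift φ) (TensorProduct.comm ℂ A B).toLinearMap ∘ₗ
    tensorComul hA hB)

/-- The adjoint action `a · x = ∑ a₁ x S(a₂)` of a Hopf algebra on itself. -/
def adjointAction (hA : HopfStructure A) : A →ₗ[ℂ] A →ₗ[ℂ] A :=
  TensorProduct.lift
    ((LinearMap.mul ℂ (Module.End ℂ A)).compl₁₂ (LinearMap.mul ℂ A)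
      ((LinearMap.mul ℂ A).flip ∘ₗ hA.antipode.toLinearMap)) ∘ₗ hA.comul.toLinearMap

/-- The Schrödinger representation of the quantum double on `A`:
`(a ⊗ 1) · x = ∑ a₁ x S(a₂)` and `(1 ⊗ b) · x = ∑ φ(x₁, S(b)) x₂`. -/
def schrodingerLeft (hA : HopfStructure A) (hB : HopfStructure B) (φ : A →ₗ[ℂ] B →ₗ[ℂ] ℂ) :
    A ⊗[ℂ] B →ₗ[ℂ] A →ₗ[ℂ] A :=
  TensorProduct.lift ((LinearMap.mul ℂ (Module.End ℂ A)).compl₁₂ (adjointAction hA)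
    (slice hA.comul.toLinearMap ∘ₗ φ.flip ∘ₗ hB.antipode.toLinearMap))

/-- The Schrödinger representation of the quantum double on `B`:
`(a ⊗ 1) · y = ∑ φ(a, y₁) y₂` and `(1 ⊗ b) · y = ∑ b₁ y S(b₂)`. -/
def schrodingerRight (_hA : HopfStructure A) (hB : HopfStructure B) (φ : A →ₗ[ℂ] B →ₗ[ℂ] ℂ) :
    A ⊗[ℂ] B →ₗ[ℂ] B →ₗ[ℂ] B :=
  TensorProduct.lift ((LinearMap.mul ℂ (Module.End ℂ B)).compl₁₂
    (slice hB.comul.toLinearMap ∘ₗ φ) (adjointAction hB))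

/-- The diagonal action of the quantum double on the Heisenberg double:
`(a ⊗ b) · (b' ♯ a') = ∑ (a₁ ⊗ b₁) · b' ♯ (a₂ ⊗ b₂) · a'`. -/
def heisenbergAction (hA : HopfStructure A) (hB : HopfStructure B) (φ : A →ₗ[ℂ] B →ₗ[ℂ] ℂ) :
    A ⊗[ℂ] B →ₗ[ℂ] B ⊗[ℂ] A →ₗ[ℂ] B ⊗[ℂ] A :=
  TensorProduct.lift ((TensorProduct.mapBilinear (RingHom.id ℂ) B A B A).compl₁₂
    (schrodingerRight hA hB φ) (schrodingerLeft hA hB φ)) ∘ₗ tensorComul hA hB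

/-- The coaction of the quantum double on the Heisenberg double:
`δ(b ♯ a) = ∑ ((1 ⊗ b₁)(a₁ ⊗ 1)) ⊗ (b₂ ♯ a₂)`. -/
def heisenbergCoaction (hA : HopfStructure A) (hB : HopfStructure B) (φ : A →ₗ[ℂ] B →ₗ[ℂ] ℂ) :
    B ⊗[ℂ] A →ₗ[ℂ] (A ⊗[ℂ] B) ⊗[ℂ] (B ⊗[ℂ] A) :=
  ((quantumDouble hA hB φ).mul ∘ₗ
      TensorProduct.map (TensorProduct.mk ℂ A B 1) ((TensorProduct.mk ℂ A B).flip 1)).rTensor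
        (B ⊗[ℂ] A) ∘ₗ
    (TensorProduct.tensorTensorTensorComm ℂ B B A A).toLinearMap ∘ₗ
    TensorProduct.map hB.comul.toLinearMap hA.comul.toLinearMap

end Doubles

/-! ### Cartan data and the algebras `U^≥` and `U^≤` -/

/-- A Cartan matrix `a` of finite type, indexed by `{0, …, n - 1}`, with relatively prime positive
integers `d i` such that `d i * a i j = d j * a j i`. -/
structure CartanDatum (n : ℕ) where
  a : Matrix (Fin n) (Fin n) ℤ
  d : Fin n → ℕ
  diag : ∀ i, a i i = 2
  offDiag : ∀ i j, i ≠ j → a i j ≤ 0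
  symm : ∀ i j, (d i : ℤ) * a i j = d j * a j i
  d_pos : ∀ i, 0 < d i
  d_coprime : Finset.univ.gcd d = 1
  posDef : (Matrix.of fun i j => ((d i * a i j : ℤ) : ℝ)).PosDef

/-- The generators of `U^≥` (with `x = E`, `k = K'`) and of `U^≤` (with `x = F`, `k = K`);
`kinv` stands for the inverse of `k`. -/
inductive Gen (n : ℕ) : Type
  | x (i : Fin n)
  | k (i : Fin n)
  | kinv (i : Fin n)

namespace CartanDatum

variable {n : ℕ} (C : CartanDatum n) (r s : ℂ)

/-- The values `⟨i, j⟩ = ⟨α_i, α_j⟩` of the Euler form. -/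
def euler (i j : Fin n) : ℤ :=
  if i < j then C.d i * C.a i j else if i = j then C.d i else 0

/-- The Euler form on the root lattice `Q = ⊕ ℤ α_i`. -/
def eulerForm (l m : Fin n → ℤ) : ℤ :=
  ∑ i, ∑ j, l i * m j * C.euler i j

end CartanDatum

/-- `(m)_v = 1 + v + ⋯ + v^(m-1)`. -/
def qNum (v : ℂ) (m : ℕ) : ℂ := ∑ t ∈ Finset.range m, v ^ t

/-- `(m)_v! = (1)_v (2)_v ⋯ (m)_v`. -/
def qFactorial (v : ℂ) (m : ℕ) : ℂ := ∏ t ∈ Finset.range m, qNum v (t + 1)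

/-- The Gaussian binomial coefficient `(m)_v! / ((k)_v! (m-k)_v!)` for `k ≤ m`. -/
def qBinom (v : ℂ) (m k : ℕ) : ℂ := qFactorial v m / (qFactorial v k * qFactorial v (m - k))

namespace CartanDatum

variable {n : ℕ} (C : CartanDatum n) (r s : ℂ)

/-- The number `1 - a i j`, which is nonnegative for `i ≠ j`. -/
def serreDeg (i j : Fin n) : ℕ := (1 - C.a i j).toNat

/-- The coefficient of the `k`-th term of the quantum Serre relation,
`(-1)^k binom(1 - a_ij, k)_v c_ij^k` with `v = r_i s_i⁻¹` and
`c_ij^k = v^(k(k-1)/2) r^(k⟨j,i⟩) s^(-k⟨i,j⟩)`. -/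
def serreCoeff (i j : Fin n) (k : ℕ) : ℂ :=
  (-1) ^ k * qBinom (r ^ C.d i * (s ^ C.d i)⁻¹) (C.serreDeg i j) k *
    ((r ^ C.d i * (s ^ C.d i)⁻¹) ^ (k * (k - 1) / 2) *
      r ^ ((k : ℤ) * C.euler j i) * s ^ (-((k : ℤ) * C.euler i j)))

open FreeAlgebra in
/-- The defining relations of `U^≥`. -/
inductive RelGe : FreeAlgebra ℂ (Gen n) → FreeAlgebra ℂ (Gen n) → Prop
  | k_kinv (i) : RelGe (ι ℂ (.k i) * ι ℂ (.kinv i)) 1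
  | kinv_k (i) : RelGe (ι ℂ (.kinv i) * ι ℂ (.k i)) 1
  | k_comm (i j) : RelGe (ι ℂ (.k i) * ι ℂ (.k j)) (ι ℂ (.k j) * ι ℂ (.k i))
  | k_x (i j) : RelGe (ι ℂ (.k i) * ι ℂ (.x j) * ι ℂ (.kinv i))
      ((r ^ (-C.euler i j) * s ^ C.euler j i) • ι ℂ (.x j))
  | serre (i j) (h : i ≠ j) : RelGe
      (∑ k ∈ Finset.range (C.serreDeg i j + 1), C.serreCoeff r s i j k •
        (ι ℂ (.x i) ^ (C.serreDeg i j - k) * ι ℂ (.x j) * ι ℂ (.x i) ^ k)) 0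

open FreeAlgebra in
/-- The defining relations of `U^≤`. -/
inductive RelLe : FreeAlgebra ℂ (Gen n) → FreeAlgebra ℂ (Gen n) → Prop
  | k_kinv (i) : RelLe (ι ℂ (.k i) * ι ℂ (.kinv i)) 1
  | kinv_k (i) : RelLe (ι ℂ (.kinv i) * ι ℂ (.k i)) 1
  | k_comm (i j) : RelLe (ι ℂ (.k i) * ι ℂ (.k j)) (ι ℂ (.k j) * ι ℂ (.k i))
  | k_x (i j) : RelLe (ι ℂ (.k i) * ι ℂ (.x j) * ι ℂ (.kinv i))
      ((r ^ (-C.euler j i) * s ^ C.euler i j) • ι ℂ (.x j))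
  | serre (i j) (h : i ≠ j) : RelLe
      (∑ k ∈ Finset.range (C.serreDeg i j + 1), C.serreCoeff r s i j k •
        (ι ℂ (.x i) ^ k * ι ℂ (.x j) * ι ℂ (.x i) ^ (C.serreDeg i j - k))) 0

/-- The algebra `U^≥`, given by generators `E_i`, `K'_i`, `K'_i⁻¹` and relations. -/
abbrev UGe : Type := RingQuot (C.RelGe r s)

/-- The algebra `U^≤`, given by generators `F_i`, `K_i`, `K_i⁻¹` and relations. -/
abbrev ULe : Type := RingQuot (C.RelLe r s)

/-- The generator `E_i` of `U^≥`. -/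
def E (i : Fin n) : C.UGe r s := RingQuot.mkAlgHom ℂ _ (FreeAlgebra.ι ℂ (.x i))

/-- The generator `K'_i` of `U^≥`, as a unit with inverse `K'_i⁻¹`. -/
def K' (i : Fin n) : (C.UGe r s)ˣ where
  val := RingQuot.mkAlgHom ℂ _ (FreeAlgebra.ι ℂ (.k i))
  inv := RingQuot.mkAlgHom ℂ _ (FreeAlgebra.ι ℂ (.kinv i))
  val_inv := by
    rw [← map_mul, RingQuot.mkAlgHom_rel ℂ (RelGe.k_kinv i), map_one]
  inv_val := by
    rw [← map_mul, RingQuot.mkAlgHom_rel ℂ (RelGe.kinv_k i), map_one]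

/-- The generator `F_i` of `U^≤`. -/
def F (i : Fin n) : C.ULe r s := RingQuot.mkAlgHom ℂ _ (FreeAlgebra.ι ℂ (.x i))

/-- The generator `K_i` of `U^≤`, as a unit with inverse `K_i⁻¹`. -/
def K (i : Fin n) : (C.ULe r s)ˣ where
  val := RingQuot.mkAlgHom ℂ _ (FreeAlgebra.ι ℂ (.k i))
  inv := RingQuot.mkAlgHom ℂ _ (FreeAlgebra.ι ℂ (.kinv i))
  val_inv := by
    rw [← map_mul, RingQuot.mkAlgHom_rel ℂ (RelLe.k_kinv i), map_one]
  inv_val := by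
    rw [← map_mul, RingQuot.mkAlgHom_rel ℂ (RelLe.kinv_k i), map_one]

/-- `K'_l = ∏ K'_i ^ (l i)` for `l` in the root lattice. -/
def K'prod (l : Fin n → ℤ) : (C.UGe r s)ˣ := (List.ofFn fun i => C.K' r s i ^ l i).prod

/-- `K_l = ∏ K_i ^ (l i)` for `l` in the root lattice. -/
def Kprod (l : Fin n → ℤ) : (C.ULe r s)ˣ := (List.ofFn fun i => C.K r s i ^ l i).prod

/-- The Hopf algebra structures on `U^≥` and `U^≤` and the skew Hopf pairing between them with the
prescribed values on the generators. Each of these maps is determined by these values and the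
axioms. -/
structure HopfPairing where
  /-- The Hopf algebra structure of `U^≥`. -/
  ge : HopfStructure (C.UGe r s)
  /-- The Hopf algebra structure of `U^≤`. -/
  le : HopfStructure (C.ULe r s)
  /-- The pairing. -/
  φ : C.UGe r s →ₗ[ℂ] C.ULe r s →ₗ[ℂ] ℂ
  comul_K' : ∀ i, ge.comul (C.K' r s i) = (C.K' r s i : C.UGe r s) ⊗ₜ (C.K' r s i : C.UGe r s)
  comul_E : ∀ i, ge.comul (C.E r s i) =
    C.E r s i ⊗ₜ (C.K' r s i : C.UGe r s) + 1 ⊗ₜ C.E r s i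
  counit_K' : ∀ i, ge.counit (C.K' r s i) = 1
  counit_E : ∀ i, ge.counit (C.E r s i) = 0
  antipode_K' : ∀ i, ge.antipode (C.K' r s i) = ((C.K' r s i)⁻¹ : (C.UGe r s)ˣ)
  antipode_E : ∀ i, ge.antipode (C.E r s i) = -(C.E r s i * ((C.K' r s i)⁻¹ : (C.UGe r s)ˣ))
  comul_K : ∀ i, le.comul (C.K r s i) = (C.K r s i : C.ULe r s) ⊗ₜ (C.K r s i : C.ULe r s)
  comul_F : ∀ i, le.comul (C.F r s i) =
    C.F r s i ⊗ₜ 1 + (C.K r s i : C.ULe r s) ⊗ₜ C.F r s i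
  counit_K : ∀ i, le.counit (C.K r s i) = 1
  counit_F : ∀ i, le.counit (C.F r s i) = 0
  antipode_K : ∀ i, le.antipode (C.K r s i) = ((C.K r s i)⁻¹ : (C.ULe r s)ˣ)
  antipode_F : ∀ i, le.antipode (C.F r s i) = -(((C.K r s i)⁻¹ : (C.ULe r s)ˣ) * C.F r s i)
  isSkewHopfPairing : IsSkewHopfPairing ge le φ
  φ_E_F : ∀ i j, φ (C.E r s i) (C.F r s j) =
    if i = j then 1 / (s ^ C.d i - r ^ C.d i) else 0
  φ_K'_K : ∀ l m, φ (C.K'prod r s l) (C.Kprod r s m) =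
    r ^ C.eulerForm l m * s ^ (-C.eulerForm m l)
  φ_E_K : ∀ i j, φ (C.E r s i) (C.K r s j) = 0
  φ_K'_F : ∀ i j, φ (C.K' r s i) (C.F r s j) = 0

/-- The element `e'_i = (s_i - r_i) ω'_i⁻¹ e_i` of `U^≥`, where `e_i = E_i` and `ω'_i = K'_i`. -/
def e' (i : Fin n) : C.UGe r s :=
  (s ^ C.d i - r ^ C.d i) • (((C.K' r s i)⁻¹ : (C.UGe r s)ˣ) * C.E r s i)

variable {C r s}

namespace HopfPairing

variable (P : C.HopfPairing r s)

/-- The two-parameter quantum group `U_{r,s}`, realized as the quantum double. -/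
def quantumGroup : BialgData (C.UGe r s ⊗[ℂ] C.ULe r s) := quantumDouble P.ge P.le P.φ

/-- The product of the two-parameter Kashiwara algebra `B_{r,s}`, realized as the Heisenberg
double. -/
def kashiwaraMul :
    (C.ULe r s ⊗[ℂ] C.UGe r s) ⊗[ℂ] (C.ULe r s ⊗[ℂ] C.UGe r s) →ₗ[ℂ]
      C.ULe r s ⊗[ℂ] C.UGe r s :=
  heisenbergMul P.ge P.le P.φ

/-- The unit `1 ♯ 1` of `B_{r,s}`. -/
def kashiwaraOne (_P : C.HopfPairing r s) : C.ULe r s ⊗[ℂ] C.UGe r s := 1 ⊗ₜ 1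

/-- The action of `U_{r,s}` on `B_{r,s}`. -/
def kashiwaraAction :
    C.UGe r s ⊗[ℂ] C.ULe r s →ₗ[ℂ]
      C.ULe r s ⊗[ℂ] C.UGe r s →ₗ[ℂ] C.ULe r s ⊗[ℂ] C.UGe r s :=
  heisenbergAction P.ge P.le P.φ

/-- The coaction of `U_{r,s}` on `B_{r,s}`. -/
def kashiwaraCoaction :
    C.ULe r s ⊗[ℂ] C.UGe r s →ₗ[ℂ]
      (C.UGe r s ⊗[ℂ] C.ULe r s) ⊗[ℂ] (C.ULe r s ⊗[ℂ] C.UGe r s) :=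
  heisenbergCoaction P.ge P.le P.φ

/-- The two-parameter quantized Weyl algebra `W_{r,s}`: the subalgebra of `B_{r,s}` generated by
the elements `1 ♯ e'_i` and `f_i ♯ 1`, where `f_i = F_i`. -/
def weyl : Submodule ℂ (C.ULe r s ⊗[ℂ] C.UGe r s) :=
  subalgebraGenerated P.kashiwaraMul P.kashiwaraOne
    (Set.range (fun i => (1 : C.ULe r s) ⊗ₜ[ℂ] C.e' r s i) ∪
      Set.range (fun i => C.F r s i ⊗ₜ[ℂ] (1 : C.UGe r s)))

end HopfPairing

end CartanDatum

end TwoParam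

end

/-!
Everything except the behaviour on generators is a statement about a skew Hopf pairing `φ` of two
Hopf algebras `A = U^≥` and `B = U^≤`. The computations take place in convolution algebras
`Hom(A ⊗ B, R)`: homomorphisms `f : A → R` and `g : B → R` become elements of this algebra
(`inl B (hom f)` and `inr A (hom g)`), invertible through the antipode, and `φ` becomes an
invertible element. The commutation rule of the Heisenberg double reads `f g = φ g f` (`IsHeis`),
that of the quantum double `φ g f = f g φ` (`IsDbl`), so Sweedler calculus turns into rearranging
products.

* *The Heisenberg double* `H` is associative because it embeds in `End(B) ⊗ A`: there `A` acts on
  `B` by `a · y = ∑ φ(a, y₁) y₂`, twisted by the comultiplication, and `B` by left multiplication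
  (`isHeis_repr`, `prodMap_repr_injective`).
* *The quantum double* `D`. Taking inverses in `f g = φ g f` shows that `f ∘ S` and `g ∘ S` satisfy
  `g f = f g φ` in the opposite algebra (`isDbl_op_antipode`). Hence `a ↦ ∑ a₁ ⊗ S(a₂)ᵒᵖ` and
  `b ↦ ∑ b₁ ⊗ S(b₂)ᵒᵖ`, with values in `H ⊗ Hᵒᵖ`, satisfy the rule of `D`
  (`isDbl_adjointHom`). The resulting map from `D` is injective (`prodMap_adjointHom_injective`), so
  that `D` is associative, and through it `D` acts on `H`, an element `k` of `A` or `B` by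
  `x ↦ ∑ k₁ x S(k₂)`. An action of this form is that of a module algebra.
* *The coaction*. The rules are compatible with comultiplications (`IsDbl.isDbl_split`,
  `IsDbl.isHeis_split`). This gives the comultiplication of `D`, and it makes the coaction
  `H → D ⊗ H` a homomorphism of algebras. The Yetter-Drinfeld condition is multiplicative in the
  element of `D` (`yd_mul`); for an element `k` of `A` or `B` it is
  `δ(k₁ v S(k₂)) = δ(k₁) δ(v) δ(S(k₂))` (`yd_split`).
* *The quantized Weyl algebra* is generated by elements `x` with `Δ(x) = x ⊗ 1 + g ⊗ x`, which makes
  it stable under the coaction. It is stable under conjugation by the `K_i`, `K'_i`, and then under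
  the twisted derivations by which the `E_i` and `F_i` act, as is seen on generators (`dblAct_mem`).

Existence of the Hopf algebras and of the pairing rests on one computation. By the `v`-binomial
theorem a quantum Serre relation says that the composite of the commuting operators
`w ↦ x w - v^t c w x`, `0 ≤ t < N`, annihilates `z` (`serre`, `serre_eq_sum`). For `x = x₁ + x₂` and
`z = z₁ + z₂` with summands that commute up to the appropriate scalars, the mixed terms vanish
(`serre_add_add`), so the comultiplication respects the Serre relations. For the pairing, let the
functionals `χ_j = φ(-, K_j)` and `ξ_j = φ(-, F_j)` on `U^≥` be the lower diagonal and the upper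
right entry of a representation by triangular `2 × 2` matrices (`exists_skewDerivation`). In the
convolution algebra of functionals they satisfy the relations of `U^≤`, because the defect of each
relation that involves the `ξ_j` is a skew derivation that vanishes on the generators
(`DualGenerators.eq_zero_of_skew`). They therefore define a homomorphism `ψ` from `U^≤` to the
functionals, and `φ(a, b) = ψ(b)(a)`.
-/

noncomputable section

namespace TwoParam

open Coalgebra WithConv HopfAlgebra MulOpposite

/-! ### Convolution algebras -/

/-- The convolution algebra of linear maps from a coalgebra `C` to an algebra `R`. -/
abbrev Conv (C R : Type*) [AddCommMonoid C] [Module ℂ C] [AddCommMonoid R] [Module ℂ R] : Type _ :=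
  WithConv (C →ₗ[ℂ] R)

section Convolution

variable {C R R' : Type*} [AddCommGroup C] [Module ℂ C] [Coalgebra ℂ C]
  [Ring R] [Algebra ℂ R] [Ring R'] [Algebra ℂ R']

omit [Coalgebra ℂ C] in
theorem conv_ext {u v : Conv C R} (h : ∀ c, u c = v c) : u = v :=
  WithConv.ext (LinearMap.ext h)

/-- Composition of an element of a convolution algebra with a linear map. -/
def convMap (F : R →ₗ[ℂ] R') (u : Conv C R) : Conv C R' := toConv (F ∘ₗ u.ofConv)

omit [Coalgebra ℂ C] in
@[simp] theorem convMap_apply (F : R →ₗ[ℂ] R') (u : Conv C R) (c : C) :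
    convMap F u c = F (u c) := rfl

theorem convMap_mul (F : R →ₐ[ℂ] R') (u v : Conv C R) :
    convMap F.toLinearMap (u * v) = convMap F.toLinearMap u * convMap F.toLinearMap v := by
  refine conv_ext fun c => ?_
  rw [convMap_apply, (ℛ ℂ c).convMul_apply, (ℛ ℂ c).convMul_apply]
  simp

theorem convMap_one (F : R →ₐ[ℂ] R') :
    convMap F.toLinearMap (1 : Conv C R) = 1 := by
  refine conv_ext fun c => ?_
  simp

/-- A functional on `C`, as an element of the convolution algebra of `C` with values in `R`. -/
def scalar (R : Type*) [Ring R] [Algebra ℂ R] (f : Conv C ℂ) : Conv C R :=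
  toConv (Algebra.linearMap ℂ R ∘ₗ f.ofConv)

omit [Coalgebra ℂ C] in
@[simp] theorem scalar_apply (f : Conv C ℂ) (c : C) : scalar R f c = algebraMap ℂ R (f c) := rfl

theorem scalar_mul (f g : Conv C ℂ) : scalar R (f * g) = scalar R f * scalar R g :=
  convMap_mul (Algebra.ofId ℂ R) f g

theorem scalar_one : scalar R (1 : Conv C ℂ) = 1 :=
  convMap_one (Algebra.ofId ℂ R)

theorem convMap_scalar_mul (F : R →ₗ[ℂ] R') (f : Conv C ℂ) (u : Conv C R) :
    convMap F (scalar R f * u) = scalar R' f * convMap F u := by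
  refine conv_ext fun c => ?_
  rw [convMap_apply, (ℛ ℂ c).convMul_apply, (ℛ ℂ c).convMul_apply]
  simp [← Algebra.smul_def]

theorem convMap_mul_scalar (F : R →ₗ[ℂ] R') (f : Conv C ℂ) (u : Conv C R) :
    convMap F (u * scalar R f) = convMap F u * scalar R' f := by
  refine conv_ext fun c => ?_
  rw [convMap_apply, (ℛ ℂ c).convMul_apply, (ℛ ℂ c).convMul_apply]
  simp [← Algebra.commutes, ← Algebra.smul_def]

omit [Coalgebra ℂ C] in
theorem convMap_scalar (F : R →ₐ[ℂ] R') (f : Conv C ℂ) :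
    convMap F.toLinearMap (scalar R f) = scalar R' f :=
  conv_ext fun c => by simp

/-- The counit axiom, after application of a linear map. -/
theorem sum_counit_smul_map {M : Type*} [AddCommGroup M] [Module ℂ M] (f : C →ₗ[ℂ] M) (c : C) :
    ∑ i ∈ (ℛ ℂ c).index, counit (R := ℂ) ((ℛ ℂ c).left i) • f ((ℛ ℂ c).right i) = f c := by
  conv_rhs => rw [← sum_counit_smul (ℛ ℂ c)]
  simp

/-- The counit axiom, after application of a linear map. -/
theorem sum_map_smul_counit {M : Type*} [AddCommGroup M] [Module ℂ M] (f : C →ₗ[ℂ] M) (c : C) :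
    ∑ i ∈ (ℛ ℂ c).index, counit (R := ℂ) ((ℛ ℂ c).right i) • f ((ℛ ℂ c).left i) = f c := by
  have h := congrArg (TensorProduct.rid ℂ C) (sum_tmul_counit_eq (ℛ ℂ c))
  simp only [map_sum, TensorProduct.rid_tmul, one_smul] at h
  conv_rhs => rw [← h]
  simp

/-- The constant `x`, as an element of the convolution algebra. -/
def const (C : Type*) [AddCommGroup C] [Module ℂ C] [Coalgebra ℂ C] (x : R) : Conv C R :=
  toConv (LinearMap.toSpanSingleton ℂ R x ∘ₗ counit)

@[simp] theorem const_apply (x : R) (c : C) : const C x c = counit (R := ℂ) c • x := rfl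

theorem mul_const_apply (u : Conv C R) (x : R) (c : C) : (u * const C x) c = u c * x := by
  rw [(ℛ ℂ c).convMul_apply]
  conv_rhs => rw [← sum_map_smul_counit u.ofConv c]
  simp [Finset.sum_mul]

end Convolution

section TensorConvolution

variable {A B R R' : Type*} [AddCommGroup A] [Module ℂ A] [Coalgebra ℂ A]
  [AddCommGroup B] [Module ℂ B] [Coalgebra ℂ B] [Ring R] [Algebra ℂ R] [Ring R'] [Algebra ℂ R']

omit [Coalgebra ℂ A] [Coalgebra ℂ B] in
theorem conv_tensor_ext {u v : Conv (A ⊗[ℂ] B) R} (h : ∀ a b, u (a ⊗ₜ b) = v (a ⊗ₜ b)) : u = v :=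
  WithConv.ext (TensorProduct.ext' h)

/-- Inflation of a linear map on `A` to `A ⊗ B`: `a ⊗ b ↦ ε(b) f(a)`. -/
def inl (B : Type*) [AddCommGroup B] [Module ℂ B] [Coalgebra ℂ B] (f : Conv A R) :
    Conv (A ⊗[ℂ] B) R :=
  toConv (f.ofConv ∘ₗ (TensorProduct.rid ℂ A).toLinearMap ∘ₗ (counit (R := ℂ)).lTensor A)

/-- Inflation of a linear map on `B` to `A ⊗ B`: `a ⊗ b ↦ ε(a) g(b)`. -/
def inr (A : Type*) [AddCommGroup A] [Module ℂ A] [Coalgebra ℂ A] (g : Conv B R) :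
    Conv (A ⊗[ℂ] B) R :=
  toConv (g.ofConv ∘ₗ (TensorProduct.lid ℂ B).toLinearMap ∘ₗ (counit (R := ℂ)).rTensor B)

omit [Coalgebra ℂ A] in
@[simp] theorem inl_apply (f : Conv A R) (a : A) (b : B) :
    inl B f (a ⊗ₜ b) = counit (R := ℂ) b • f a := by simp [inl]

omit [Coalgebra ℂ B] in
@[simp] theorem inr_apply (g : Conv B R) (a : A) (b : B) :
    inr A g (a ⊗ₜ b) = counit (R := ℂ) a • g b := by simp [inr]

theorem conv_tensor_apply (u v : Conv (A ⊗[ℂ] B) R) (a : A) (b : B) :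
    (u * v) (a ⊗ₜ b) = ∑ i ∈ (ℛ ℂ a).index, ∑ j ∈ (ℛ ℂ b).index,
      u ((ℛ ℂ a).left i ⊗ₜ (ℛ ℂ b).left j) * v ((ℛ ℂ a).right i ⊗ₜ (ℛ ℂ b).right j) := by
  rw [LinearMap.convMul_apply, TensorProduct.comul_tmul]
  conv_lhs => rw [← (ℛ ℂ a).eq, ← (ℛ ℂ b).eq]
  simp only [TensorProduct.sum_tmul, TensorProduct.tmul_sum, map_sum,
    TensorProduct.AlgebraTensorModule.tensorTensorTensorComm_tmul, TensorProduct.map_tmul,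
    LinearMap.mul'_apply]
  exact Finset.sum_comm

theorem sum_counit_mul_counit (b : B) :
    ∑ j ∈ (ℛ ℂ b).index, counit (R := ℂ) ((ℛ ℂ b).left j) * counit ((ℛ ℂ b).right j) =
      counit (R := ℂ) b := by
  simpa using sum_counit_smul_map (counit (R := ℂ)) b

theorem inl_mul (f g : Conv A R) : inl B (f * g) = inl B f * inl B g := by
  refine conv_tensor_ext fun a b => ?_
  rw [conv_tensor_apply, inl_apply, (ℛ ℂ a).convMul_apply, ← sum_counit_mul_counit b]
  simp only [inl_apply, smul_mul_smul_comm, ← Finset.sum_smul, Finset.smul_sum]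

theorem inr_mul (f g : Conv B R) : inr A (f * g) = inr A f * inr A g := by
  refine conv_tensor_ext fun a b => ?_
  rw [conv_tensor_apply, inr_apply, (ℛ ℂ b).convMul_apply, ← sum_counit_mul_counit a]
  simp only [inr_apply, smul_mul_smul_comm, Finset.sum_smul, Finset.smul_sum]
  exact Finset.sum_comm

theorem inl_one : inl B (1 : Conv A R) = 1 :=
  conv_tensor_ext fun a b => by
    simp [Algebra.algebraMap_eq_smul_one, smul_smul]

theorem inr_one : inr A (1 : Conv B R) = 1 :=
  conv_tensor_ext fun a b => by
    simp [Algebra.algebraMap_eq_smul_one, smul_smul, mul_comm]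

omit [Coalgebra ℂ A] in
theorem convMap_inl (F : R →ₗ[ℂ] R') (f : Conv A R) :
    convMap F (inl B f) = inl B (convMap F f) := rfl

omit [Coalgebra ℂ B] in
theorem convMap_inr (F : R →ₗ[ℂ] R') (f : Conv B R) :
    convMap F (inr A f) = inr A (convMap F f) := rfl

theorem inl_mul_inr_apply (f : Conv A R) (g : Conv B R) (a : A) (b : B) :
    (inl B f * inr A g) (a ⊗ₜ b) = f a * g b := by
  rw [conv_tensor_apply, ← sum_map_smul_counit f.ofConv a, ← sum_counit_smul_map g.ofConv b,
    Finset.sum_mul_sum]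
  simp [mul_comm, smul_smul]

theorem inr_mul_inl_apply (f : Conv A R) (g : Conv B R) (a : A) (b : B) :
    (inr A g * inl B f) (a ⊗ₜ b) = g b * f a := by
  rw [conv_tensor_apply, ← sum_counit_smul_map f.ofConv a, ← sum_map_smul_counit g.ofConv b,
    Finset.sum_mul_sum, Finset.sum_comm]
  simp [mul_comm, smul_smul]

theorem inl_inr_comm (f : Conv A R) (g : Conv B R) (h : ∀ a b, Commute (f a) (g b)) :
    inl B f * inr A g = inr A g * inl B f :=
  conv_tensor_ext fun a b => by rw [inl_mul_inr_apply, inr_mul_inl_apply, (h a b).eq]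

end TensorConvolution

/-! ### Hopf algebras and homomorphisms in convolution algebras -/

/-- A Hopf algebra with invertible antipode, as a class; it puts Mathlib's Hopf algebra structure
on `A`. -/
class HopfStr (A : Type*) [Ring A] [Algebra ℂ A] where
  str : HopfStructure A

section HopfStr

variable {A : Type*} [Ring A] [Algebra ℂ A] [HopfStr A]

instance instHopfAlgebra : HopfAlgebra ℂ A where
  comul := (HopfStr.str (A := A)).comul.toLinearMap
  counit := (HopfStr.str (A := A)).counit.toLinearMap
  coassoc := LinearMap.ext (HopfStr.str (A := A)).isCoalgebra.coassoc
  rTensor_counit_comp_comul := LinearMap.ext fun x => (TensorProduct.lid ℂ A).injective <| by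
    simpa using (HopfStr.str (A := A)).isCoalgebra.counit_left x
  lTensor_counit_comp_comul := LinearMap.ext fun x => (TensorProduct.rid ℂ A).injective <| by
    simpa using (HopfStr.str (A := A)).isCoalgebra.counit_right x
  counit_one := map_one (HopfStr.str (A := A)).counit
  mul_compr₂_counit := by ext; simp
  comul_one := map_one (HopfStr.str (A := A)).comul
  mul_compr₂_comul := by ext; simp
  antipode := (HopfStr.str (A := A)).antipode.toLinearMap
  mul_antipode_rTensor_comul := LinearMap.ext (HopfStr.str (A := A)).antipode_left
  mul_antipode_lTensor_comul := LinearMap.ext (HopfStr.str (A := A)).antipode_right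

/-- The inverse of the antipode. -/
def invAntipode (A : Type*) [Ring A] [Algebra ℂ A] [HopfStr A] : A →ₗ[ℂ] A :=
  (HopfStr.str (A := A)).antipode.symm.toLinearMap

theorem antipode_invAntipode (a : A) : antipode ℂ (invAntipode A a) = a :=
  (HopfStr.str (A := A)).antipode.apply_symm_apply a

theorem antipode_injective : Function.Injective (antipode ℂ : A →ₗ[ℂ] A) :=
  (HopfStr.str (A := A)).antipode.injective

/-- The inverse of the antipode is an antipode for the opposite comultiplication. -/
theorem sum_invAntipode_mul (a : A) :
    ∑ i ∈ (ℛ ℂ a).index, invAntipode A ((ℛ ℂ a).right i) * (ℛ ℂ a).left i =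
      counit (R := ℂ) a • 1 := by
  apply antipode_injective
  simpa [antipode_mul_antidistrib, antipode_invAntipode] using sum_antipode_mul_eq_smul (ℛ ℂ a)

theorem sum_mul_invAntipode (a : A) :
    ∑ i ∈ (ℛ ℂ a).index, (ℛ ℂ a).right i * invAntipode A ((ℛ ℂ a).left i) =
      counit (R := ℂ) a • 1 := by
  apply antipode_injective
  simpa [antipode_mul_antidistrib, antipode_invAntipode] using sum_mul_antipode_eq_smul (ℛ ℂ a)

variable {R : Type*} [Ring R] [Algebra ℂ R]

/-- An algebra homomorphism, as an element of the convolution algebra. -/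
def hom (f : A →ₐ[ℂ] R) : Conv A R := toConv f.toLinearMap

/-- The convolution inverse `f ∘ S` of an algebra homomorphism `f`. -/
def homInv (f : A →ₐ[ℂ] R) : Conv A R := toConv (f.toLinearMap ∘ₗ antipode ℂ)

omit [HopfStr A] in
@[simp] theorem hom_apply (f : A →ₐ[ℂ] R) (a : A) : hom f a = f a := rfl

@[simp] theorem homInv_apply (f : A →ₐ[ℂ] R) (a : A) : homInv f a = f (antipode ℂ a) := rfl

theorem hom_mul_homInv (f : A →ₐ[ℂ] R) : hom f * homInv f = 1 := by
  have h := congrArg (convMap f.toLinearMap) (LinearMap.id_mul_antipode (R := ℂ) (C := A))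
  rwa [convMap_mul, convMap_one] at h

theorem homInv_mul_hom (f : A →ₐ[ℂ] R) : homInv f * hom f = 1 := by
  have h := congrArg (convMap f.toLinearMap) (LinearMap.antipode_mul_id (R := ℂ) (C := A))
  rwa [convMap_mul, convMap_one] at h

variable {R₁ R₂ : Type*} [Ring R₁] [Algebra ℂ R₁] [Ring R₂] [Algebra ℂ R₂]

/-- The homomorphism `a ↦ ∑ f(a₁) ⊗ g(a₂)`. -/
def split (f : A →ₐ[ℂ] R₁) (g : A →ₐ[ℂ] R₂) : A →ₐ[ℂ] R₁ ⊗[ℂ] R₂ :=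
  (Algebra.TensorProduct.map f g).comp (Bialgebra.comulAlgHom ℂ A)

/-- The homomorphism `x ↦ x ⊗ 1`. -/
abbrev incL (R₁ R₂ : Type*) [Ring R₁] [Algebra ℂ R₁] [Ring R₂] [Algebra ℂ R₂] :
    R₁ →ₐ[ℂ] R₁ ⊗[ℂ] R₂ := Algebra.TensorProduct.includeLeft

/-- The homomorphism `x ↦ 1 ⊗ x`. -/
abbrev incR (R₁ R₂ : Type*) [Ring R₁] [Algebra ℂ R₁] [Ring R₂] [Algebra ℂ R₂] :
    R₂ →ₐ[ℂ] R₁ ⊗[ℂ] R₂ := Algebra.TensorProduct.includeRight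

theorem split_apply (f : A →ₐ[ℂ] R₁) (g : A →ₐ[ℂ] R₂) (a : A) :
    split f g a = ∑ i ∈ (ℛ ℂ a).index, f ((ℛ ℂ a).left i) ⊗ₜ g ((ℛ ℂ a).right i) := by
  rw [split, AlgHom.comp_apply, Bialgebra.comulAlgHom_apply]
  conv_lhs => rw [← (ℛ ℂ a).eq]
  simp

theorem hom_split (f : A →ₐ[ℂ] R₁) (g : A →ₐ[ℂ] R₂) :
    hom (split f g) = hom ((incL R₁ R₂).comp f) * hom ((incR R₁ R₂).comp g) := by
  refine conv_ext fun a => ?_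
  rw [(ℛ ℂ a).convMul_apply, hom_apply, split_apply]
  simp

theorem homInv_split (f : A →ₐ[ℂ] R₁) (g : A →ₐ[ℂ] R₂) :
    homInv (split f g) = homInv ((incR R₁ R₂).comp g) * homInv ((incL R₁ R₂).comp f) := by
  refine left_inv_eq_right_inv (homInv_mul_hom _) ?_
  rw [hom_split, mul_assoc, ← mul_assoc (hom ((incR R₁ R₂).comp g)), hom_mul_homInv, one_mul,
    hom_mul_homInv]

/-- Left multiplication through `f`, together with right multiplication by the antipode: the
homomorphism `a ↦ ∑ f(a₁) ⊗ f(S(a₂))ᵒᵖ`. -/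
def adjointHom (f : A →ₐ[ℂ] R) : A →ₐ[ℂ] R ⊗[ℂ] Rᵐᵒᵖ :=
  split f (f.op.comp (antipodeAlgHomOp ℂ A))

end HopfStr

/-! ### Skew Hopf pairings and their commutation rules -/

/-- A skew Hopf pairing between Hopf algebras with invertible antipode. -/
structure SkewPairing (A B : Type*) [Ring A] [Algebra ℂ A] [Ring B] [Algebra ℂ B]
    [HopfStr A] [HopfStr B] where
  form : A →ₗ[ℂ] B →ₗ[ℂ] ℂ
  isSkew : IsSkewHopfPairing HopfStr.str HopfStr.str form

namespace SkewPairing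

variable {A B : Type*} [Ring A] [Algebra ℂ A] [Ring B] [Algebra ℂ B] [HopfStr A] [HopfStr B]
  (P : SkewPairing A B)

theorem form_mul_right (a : A) (b b' : B) :
    P.form a (b * b') =
      ∑ i ∈ (ℛ ℂ a).index, P.form ((ℛ ℂ a).left i) b * P.form ((ℛ ℂ a).right i) b' := by
  rw [P.isSkew.apply_mul]
  change LinearMap.mul' ℂ ℂ (TensorProduct.map _ _ (comul a)) = _
  conv_lhs => rw [← (ℛ ℂ a).eq]
  simp

theorem form_mul_left (a a' : A) (b : B) :
    P.form (a * a') b =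
      ∑ i ∈ (ℛ ℂ b).index, P.form a' ((ℛ ℂ b).left i) * P.form a ((ℛ ℂ b).right i) := by
  rw [P.isSkew.mul_apply]
  change LinearMap.mul' ℂ ℂ (TensorProduct.map _ _ (comul b)) = _
  conv_lhs => rw [← (ℛ ℂ b).eq]
  simp

theorem form_one_right (a : A) : P.form a 1 = counit (R := ℂ) a := P.isSkew.apply_one a

theorem form_one_left (b : B) : P.form 1 b = counit (R := ℂ) b := P.isSkew.one_apply b

/-- The pairing, as an element of the convolution algebra of `A ⊗ B`. -/
def val : Conv (A ⊗[ℂ] B) ℂ := toConv (TensorProduct.lift P.form)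

/-- The convolution inverse `a ⊗ b ↦ φ(S⁻¹(a), b)` of the pairing. -/
def inv : Conv (A ⊗[ℂ] B) ℂ := toConv (TensorProduct.lift P.form ∘ₗ (invAntipode A).rTensor B)

@[simp] theorem val_apply (a : A) (b : B) : P.val (a ⊗ₜ b) = P.form a b := rfl

@[simp] theorem inv_apply (a : A) (b : B) : P.inv (a ⊗ₜ b) = P.form (invAntipode A a) b := rfl

theorem val_mul_inv : P.val * P.inv = 1 := by
  refine conv_tensor_ext fun a b => ?_
  rw [conv_tensor_apply]
  simp only [val_apply, inv_apply, ← form_mul_left]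
  rw [← LinearMap.sum_apply, ← map_sum, sum_invAntipode_mul]
  simp [form_one_left, mul_comm]

theorem inv_mul_val : P.inv * P.val = 1 := by
  refine conv_tensor_ext fun a b => ?_
  rw [conv_tensor_apply]
  simp only [val_apply, inv_apply, ← form_mul_left]
  rw [← LinearMap.sum_apply, ← map_sum, sum_mul_invAntipode]
  simp [form_one_left, mul_comm]

/-- The inverse of the pairing is also `a ⊗ b ↦ φ(a, S(b))`. -/
theorem inv_eq_antipode_right :
    P.inv = toConv (TensorProduct.lift P.form ∘ₗ (antipode ℂ).lTensor A) := by
  refine left_inv_eq_right_inv P.inv_mul_val ?_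
  refine conv_tensor_ext fun a b => ?_
  rw [conv_tensor_apply, Finset.sum_comm]
  simp only [val_apply, LinearMap.comp_apply, LinearMap.lTensor_tmul, TensorProduct.lift.tmul,
    ← form_mul_right]
  rw [← map_sum, sum_mul_antipode_eq_smul]
  simp [form_one_right, mul_comm]

theorem inv_apply' (a : A) (b : B) : P.inv (a ⊗ₜ b) = P.form a (antipode ℂ b) := by
  rw [inv_eq_antipode_right]; rfl

variable (R : Type*) [Ring R] [Algebra ℂ R]

theorem scalar_val_mul_inv : scalar R P.val * scalar R P.inv = 1 := by
  rw [← scalar_mul, val_mul_inv, scalar_one]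

theorem scalar_inv_mul_val : scalar R P.inv * scalar R P.val = 1 := by
  rw [← scalar_mul, inv_mul_val, scalar_one]

variable {R}

/-- The commutation rule `f(a) g(b) = ∑ φ(a₁, b₁) g(b₂) f(a₂)` of the Heisenberg double, for
homomorphisms `f`, `g` from `A`, `B` to an algebra. -/
def IsHeis (f : A →ₐ[ℂ] R) (g : B →ₐ[ℂ] R) : Prop :=
  inl B (hom f) * inr A (hom g) = scalar R P.val * (inr A (hom g) * inl B (hom f))

/-- The commutation rule `∑ φ(a₁, b₁) g(b₂) f(a₂) = ∑ f(a₁) g(b₁) φ(a₂, b₂)` of the quantum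
double, for homomorphisms `f`, `g` from `A`, `B` to an algebra. -/
def IsDbl (f : A →ₐ[ℂ] R) (g : B →ₐ[ℂ] R) : Prop :=
  scalar R P.val * (inr A (hom g) * inl B (hom f)) =
    inl B (hom f) * inr A (hom g) * scalar R P.val

variable {P}

omit [HopfStr A] in
theorem convMap_hom {R' : Type*} [Ring R'] [Algebra ℂ R'] (F : R →ₐ[ℂ] R') (f : A →ₐ[ℂ] R) :
    convMap F.toLinearMap (hom f) = hom (F.comp f) := rfl

theorem IsHeis.map {R' : Type*} [Ring R'] [Algebra ℂ R'] {f : A →ₐ[ℂ] R} {g : B →ₐ[ℂ] R}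
    (h : P.IsHeis f g) (F : R →ₐ[ℂ] R') : P.IsHeis (F.comp f) (F.comp g) := by
  have := congrArg (convMap F.toLinearMap) h
  simp only [convMap_mul, convMap_scalar, convMap_inl, convMap_inr, convMap_hom] at this
  exact this

theorem IsDbl.map {R' : Type*} [Ring R'] [Algebra ℂ R'] {f : A →ₐ[ℂ] R} {g : B →ₐ[ℂ] R}
    (h : P.IsDbl f g) (F : R →ₐ[ℂ] R') : P.IsDbl (F.comp f) (F.comp g) := by
  have := congrArg (convMap F.toLinearMap) h
  simp only [convMap_mul, convMap_scalar, convMap_inl, convMap_inr, convMap_hom] at this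
  exact this

end SkewPairing

section Twisted

variable {X Y R : Type*} [Ring X] [Algebra ℂ X] [Ring Y] [Algebra ℂ Y] [Ring R] [Algebra ℂ R]

/-- The linear map `x ⊗ y ↦ f(x) g(y)`. -/
def prodMap (f : X →ₐ[ℂ] R) (g : Y →ₐ[ℂ] R) : X ⊗[ℂ] Y →ₗ[ℂ] R :=
  LinearMap.mul' ℂ R ∘ₗ TensorProduct.map f.toLinearMap g.toLinearMap

@[simp] theorem prodMap_tmul (f : X →ₐ[ℂ] R) (g : Y →ₐ[ℂ] R) (x : X) (y : Y) :
    prodMap f g (x ⊗ₜ y) = f x * g y := by simp [prodMap]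

/-- `(x ⊗ y)(x' ⊗ y')` is `x T(y ⊗ x') y'`. -/
theorem twistedMul_tmul (T : Y ⊗[ℂ] X →ₗ[ℂ] X ⊗[ℂ] Y) (x x' : X) (y y' : Y) :
    twistedMul T ((x ⊗ₜ y) ⊗ₜ (x' ⊗ₜ y')) =
      TensorProduct.map (LinearMap.mulLeft ℂ x) (LinearMap.mulRight ℂ y') (T (y ⊗ₜ x')) := by
  simp only [twistedMul, LinearMap.comp_apply, LinearEquiv.coe_coe,
    TensorProduct.tensorTensorTensorAssoc_tmul, LinearMap.rTensor_tmul, LinearMap.lTensor_tmul]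
  induction T (y ⊗ₜ x') with
  | zero => simp
  | tmul p q => simp
  | add p q hp hq => simp only [TensorProduct.tmul_add, TensorProduct.add_tmul, map_add, hp, hq]

/-- If `f` and `g` satisfy the commutation rule encoded by `T`, then `x ⊗ y ↦ f(x) g(y)` is
multiplicative for the twisted product. -/
theorem prodMap_twistedMul (T : Y ⊗[ℂ] X →ₗ[ℂ] X ⊗[ℂ] Y) (f : X →ₐ[ℂ] R) (g : Y →ₐ[ℂ] R)
    (h : ∀ y x, prodMap f g (T (y ⊗ₜ x)) = g y * f x) (u v : X ⊗[ℂ] Y) :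
    prodMap f g (twistedMul T (u ⊗ₜ v)) = prodMap f g u * prodMap f g v := by
  induction u with
  | zero => simp
  | add p q hp hq => simp only [TensorProduct.add_tmul, map_add, hp, hq, add_mul]
  | tmul x y =>
    induction v with
    | zero => simp
    | add p q hp hq => simp only [TensorProduct.tmul_add, map_add, hp, hq, mul_add]
    | tmul x' y' =>
      rw [twistedMul_tmul, prodMap_tmul, prodMap_tmul, mul_assoc, ← mul_assoc (g y), ← h]
      induction T (y ⊗ₜ x') with
      | zero => simp
      | tmul p q => simp [mul_assoc]
      | add p q hp hq => simp only [map_add, hp, hq, add_mul, mul_add]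

/-- A twisted product is associative and unital as soon as it is realized by products in an
algebra. -/
theorem isAlgebra_twistedMul (T : Y ⊗[ℂ] X →ₗ[ℂ] X ⊗[ℂ] Y) (f : X →ₐ[ℂ] R) (g : Y →ₐ[ℂ] R)
    (h : ∀ y x, prodMap f g (T (y ⊗ₜ x)) = g y * f x)
    (hinj : Function.Injective (prodMap f g)) :
    IsAlgebra (twistedMul T) (1 ⊗ₜ 1) where
  one_mul u := hinj (by rw [prodMap_twistedMul T f g h]; simp)
  mul_one u := hinj (by rw [prodMap_twistedMul T f g h]; simp)
  mul_assoc u v w := hinj (by simp only [prodMap_twistedMul T f g h, mul_assoc])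

end Twisted

/-! ### The Heisenberg double acting on `B` -/

section Slice

variable {C : Type*} [AddCommGroup C] [Module ℂ C] [Coalgebra ℂ C]

theorem slice_apply {ι : Type*} (f : C →ₗ[ℂ] ℂ) {c : C} (𝓡 : Coalgebra.Repr ℂ c ι) :
    slice comul f c = ∑ i ∈ 𝓡.index, f (𝓡.left i) • 𝓡.right i := by
  change TensorProduct.lid ℂ C (f.rTensor C (comul c)) = _
  rw [← 𝓡.eq]
  simp

theorem comul_slice (g : C →ₗ[ℂ] ℂ) (c : C) :
    comul (R := ℂ) (slice comul g c) = (slice comul g).rTensor C (comul c) := by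
  let Φ : C ⊗[ℂ] (C ⊗[ℂ] C) →ₗ[ℂ] C ⊗[ℂ] C :=
    (TensorProduct.lid ℂ (C ⊗[ℂ] C)).toLinearMap ∘ₗ g.rTensor (C ⊗[ℂ] C)
  have h1 : ∀ z : C ⊗[ℂ] C, comul (TensorProduct.lid ℂ C (g.rTensor C z)) =
      Φ ((comul (R := ℂ)).lTensor C z) := fun z => by
    induction z with
    | zero => simp
    | tmul x y => simp [Φ]
    | add x y hx hy => simp only [map_add, hx, hy]
  have h2 : ∀ z : C ⊗[ℂ] C, (slice comul g).rTensor C z =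
      Φ (TensorProduct.assoc ℂ C C C ((comul (R := ℂ)).rTensor C z)) := fun z => by
    induction z with
    | zero => simp
    | add x y hx hy => simp only [map_add, hx, hy]
    | tmul x y =>
      rw [LinearMap.rTensor_tmul, LinearMap.rTensor_tmul, slice_apply g (ℛ ℂ x)]
      conv_rhs => rw [← (ℛ ℂ x).eq]
      simp [Φ, TensorProduct.sum_tmul, TensorProduct.smul_tmul']
  rw [h2, coassoc_apply, ← h1]
  rfl

/-- Slices compose in the reverse order, by coassociativity. -/
theorem slice_slice (f g : C →ₗ[ℂ] ℂ) (c : C) :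
    slice comul f (slice comul g c) = slice comul (toConv g * toConv f).ofConv c := by
  change TensorProduct.lid ℂ C (f.rTensor C (comul (slice comul g c))) =
    TensorProduct.lid ℂ C ((toConv g * toConv f).ofConv.rTensor C (comul c))
  rw [comul_slice, ← LinearMap.comp_apply (f.rTensor C), ← LinearMap.rTensor_comp]
  congr 3
  ext x
  rw [LinearMap.comp_apply, slice_apply g (ℛ ℂ x), (ℛ ℂ x).convMul_apply]
  simp

end Slice

namespace SkewPairing

variable {A B : Type*} [Ring A] [Algebra ℂ A] [Ring B] [Algebra ℂ B] [HopfStr A] [HopfStr B]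
  (P : SkewPairing A B) {R : Type*} [Ring R] [Algebra ℂ R]

/-- The representation `a · y = ∑ φ(a, y₁) y₂` of `A` on `B`. -/
def sliceHom : A →ₐ[ℂ] Module.End ℂ B :=
  AlgHom.ofLinearMap (slice comul ∘ₗ P.form)
    (LinearMap.ext fun y => by
      have h : P.form 1 = counit (R := ℂ) := LinearMap.ext P.form_one_left
      rw [LinearMap.comp_apply, slice_apply _ (ℛ ℂ y), h, sum_counit_smul]; rfl)
    (fun a a' => LinearMap.ext fun y => by
      rw [LinearMap.comp_apply, LinearMap.comp_apply, LinearMap.comp_apply, Module.End.mul_apply,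
        slice_slice]
      congr 2
      ext b
      rw [(ℛ ℂ b).convMul_apply, form_mul_left])

theorem sliceHom_apply (a : A) (y : B) :
    P.sliceHom a y = ∑ j ∈ (ℛ ℂ y).index, P.form a ((ℛ ℂ y).left j) • (ℛ ℂ y).right j :=
  slice_apply _ _

theorem isHeis_iff (f : A →ₐ[ℂ] R) (g : B →ₐ[ℂ] R) :
    P.IsHeis f g ↔ ∀ a b, f a * g b = ∑ i ∈ (ℛ ℂ a).index, ∑ j ∈ (ℛ ℂ b).index,
      P.form ((ℛ ℂ a).left i) ((ℛ ℂ b).left j) • (g ((ℛ ℂ b).right j) * f ((ℛ ℂ a).right i)) := by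
  have key : ∀ a b, (scalar R P.val * (inr A (hom g) * inl B (hom f))) (a ⊗ₜ b) =
      ∑ i ∈ (ℛ ℂ a).index, ∑ j ∈ (ℛ ℂ b).index, P.form ((ℛ ℂ a).left i) ((ℛ ℂ b).left j) •
        (g ((ℛ ℂ b).right j) * f ((ℛ ℂ a).right i)) := fun a b => by
    rw [conv_tensor_apply]
    simp only [inr_mul_inl_apply, scalar_apply, val_apply, hom_apply, ← Algebra.smul_def]
  refine ⟨fun h a b => ?_, fun h => conv_tensor_ext fun a b => ?_⟩
  · rw [← key, ← h, inl_mul_inr_apply]; rfl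
  · rw [key, ← h, inl_mul_inr_apply]; rfl

/-- On `B` the action of `A` by `a · y = ∑ φ(a, y₁) y₂` and that of `B` by left multiplication
satisfy the commutation rule of the Heisenberg double. -/
theorem isHeis_sliceHom : P.IsHeis P.sliceHom (Algebra.lmul ℂ B) := by
  rw [isHeis_iff]
  refine fun a b => LinearMap.ext fun y => ?_
  simp only [LinearMap.sum_apply, LinearMap.smul_apply, Module.End.mul_apply,
    Algebra.coe_lmul_eq_mul, LinearMap.mul_apply_apply]
  refine (slice_apply _ ((ℛ ℂ b).mul (ℛ ℂ y))).trans ?_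
  simp only [sliceHom_apply, Coalgebra.Repr.mul_index, Coalgebra.Repr.mul_left,
    Coalgebra.Repr.mul_right, Finset.sum_product, form_mul_right, Finset.sum_smul, Finset.mul_sum,
    Finset.smul_sum, mul_smul_comm, smul_smul]
  conv_rhs => rw [Finset.sum_comm]
  exact Finset.sum_congr rfl fun _ _ => Finset.sum_comm

/-- The commutation rule `a ⊗ b ↦ ∑ φ(a₁, b₁) b₂ ⊗ a₂` of the Heisenberg double. -/
abbrev heisTwist : A ⊗[ℂ] B →ₗ[ℂ] B ⊗[ℂ] A :=
  (TensorProduct.lid ℂ (B ⊗[ℂ] A)).toLinearMap ∘ₗ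
    TensorProduct.map (TensorProduct.lift P.form) (TensorProduct.comm ℂ A B).toLinearMap ∘ₗ
    tensorComul HopfStr.str HopfStr.str

theorem tensorComul_eq : tensorComul (HopfStr.str (A := A)) (HopfStr.str (A := B)) = comul :=
  TensorProduct.ext' fun _ _ => rfl

theorem comul_tensor (a : A) (b : B) : comul (R := ℂ) (a ⊗ₜ[ℂ] b) =
    ∑ i ∈ (ℛ ℂ a).index, ∑ j ∈ (ℛ ℂ b).index,
      ((ℛ ℂ a).left i ⊗ₜ[ℂ] (ℛ ℂ b).left j) ⊗ₜ[ℂ] ((ℛ ℂ a).right i ⊗ₜ[ℂ] (ℛ ℂ b).right j) := by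
  rw [TensorProduct.comul_tmul]
  conv_lhs => rw [← (ℛ ℂ a).eq, ← (ℛ ℂ b).eq]
  simp only [TensorProduct.sum_tmul, TensorProduct.tmul_sum, map_sum,
    TensorProduct.AlgebraTensorModule.tensorTensorTensorComm_tmul]
  exact Finset.sum_comm

theorem heisTwist_tmul (a : A) (b : B) : P.heisTwist (a ⊗ₜ b) =
    ∑ i ∈ (ℛ ℂ a).index, ∑ j ∈ (ℛ ℂ b).index, P.form ((ℛ ℂ a).left i) ((ℛ ℂ b).left j) •
      ((ℛ ℂ b).right j ⊗ₜ[ℂ] (ℛ ℂ a).right i) := by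
  simp only [heisTwist, LinearMap.comp_apply, tensorComul_eq, comul_tensor]
  simp

theorem IsHeis.prodMap_heisTwist {P : SkewPairing A B} {f : A →ₐ[ℂ] R} {g : B →ₐ[ℂ] R}
    (h : P.IsHeis f g) (a : A) (b : B) :
    prodMap g f (P.heisTwist (a ⊗ₜ b)) = f a * g b := by
  rw [heisTwist_tmul, (P.isHeis_iff f g).1 h]
  simp

/-- The homomorphism `a ↦ ∑ (a₁ · ) ⊗ a₂` from `A` to `End(B) ⊗ A`. -/
abbrev heisReprA : A →ₐ[ℂ] Module.End ℂ B ⊗[ℂ] A := split P.sliceHom (AlgHom.id ℂ A)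

/-- The homomorphism `b ↦ L_b ⊗ 1` from `B` to `End(B) ⊗ A`, where `L_b` is the multiplication
by `b`. -/
abbrev heisReprB (A B : Type*) [Ring A] [Algebra ℂ A] [Ring B] [Algebra ℂ B] :
    B →ₐ[ℂ] Module.End ℂ B ⊗[ℂ] A :=
  (incL (Module.End ℂ B) A).comp (Algebra.lmul ℂ B)

/-- The Heisenberg rule for `a ↦ a ·` is inherited by `a ↦ ∑ (a₁ ·) ⊗ a₂`, as `1 ⊗ a₂` commutes with
`L_b ⊗ 1`. -/
theorem isHeis_repr : P.IsHeis (R := Module.End ℂ B ⊗[ℂ] A) P.heisReprA (heisReprB A B) := by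
  have h := P.isHeis_sliceHom.map (incL (Module.End ℂ B) A)
  have hc : inl B (hom ((incR (Module.End ℂ B) A).comp (AlgHom.id ℂ A))) *
      inr A (hom (heisReprB A B)) = inr A (hom (heisReprB A B)) *
      inl B (hom ((incR (Module.End ℂ B) A).comp (AlgHom.id ℂ A))) :=
    inl_inr_comm _ _ fun a b => by simp [Commute, SemiconjBy]
  unfold IsHeis at h ⊢
  rw [hom_split, inl_mul, mul_assoc, hc, ← mul_assoc, h]
  simp only [mul_assoc]

/-- The image of `b ⊗ a`, applied to `1 ∈ B` in the first factor, is `b ⊗ a`. -/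
theorem prodMap_repr_injective : Function.Injective
    (prodMap (R := Module.End ℂ B ⊗[ℂ] A) (heisReprB A B) P.heisReprA) := by
  let ev : Module.End ℂ B ⊗[ℂ] A →ₗ[ℂ] B ⊗[ℂ] A :=
    (LinearMap.applyₗ (1 : B) : Module.End ℂ B →ₗ[ℂ] B).rTensor A
  have h : ∀ u, ev (prodMap (R := Module.End ℂ B ⊗[ℂ] A) (heisReprB A B) P.heisReprA u) = u :=
      fun u => by
    induction u with
    | zero => simp
    | add x y hx hy => simp only [map_add, hx, hy]
    | tmul b a =>
      have h1 : ∀ a' : A, P.sliceHom a' 1 = counit (R := ℂ) a' • (1 : B) := fun a' => by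
        change TensorProduct.lid ℂ B ((P.form a').rTensor B (comul (1 : B))) = _
        simp [Algebra.TensorProduct.one_def, form_one_right]
      have h2 := congrArg (b ⊗ₜ[ℂ] ·) (sum_counit_smul (R := ℂ) (ℛ ℂ a))
      simp only [TensorProduct.tmul_sum] at h2
      simp only [prodMap_tmul, split_apply, Finset.mul_sum, map_sum]
      conv_rhs => rw [← h2]
      simp [ev, h1, TensorProduct.smul_tmul]
  exact Function.LeftInverse.injective h

end SkewPairing

/-! ### Twisted products as algebras -/

section Tw

variable {X Y R : Type*} [Ring X] [Algebra ℂ X] [Ring Y] [Algebra ℂ Y] [Ring R] [Algebra ℂ R]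

/-- The space `X ⊗ Y`, as the carrier of the twisted product given by `T`. -/
def Tw (_T : Y ⊗[ℂ] X →ₗ[ℂ] X ⊗[ℂ] Y) : Type _ := X ⊗[ℂ] Y

namespace Tw

variable (T : Y ⊗[ℂ] X →ₗ[ℂ] X ⊗[ℂ] Y)

instance : AddCommGroup (Tw T) := inferInstanceAs (AddCommGroup (X ⊗[ℂ] Y))

instance : Module ℂ (Tw T) := inferInstanceAs (Module ℂ (X ⊗[ℂ] Y))

/-- The identification of `X ⊗ Y` with the twisted product. -/
def of : X ⊗[ℂ] Y ≃ₗ[ℂ] Tw T := LinearEquiv.refl ℂ (X ⊗[ℂ] Y)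

variable [h : Fact (IsAlgebra (twistedMul T) (1 ⊗ₜ 1))]

instance : Mul (Tw T) where
  mul u v := of T (twistedMul T ((of T).symm u ⊗ₜ (of T).symm v))

omit h in
theorem of_mul (u v : X ⊗[ℂ] Y) : of T u * of T v = of T (twistedMul T (u ⊗ₜ v)) := rfl

instance : Ring (Tw T) where
  one := of T (1 ⊗ₜ 1)
  mul_assoc u v w := h.out.mul_assoc u v w
  one_mul u := h.out.one_mul u
  mul_one u := h.out.mul_one u
  zero_mul u := by
    change of T (twistedMul T (0 ⊗ₜ _)) = 0
    rw [TensorProduct.zero_tmul, map_zero, map_zero]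
  mul_zero u := by
    change of T (twistedMul T (_ ⊗ₜ 0)) = 0
    rw [TensorProduct.tmul_zero, map_zero, map_zero]
  left_distrib u v w := by
    change of T (twistedMul T (_ ⊗ₜ ((of T).symm v + (of T).symm w))) = _
    rw [TensorProduct.tmul_add, map_add, map_add]; rfl
  right_distrib u v w := by
    change of T (twistedMul T (((of T).symm u + (of T).symm v) ⊗ₜ _)) = _
    rw [TensorProduct.add_tmul, map_add, map_add]; rfl
  zsmul := zsmulRec
  neg_add_cancel u := neg_add_cancel u

instance : Algebra ℂ (Tw T) :=
  Algebra.ofModule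
    (fun c u v => by
      change of T (twistedMul T ((c • (of T).symm u) ⊗ₜ _)) = _
      rw [← TensorProduct.smul_tmul', map_smul, map_smul]; rfl)
    (fun c u v => by
      change of T (twistedMul T (_ ⊗ₜ (c • (of T).symm v))) = _
      rw [TensorProduct.tmul_smul, map_smul, map_smul]; rfl)

theorem twist_one_left (x : X) : T (1 ⊗ₜ x) = x ⊗ₜ 1 := by
  have := h.out.one_mul (x ⊗ₜ 1)
  rw [twistedMul_tmul] at this
  simpa using this

theorem twist_one_right (y : Y) : T (y ⊗ₜ 1) = 1 ⊗ₜ y := by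
  have := h.out.mul_one (1 ⊗ₜ y)
  rw [twistedMul_tmul] at this
  simpa using this

/-- The inclusion of the left factor. -/
def left : X →ₐ[ℂ] Tw T :=
  AlgHom.ofLinearMap ((of T).toLinearMap ∘ₗ (TensorProduct.mk ℂ X Y).flip 1) rfl fun x x' => by
    simp only [LinearMap.comp_apply, LinearEquiv.coe_coe, LinearMap.flip_apply,
      TensorProduct.mk_apply, of_mul, twistedMul_tmul, twist_one_left]
    simp

/-- The inclusion of the right factor. -/
def right : Y →ₐ[ℂ] Tw T :=
  AlgHom.ofLinearMap ((of T).toLinearMap ∘ₗ TensorProduct.mk ℂ X Y 1) rfl fun y y' => by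
    simp only [LinearMap.comp_apply, LinearEquiv.coe_coe,
      TensorProduct.mk_apply, of_mul, twistedMul_tmul, twist_one_right]
    simp

theorem left_apply (x : X) : left T x = of T (x ⊗ₜ 1) := rfl

theorem right_apply (y : Y) : right T y = of T (1 ⊗ₜ y) := rfl

theorem left_mul_right (x : X) (y : Y) : left T x * right T y = of T (x ⊗ₜ y) := by
  rw [left_apply, right_apply, of_mul, twistedMul_tmul, twist_one_left]
  simp

theorem right_mul_left (x : X) (y : Y) : right T y * left T x = of T (T (y ⊗ₜ x)) := by
  rw [left_apply, right_apply, of_mul, twistedMul_tmul]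
  simp

theorem prodMap_left_right : prodMap (left T) (right T) = (of T).toLinearMap :=
  TensorProduct.ext' fun x y => by simp [left_mul_right]

variable {T}

@[elab_as_elim]
theorem induction_on {p : Tw T → Prop} (u : Tw T) (zero : p 0)
    (mul : ∀ x y, p (left T x * right T y)) (add : ∀ u v, p u → p v → p (u + v)) : p u := by
  have : ∀ w : X ⊗[ℂ] Y, p (of T w) := fun w => by
    induction w with
    | zero => exact zero
    | tmul x y => rw [← left_mul_right]; exact mul x y
    | add a b ha hb => rw [map_add]; exact add _ _ ha hb
  exact this u

/-- The universal property of the twisted product. -/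
def lift (f : X →ₐ[ℂ] R) (g : Y →ₐ[ℂ] R) (hfg : ∀ y x, prodMap f g (T (y ⊗ₜ x)) = g y * f x) :
    Tw T →ₐ[ℂ] R :=
  AlgHom.ofLinearMap (prodMap f g ∘ₗ (of T).symm.toLinearMap)
    ((prodMap_tmul f g 1 1).trans (by simp))
    (fun u v => prodMap_twistedMul T f g hfg u v)

theorem lift_of (f : X →ₐ[ℂ] R) (g : Y →ₐ[ℂ] R)
    (hfg : ∀ y x, prodMap f g (T (y ⊗ₜ x)) = g y * f x) (u : X ⊗[ℂ] Y) :
    lift f g hfg (of T u) = prodMap f g u := rfl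

@[simp] theorem lift_left (f : X →ₐ[ℂ] R) (g : Y →ₐ[ℂ] R)
    (hfg : ∀ y x, prodMap f g (T (y ⊗ₜ x)) = g y * f x) (x : X) :
    lift f g hfg (left T x) = f x := by
  rw [left_apply, lift_of]; simp

@[simp] theorem lift_right (f : X →ₐ[ℂ] R) (g : Y →ₐ[ℂ] R)
    (hfg : ∀ y x, prodMap f g (T (y ⊗ₜ x)) = g y * f x) (y : Y) :
    lift f g hfg (right T y) = g y := by
  rw [right_apply, lift_of]; simp

theorem algHom_ext {F G : Tw T →ₐ[ℂ] R} (hl : ∀ x, F (left T x) = G (left T x))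
    (hr : ∀ y, F (right T y) = G (right T y)) : F = G := by
  refine AlgHom.ext fun u => ?_
  induction u using induction_on with
  | zero => simp
  | mul x y => rw [map_mul, map_mul, hl, hr]
  | add u v hu hv => rw [map_add, map_add, hu, hv]

end Tw

end Tw

namespace SkewPairing

variable {A B : Type*} [Ring A] [Algebra ℂ A] [Ring B] [Algebra ℂ B] [HopfStr A] [HopfStr B]
  (P : SkewPairing A B) {R : Type*} [Ring R] [Algebra ℂ R]

instance factHeis : Fact (IsAlgebra (twistedMul P.heisTwist) (1 ⊗ₜ 1)) :=
  ⟨isAlgebra_twistedMul P.heisTwist (R := Module.End ℂ B ⊗[ℂ] A) (heisReprB A B) P.heisReprA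
    (fun a b => P.isHeis_repr.prodMap_heisTwist a b) P.prodMap_repr_injective⟩

/-- The Heisenberg double. -/
abbrev Heis : Type _ := Tw P.heisTwist

/-- The inclusion of `A` in the Heisenberg double. -/
abbrev heisA : A →ₐ[ℂ] P.Heis := Tw.right P.heisTwist

/-- The inclusion of `B` in the Heisenberg double. -/
abbrev heisB : B →ₐ[ℂ] P.Heis := Tw.left P.heisTwist

theorem isHeis_heis : P.IsHeis P.heisA P.heisB := by
  rw [isHeis_iff]
  intro a b
  rw [Tw.right_mul_left, heisTwist_tmul]
  simp [← Tw.left_mul_right]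

/-- The universal property of the Heisenberg double. -/
def heisLift {f : A →ₐ[ℂ] R} {g : B →ₐ[ℂ] R} (h : P.IsHeis f g) : P.Heis →ₐ[ℂ] R :=
  Tw.lift g f h.prodMap_heisTwist

/-- The commutation rule `b ⊗ a ↦ ∑ φ(S⁻¹(a₁), b₁) φ(a₃, b₃) a₂ ⊗ b₂` of the quantum double. -/
abbrev dblTwist : B ⊗[ℂ] A →ₗ[ℂ] A ⊗[ℂ] B := doubleTwist HopfStr.str HopfStr.str P.form

theorem scalar_mul_mul_scalar_apply {C : Type*} [AddCommGroup C] [Module ℂ C] [Coalgebra ℂ C]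
    (f g : Conv C ℂ) (u : Conv C R) (c : C) :
    (scalar R f * (u * scalar R g)) c =
      ∑ i ∈ (ℛ ℂ c).index, f ((ℛ ℂ c).left i) • ∑ j ∈ (ℛ ℂ ((ℛ ℂ c).right i)).index,
        g ((ℛ ℂ ((ℛ ℂ c).right i)).right j) • u ((ℛ ℂ ((ℛ ℂ c).right i)).left j) := by
  simp only [Coalgebra.Repr.convMul_apply (ℛ ℂ _), scalar_apply, ← Algebra.smul_def,
    ← Algebra.commutes]

/-- The twist of the quantum double is conjugation by the pairing in the convolution algebra. -/
theorem map_dblTwist (e : A ⊗[ℂ] B →ₗ[ℂ] R) (a : A) (b : B) :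
    e (P.dblTwist (b ⊗ₜ a)) =
      (scalar R P.inv * (toConv e * scalar R P.val)) (a ⊗ₜ b) := by
  rw [scalar_mul_mul_scalar_apply]
  simp only [dblTwist, doubleTwist, LinearMap.comp_apply, tensorComul_eq, LinearEquiv.coe_coe,
    TensorProduct.comm_tmul]
  conv_lhs => rw [← (ℛ ℂ (a ⊗ₜ[ℂ] b)).eq]
  simp only [map_sum, LinearMap.lTensor_tmul, TensorProduct.map_tmul, TensorProduct.lid_tmul,
    map_smul]
  refine Finset.sum_congr rfl fun i _ => congrArg₂ _ rfl ?_
  simp only [LinearMap.comp_apply]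
  conv_lhs => rw [← (ℛ ℂ ((ℛ ℂ (a ⊗ₜ[ℂ] b)).right i)).eq]
  simp
  rfl

theorem IsDbl.prodMap_dblTwist {P : SkewPairing A B} {f : A →ₐ[ℂ] R} {g : B →ₐ[ℂ] R}
    (h : P.IsDbl f g) (b : B) (a : A) :
    prodMap f g (P.dblTwist (b ⊗ₜ a)) = g b * f a := by
  have h1 : (toConv (prodMap f g) : Conv (A ⊗[ℂ] B) R) = inl B (hom f) * inr A (hom g) :=
    conv_tensor_ext fun a b => by rw [inl_mul_inr_apply]; exact prodMap_tmul f g a b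
  rw [map_dblTwist, h1, ← h, ← mul_assoc, scalar_inv_mul_val, one_mul, inr_mul_inl_apply]
  rfl

/-- Inverting both sides of `f g = φ g f` gives `g⁻¹ f⁻¹ = f⁻¹ g⁻¹ φ⁻¹`, where the inverses are
`f ∘ S` and `g ∘ S`. Hence `f ∘ S` and `g ∘ S` satisfy `g f = f g φ` in the opposite algebra. -/
theorem isDbl_op_antipode {f : A →ₐ[ℂ] R} {g : B →ₐ[ℂ] R} (h : P.IsHeis f g) :
    inr A (hom (g.op.comp (antipodeAlgHomOp ℂ B))) * inl B (hom (f.op.comp (antipodeAlgHomOp ℂ A)))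
      = inl B (hom (f.op.comp (antipodeAlgHomOp ℂ A))) *
        inr A (hom (g.op.comp (antipodeAlgHomOp ℂ B))) * scalar Rᵐᵒᵖ P.val := by
  have h1 : inl B (homInv f) * inr A (homInv g) =
      inr A (homInv g) * inl B (homInv f) * scalar R P.val := by
    have e1 : inl B (hom f) * inl B (homInv f) = (1 : Conv (A ⊗[ℂ] B) R) := by
      rw [← inl_mul, hom_mul_homInv, inl_one]
    have e2 : inr A (hom g) * inr A (homInv g) = (1 : Conv (A ⊗[ℂ] B) R) := by
      rw [← inr_mul, hom_mul_homInv, inr_one]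
    have e3 : inl B (homInv f) * inl B (hom f) = (1 : Conv (A ⊗[ℂ] B) R) := by
      rw [← inl_mul, homInv_mul_hom, inl_one]
    have e4 : inr A (homInv g) * inr A (hom g) = (1 : Conv (A ⊗[ℂ] B) R) := by
      rw [← inr_mul, homInv_mul_hom, inr_one]
    -- in `f⁻¹ g⁻¹ = g⁻¹ f⁻¹ (f g) f⁻¹ g⁻¹` the Heisenberg rule is applied to `f g`
    calc inl B (homInv f) * inr A (homInv g)
        = inr A (homInv g) * inl B (homInv f) * (inl B (hom f) * inr A (hom g)) *
          (inl B (homInv f) * inr A (homInv g)) := by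
          simp only [mul_assoc]
          rw [← mul_assoc (inl B (homInv f)), e3, one_mul, ← mul_assoc (inr A (homInv g)), e4,
            one_mul]
      _ = _ := by
          rw [h]
          simp only [mul_assoc]
          rw [← mul_assoc (inl B (hom f)), e1, one_mul, e2, mul_one]
  have h2 := congrArg (convMap (MulOpposite.opLinearEquiv ℂ : R ≃ₗ[ℂ] Rᵐᵒᵖ).toLinearMap) h1
  rw [convMap_mul_scalar] at h2
  have e1 : convMap (MulOpposite.opLinearEquiv ℂ : R ≃ₗ[ℂ] Rᵐᵒᵖ).toLinearMap
      (inl B (homInv f) * inr A (homInv g)) =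
      inr A (hom (g.op.comp (antipodeAlgHomOp ℂ B))) *
        inl B (hom (f.op.comp (antipodeAlgHomOp ℂ A))) := conv_tensor_ext fun a b => by
    rw [convMap_apply, inl_mul_inr_apply, inr_mul_inl_apply]; simp
  have e2 : convMap (MulOpposite.opLinearEquiv ℂ : R ≃ₗ[ℂ] Rᵐᵒᵖ).toLinearMap
      (inr A (homInv g) * inl B (homInv f)) =
      inl B (hom (f.op.comp (antipodeAlgHomOp ℂ A))) *
        inr A (hom (g.op.comp (antipodeAlgHomOp ℂ B))) := conv_tensor_ext fun a b => by
    rw [convMap_apply, inl_mul_inr_apply, inr_mul_inl_apply]; simp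
  rw [← e1, h2, e2]

end SkewPairing

/-! ### The quantum double -/

namespace SkewPairing

variable {A B : Type*} [Ring A] [Algebra ℂ A] [Ring B] [Algebra ℂ B] [HopfStr A] [HopfStr B]
  (P : SkewPairing A B)

section Split

variable {R₁ R₂ : Type*} [Ring R₁] [Algebra ℂ R₁] [Ring R₂] [Algebra ℂ R₂]
  {f₁ : A →ₐ[ℂ] R₁} {f₂ : A →ₐ[ℂ] R₂} {g₁ : B →ₐ[ℂ] R₁} {g₂ : B →ₐ[ℂ] R₂}

theorem inl_split_mul_inr_split :
    inl B (hom (split f₁ f₂)) * inr A (hom (split g₁ g₂)) =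
      (inl B (hom ((incL R₁ R₂).comp f₁)) * inr A (hom ((incL R₁ R₂).comp g₁))) *
      (inl B (hom ((incR R₁ R₂).comp f₂)) * inr A (hom ((incR R₁ R₂).comp g₂))) := by
  have hc := inl_inr_comm (hom ((incR R₁ R₂).comp f₂)) (hom ((incL R₁ R₂).comp g₁))
    fun a b => by simp [Commute, SemiconjBy]
  simp only [hom_split, inl_mul, inr_mul, mul_assoc]
  rw [← mul_assoc (inl B (hom ((incR R₁ R₂).comp f₂))), hc]
  simp only [mul_assoc]

theorem inr_split_mul_inl_split :
    inr A (hom (split g₁ g₂)) * inl B (hom (split f₁ f₂)) =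
      (inr A (hom ((incL R₁ R₂).comp g₁)) * inl B (hom ((incL R₁ R₂).comp f₁))) *
      (inr A (hom ((incR R₁ R₂).comp g₂)) * inl B (hom ((incR R₁ R₂).comp f₂))) := by
  have hc := inl_inr_comm (hom ((incL R₁ R₂).comp f₁)) (hom ((incR R₁ R₂).comp g₂))
    fun a b => by simp [Commute, SemiconjBy]
  simp only [hom_split, inl_mul, inr_mul, mul_assoc]
  rw [← mul_assoc (inr A (hom ((incR R₁ R₂).comp g₂))), ← hc]
  simp only [mul_assoc]

variable {P}

/-- The first factor absorbs the pairing on the left, the second one releases it on the right. -/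
theorem IsHeis.isDbl_split (h₁ : P.IsHeis f₁ g₁)
    (h₂ : inr A (hom g₂) * inl B (hom f₂) = inl B (hom f₂) * inr A (hom g₂) * scalar R₂ P.val) :
    P.IsDbl (split f₁ f₂) (split g₁ g₂) := by
  have h₁' := h₁.map (incL R₁ R₂)
  have h₂' := congrArg (convMap (incR R₁ R₂).toLinearMap) h₂
  simp only [convMap_mul, convMap_scalar, convMap_inl, convMap_inr, convMap_hom] at h₂'
  unfold IsHeis at h₁'
  unfold IsDbl
  rw [inl_split_mul_inr_split, inr_split_mul_inl_split, ← mul_assoc, ← h₁', h₂']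
  simp only [mul_assoc]

theorem IsDbl.isDbl_split (h₁ : P.IsDbl f₁ g₁) (h₂ : P.IsDbl f₂ g₂) :
    P.IsDbl (split f₁ f₂) (split g₁ g₂) := by
  have h₁' := h₁.map (incL R₁ R₂)
  have h₂' := h₂.map (incR R₁ R₂)
  unfold IsDbl at h₁' h₂' ⊢
  rw [inl_split_mul_inr_split, inr_split_mul_inl_split, ← mul_assoc, h₁', mul_assoc, h₂']
  simp only [mul_assoc]

theorem IsDbl.isHeis_split (h₁ : P.IsDbl f₁ g₁) (h₂ : P.IsHeis f₂ g₂) :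
    P.IsHeis (split f₁ f₂) (split g₁ g₂) := by
  have h₁' := h₁.map (incL R₁ R₂)
  have h₂' := h₂.map (incR R₁ R₂)
  unfold IsDbl at h₁'
  unfold IsHeis at h₂' ⊢
  rw [inl_split_mul_inr_split, inr_split_mul_inl_split, h₂', ← mul_assoc _ (scalar _ _), ← h₁']
  simp only [mul_assoc]

theorem prodMap_split : prodMap (split f₁ f₂) (split g₁ g₂) =
    TensorProduct.map (prodMap f₁ g₁) (prodMap f₂ g₂) ∘ₗ comul := by
  refine TensorProduct.ext' fun a b => ?_
  rw [prodMap_tmul, LinearMap.comp_apply, comul_tensor, split_apply, split_apply,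
    Finset.sum_mul_sum]
  simp

end Split

/-- The antipode followed by the inclusion of `A` in the opposite of the Heisenberg double. -/
abbrev heisOpA : A →ₐ[ℂ] P.Heisᵐᵒᵖ := P.heisA.op.comp (antipodeAlgHomOp ℂ A)

/-- The antipode followed by the inclusion of `B` in the opposite of the Heisenberg double. -/
abbrev heisOpB : B →ₐ[ℂ] P.Heisᵐᵒᵖ := P.heisB.op.comp (antipodeAlgHomOp ℂ B)

/-- `a ↦ ∑ a₁ ⊗ S(a₂)ᵒᵖ` and `b ↦ ∑ b₁ ⊗ S(b₂)ᵒᵖ`, with values in the tensor product of the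
Heisenberg double and its opposite, satisfy the commutation rule of the quantum double. -/
theorem isDbl_adjointHom : P.IsDbl (adjointHom P.heisA) (adjointHom P.heisB) :=
  P.isHeis_heis.isDbl_split (P.isDbl_op_antipode P.isHeis_heis)

/-- The functional `b ♯ a ↦ φ(S⁻¹(a), b)` on the Heisenberg double. It is chosen to take the
value `ε(a) ε(b)` at the product `a b` in the other order. -/
def heisFunctional : P.Heis →ₗ[ℂ] ℂ :=
  P.inv.ofConv ∘ₗ (TensorProduct.comm ℂ B A).toLinearMap ∘ₗ (Tw.of P.heisTwist).symm.toLinearMap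

theorem heisFunctional_mul (a : A) (b : B) :
    P.heisFunctional (P.heisA a * P.heisB b) = counit (R := ℂ) (a ⊗ₜ[ℂ] b) := by
  have h := congrArg (convMap P.heisFunctional) P.isHeis_heis
  rw [convMap_scalar_mul] at h
  have e : convMap P.heisFunctional (inr A (hom P.heisB) * inl B (hom P.heisA)) = P.inv :=
    conv_tensor_ext fun a b => by
      rw [convMap_apply, inr_mul_inl_apply]
      exact congrArg P.heisFunctional (Tw.left_mul_right _ b a)
  have e' : scalar ℂ P.val = P.val := rfl
  rw [e, e', val_mul_inv] at h
  have h' := congrArg (fun u : Conv (A ⊗[ℂ] B) ℂ => u (a ⊗ₜ b)) h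
  simp only [convMap_apply, inl_mul_inr_apply] at h'
  exact h'

theorem prodMap_heisOp_injective : Function.Injective (prodMap P.heisOpA P.heisOpB) := by
  have h : (prodMap P.heisOpA P.heisOpB : A ⊗[ℂ] B → P.Heisᵐᵒᵖ) =
      fun u => MulOpposite.op (Tw.of P.heisTwist (TensorProduct.comm ℂ A B
        (TensorProduct.congr (HopfStr.str (A := A)).antipode
          (HopfStr.str (A := B)).antipode u))) := by
    funext u
    induction u with
    | zero => simp
    | add x y hx hy => simp only [map_add, hx, hy, MulOpposite.op_add]
    | tmul a b =>
      rw [prodMap_tmul]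
      exact congrArg MulOpposite.op (Tw.left_mul_right P.heisTwist (antipode ℂ b) (antipode ℂ a))
  rw [h]
  exact MulOpposite.op_injective.comp ((Tw.of P.heisTwist).injective.comp
    ((TensorProduct.comm ℂ A B).injective.comp (LinearEquiv.injective _)))

/-- Applying `heisFunctional` to the first factor of `∑ a₁ b₁ ⊗ (S(a₂)ᵒᵖ S(b₂)ᵒᵖ)` leaves
`S(a)ᵒᵖ S(b)ᵒᵖ`, from which `a ⊗ b` can be recovered since the antipodes are bijective. -/
theorem prodMap_adjointHom_injective :
    Function.Injective (prodMap (adjointHom P.heisA) (adjointHom P.heisB)) := by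
  have h : ∀ u, (P.heisFunctional.rTensor P.Heisᵐᵒᵖ)
      (prodMap (adjointHom P.heisA) (adjointHom P.heisB) u) =
      1 ⊗ₜ prodMap P.heisOpA P.heisOpB u := fun u => by
    have e : P.heisFunctional ∘ₗ prodMap P.heisA P.heisB = counit :=
      TensorProduct.ext' fun a b => by
        rw [LinearMap.comp_apply, prodMap_tmul, heisFunctional_mul]
    have e' := congrArg ((prodMap P.heisOpA P.heisOpB).lTensor ℂ)
      (rTensor_counit_comul (R := ℂ) u)
    rw [adjointHom, adjointHom, prodMap_split, LinearMap.comp_apply, ← LinearMap.comp_apply,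
      LinearMap.rTensor_comp_map, e]
    rw [← LinearMap.comp_apply, LinearMap.lTensor_comp_rTensor, LinearMap.lTensor_tmul] at e'
    exact e'
  intro u v huv
  have := congrArg (P.heisFunctional.rTensor P.Heisᵐᵒᵖ) huv
  rw [h, h] at this
  apply P.prodMap_heisOp_injective
  simpa using congrArg (TensorProduct.lid ℂ P.Heisᵐᵒᵖ) this

instance factDbl : Fact (IsAlgebra (twistedMul P.dblTwist) (1 ⊗ₜ 1)) :=
  ⟨isAlgebra_twistedMul P.dblTwist _ _ (fun b a => P.isDbl_adjointHom.prodMap_dblTwist b a)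
    P.prodMap_adjointHom_injective⟩

/-- The quantum double. -/
abbrev Dbl : Type _ := Tw P.dblTwist

/-- The inclusion of `A` in the quantum double. -/
abbrev dblA : A →ₐ[ℂ] P.Dbl := Tw.left P.dblTwist

/-- The inclusion of `B` in the quantum double. -/
abbrev dblB : B →ₐ[ℂ] P.Dbl := Tw.right P.dblTwist

theorem isDbl_dbl : P.IsDbl P.dblA P.dblB := by
  have h : scalar P.Dbl P.inv * (inl B (hom P.dblA) * inr A (hom P.dblB) * scalar P.Dbl P.val) =
      inr A (hom P.dblB) * inl B (hom P.dblA) := conv_tensor_ext fun a b => by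
    have e := P.map_dblTwist (R := P.Dbl) (Tw.of P.dblTwist).toLinearMap a b
    have e' : (toConv (Tw.of P.dblTwist).toLinearMap : Conv (A ⊗[ℂ] B) P.Dbl) =
        inl B (hom P.dblA) * inr A (hom P.dblB) := conv_tensor_ext fun a b => by
      rw [inl_mul_inr_apply]; exact (Tw.left_mul_right P.dblTwist a b).symm
    rw [← e', ← e, inr_mul_inl_apply]
    exact (Tw.right_mul_left P.dblTwist a b).symm
  unfold IsDbl
  rw [← h, ← mul_assoc, scalar_val_mul_inv, one_mul]

variable {R : Type*} [Ring R] [Algebra ℂ R]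

/-- The universal property of the quantum double. -/
def dblLift {f : A →ₐ[ℂ] R} {g : B →ₐ[ℂ] R} (h : P.IsDbl f g) : P.Dbl →ₐ[ℂ] R :=
  Tw.lift f g h.prodMap_dblTwist

/-- The comultiplication of the quantum double. -/
def dblComul : P.Dbl →ₐ[ℂ] P.Dbl ⊗[ℂ] P.Dbl := P.dblLift (P.isDbl_dbl.isDbl_split P.isDbl_dbl)

theorem isDbl_counit : P.IsDbl (Bialgebra.counitAlgHom ℂ A) (Bialgebra.counitAlgHom ℂ B) := by
  have h1 : inl B (hom (Bialgebra.counitAlgHom ℂ A)) = (1 : Conv (A ⊗[ℂ] B) ℂ) :=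
    conv_tensor_ext fun a b => by simp [mul_comm]
  have h2 : inr A (hom (Bialgebra.counitAlgHom ℂ B)) = (1 : Conv (A ⊗[ℂ] B) ℂ) :=
    conv_tensor_ext fun a b => by simp [mul_comm]
  unfold IsDbl
  simp [h1, h2]

/-- The counit of the quantum double. -/
def dblCounit : P.Dbl →ₐ[ℂ] ℂ := P.dblLift P.isDbl_counit

/-- The structure maps of the quantum double. -/
def dblData : BialgData P.Dbl where
  mul := LinearMap.mul' ℂ P.Dbl
  one := 1
  comul := P.dblComul.toLinearMap
  counit := P.dblCounit.toLinearMap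

theorem dblComul_of (u : A ⊗[ℂ] B) : P.dblComul (Tw.of P.dblTwist u) =
    TensorProduct.map (Tw.of P.dblTwist).toLinearMap (Tw.of P.dblTwist).toLinearMap
      (comul (R := ℂ) u) := by
  rw [dblComul, dblLift, Tw.lift_of, prodMap_split, Tw.prodMap_left_right]
  rfl

theorem dblCounit_of (u : A ⊗[ℂ] B) : P.dblCounit (Tw.of P.dblTwist u) = counit (R := ℂ) u := by
  rw [dblCounit, dblLift, Tw.lift_of]
  induction u with
  | zero => simp
  | add x y hx hy => simp only [map_add, hx, hy]
  | tmul a b => simp [mul_comm]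

/-- The explicit structure maps of the quantum double are those of the algebra `Dbl`. -/
theorem quantumDouble_eq :
    (quantumDouble HopfStr.str HopfStr.str P.form : BialgData (A ⊗[ℂ] B)) = P.dblData := by
  have h1 : (quantumDouble HopfStr.str HopfStr.str P.form).mul = LinearMap.mul' ℂ P.Dbl :=
    TensorProduct.ext' fun x y => rfl
  have h3 : (quantumDouble HopfStr.str HopfStr.str P.form).comul = P.dblComul.toLinearMap :=
    TensorProduct.ext' fun a b => by
      refine Eq.trans ?_ (P.dblComul_of (a ⊗ₜ b)).symm
      exact (congrArg (fun F : _ →ₗ[ℂ] _ => F (comul (R := ℂ) (a ⊗ₜ[ℂ] b)))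
        (TensorProduct.map_id (R := ℂ) (M := A ⊗[ℂ] B) (N := A ⊗[ℂ] B))).symm
  have h4 : (quantumDouble HopfStr.str HopfStr.str P.form).counit = P.dblCounit.toLinearMap :=
    TensorProduct.ext' fun a b => by
      refine Eq.trans ?_ (P.dblCounit_of (a ⊗ₜ b)).symm
      change LinearMap.mul' ℂ ℂ (TensorProduct.map _ _ (a ⊗ₜ b)) = _
      rw [TensorProduct.map_tmul, LinearMap.mul'_apply, TensorProduct.counit_tmul, mul_comm]
      rfl
  unfold dblData
  rw [← h1, ← h3, ← h4]
  rfl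

end SkewPairing

/-! ### The adjoint action of the quantum double on the Heisenberg double -/

section General

theorem squareMul_mul' {V : Type*} [Ring V] [Algebra ℂ V] (u v : V ⊗[ℂ] V) :
    squareMul (LinearMap.mul' ℂ V) (u ⊗ₜ v) = u * v := by
  induction u with
  | zero => simp
  | add x y hx hy => simp only [TensorProduct.add_tmul, map_add, hx, hy, add_mul]
  | tmul a b =>
    induction v with
    | zero => simp
    | add x y hx hy => simp only [TensorProduct.tmul_add, map_add, hx, hy, mul_add]
    | tmul c d => simp [squareMul]

theorem isAlgebra_mul' (V : Type*) [Ring V] [Algebra ℂ V] :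
    IsAlgebra (LinearMap.mul' ℂ V) 1 where
  one_mul x := by simp
  mul_one x := by simp
  mul_assoc x y z := by simp [mul_assoc]

theorem isCoalgebra_coalgebra (C : Type*) [AddCommGroup C] [Module ℂ C] [Coalgebra ℂ C] :
    IsCoalgebra (comul (R := ℂ) (A := C)) counit where
  coassoc x := coassoc_apply x
  counit_left x := by simp
  counit_right x := by simp

end General

section Conv

variable {C R : Type*} [AddCommGroup C] [Module ℂ C] [Coalgebra ℂ C] [Ring R] [Algebra ℂ R]

theorem const_mul_apply (x : R) (u : Conv C R) (c : C) : (const C x * u) c = x * u c := by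
  rw [(ℛ ℂ c).convMul_apply]
  conv_rhs => rw [← sum_counit_smul_map u.ofConv c]
  simp [Finset.mul_sum]

theorem const_mul_const (x y : R) : const C x * const C y = const C (x * y) :=
  conv_ext fun c => by rw [const_mul_apply]; simp

theorem const_one : const C (1 : R) = 1 :=
  conv_ext fun c => by simp [Algebra.algebraMap_eq_smul_one]

theorem const_mul_comm {x : R} {u : Conv C R} (h : ∀ c, Commute x (u c)) :
    const C x * u = u * const C x :=
  conv_ext fun c => by rw [const_mul_apply, mul_const_apply, (h c).eq]

theorem convMap_const {R' : Type*} [Ring R'] [Algebra ℂ R'] (F : R →ₗ[ℂ] R') (x : R) :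
    convMap F (const C x) = const C (F x) := conv_ext fun c => by simp

end Conv

section Adjoint

variable {K R : Type*} [Ring K] [Algebra ℂ K] [HopfStr K] [Ring R] [Algebra ℂ R]

/-- The adjoint action `k · x = ∑ f(k₁) x f(S(k₂))` through a homomorphism `f`. -/
def adRep (f : K →ₐ[ℂ] R) : K →ₐ[ℂ] Module.End ℂ R :=
  (AlgHom.mulLeftRight ℂ R).comp (adjointHom f)

theorem adRep_sum (f : K →ₐ[ℂ] R) (k : K) (x : R) :
    adRep f k x = ∑ i ∈ (ℛ ℂ k).index,
      f ((ℛ ℂ k).left i) * x * f (antipode ℂ ((ℛ ℂ k).right i)) := by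
  simp only [adRep, adjointHom, AlgHom.comp_apply, split_apply, map_sum, LinearMap.sum_apply,
    AlgHom.mulLeftRight_apply]
  simp

/-- The adjoint action is conjugation by `f` in the convolution algebra. -/
theorem adRep_eq_conv (f : K →ₐ[ℂ] R) (k : K) (x : R) :
    adRep f k x = (hom f * const K x * homInv f) k := by
  rw [adRep_sum, (ℛ ℂ k).convMul_apply]
  refine Finset.sum_congr rfl fun i _ => ?_
  rw [mul_const_apply]
  rfl

theorem adRep_mul (f : K →ₐ[ℂ] R) (k : K) (x y : R) :
    adRep f k (x * y) = ∑ i ∈ (ℛ ℂ k).index,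
      adRep f ((ℛ ℂ k).left i) x * adRep f ((ℛ ℂ k).right i) y := by
  simp only [adRep_eq_conv]
  rw [← (ℛ ℂ k).convMul_apply, ← const_mul_const]
  congr 1
  simp only [mul_assoc]
  rw [← mul_assoc (homInv f), homInv_mul_hom, one_mul]

theorem adRep_one (f : K →ₐ[ℂ] R) (k : K) : adRep f k 1 = counit (R := ℂ) k • (1 : R) := by
  rw [adRep_eq_conv, const_one, mul_one, hom_mul_homInv, LinearMap.convOne_apply,
    Algebra.algebraMap_eq_smul_one]

end Adjoint

namespace SkewPairing

variable {A B : Type*} [Ring A] [Algebra ℂ A] [Ring B] [Algebra ℂ B] [HopfStr A] [HopfStr B]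
  (P : SkewPairing A B)

theorem isCoalgebra_dbl : IsCoalgebra P.dblComul.toLinearMap P.dblCounit.toLinearMap := by
  have h := isCoalgebra_coalgebra (A ⊗[ℂ] B)
  have h3 : comul (R := ℂ) (A := A ⊗[ℂ] B) = P.dblComul.toLinearMap :=
    LinearMap.ext fun u => by
      refine Eq.trans ?_ (P.dblComul_of u).symm
      exact (congrArg (fun F : _ →ₗ[ℂ] _ => F (comul (R := ℂ) u))
        (TensorProduct.map_id (R := ℂ) (M := A ⊗[ℂ] B) (N := A ⊗[ℂ] B))).symm
  have h4 : counit (R := ℂ) (A := A ⊗[ℂ] B) = P.dblCounit.toLinearMap :=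
    LinearMap.ext fun u => (P.dblCounit_of u).symm
  rw [h3, h4] at h
  exact h

theorem isBialgebra_dbl : P.dblData.IsBialgebra where
  isAlgebra := isAlgebra_mul' P.Dbl
  isCoalgebra := P.isCoalgebra_dbl
  comul_one := map_one P.dblComul
  comul_mul x y := (map_mul P.dblComul x y).trans (squareMul_mul' _ _).symm
  counit_one := map_one P.dblCounit
  counit_mul x y := map_mul P.dblCounit x y

/-- The antipode `a b ↦ S(b) S(a)` of the quantum double. -/
def dblAntipode : P.Dbl →ₗ[ℂ] P.Dbl :=
  (inr A (homInv P.dblB) * inl B (homInv P.dblA)).ofConv ∘ₗ (Tw.of P.dblTwist).symm.toLinearMap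

theorem toConv_of :
    (toConv (Tw.of P.dblTwist).toLinearMap : Conv (A ⊗[ℂ] B) P.Dbl) =
      inl B (hom P.dblA) * inr A (hom P.dblB) :=
  conv_tensor_ext fun a b => by
    rw [inl_mul_inr_apply]; exact (Tw.left_mul_right P.dblTwist a b).symm

theorem isAntipode_dbl : P.dblData.IsAntipode P.dblAntipode where
  left := fun x => by
    obtain ⟨u, rfl⟩ := (Tw.of P.dblTwist).surjective x
    have h : (inr A (homInv P.dblB) * inl B (homInv P.dblA)) *
        toConv (Tw.of P.dblTwist).toLinearMap = 1 := by
      rw [toConv_of, mul_assoc, ← mul_assoc (inl B _), ← inl_mul, homInv_mul_hom, inl_one,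
        one_mul, ← inr_mul, homInv_mul_hom, inr_one]
    have h' := congrArg (fun w : Conv (A ⊗[ℂ] B) P.Dbl => w u) h
    simp only [LinearMap.convOne_apply, LinearMap.convMul_apply] at h'
    change LinearMap.mul' ℂ P.Dbl (P.dblAntipode.rTensor P.Dbl (P.dblComul (Tw.of P.dblTwist u))) =
      P.dblCounit (Tw.of P.dblTwist u) • (1 : P.Dbl)
    rw [dblComul_of, dblCounit_of, ← Algebra.algebraMap_eq_smul_one, ← h']
    refine congrArg (LinearMap.mul' ℂ P.Dbl) ?_
    rw [← LinearMap.comp_apply, LinearMap.rTensor_comp_map]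
    rfl
  right := fun x => by
    obtain ⟨u, rfl⟩ := (Tw.of P.dblTwist).surjective x
    have h : toConv (Tw.of P.dblTwist).toLinearMap *
        (inr A (homInv P.dblB) * inl B (homInv P.dblA)) = 1 := by
      rw [toConv_of, mul_assoc, ← mul_assoc (inr A _), ← inr_mul, hom_mul_homInv, inr_one,
        one_mul, ← inl_mul, hom_mul_homInv, inl_one]
    have h' := congrArg (fun w : Conv (A ⊗[ℂ] B) P.Dbl => w u) h
    simp only [LinearMap.convOne_apply, LinearMap.convMul_apply] at h'
    change LinearMap.mul' ℂ P.Dbl (P.dblAntipode.lTensor P.Dbl (P.dblComul (Tw.of P.dblTwist u))) =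
      P.dblCounit (Tw.of P.dblTwist u) • (1 : P.Dbl)
    rw [dblComul_of, dblCounit_of, ← Algebra.algebraMap_eq_smul_one, ← h']
    refine congrArg (LinearMap.mul' ℂ P.Dbl) ?_
    rw [← LinearMap.comp_apply, LinearMap.lTensor_comp_map]
    rfl

theorem isHopfAlgebra_dbl : P.dblData.IsHopfAlgebra :=
  ⟨P.isBialgebra_dbl, P.dblAntipode, P.isAntipode_dbl⟩

/-- The inner action of the quantum double on the Heisenberg double: `A` and `B` act by the adjoint
action through their inclusions in the Heisenberg double. -/
def dblAct : P.Dbl →ₐ[ℂ] Module.End ℂ P.Heis :=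
  (AlgHom.mulLeftRight ℂ P.Heis).comp (P.dblLift P.isDbl_adjointHom)

theorem dblAct_left (a : A) : P.dblAct (P.dblA a) = adRep P.heisA a := by
  rw [dblAct, AlgHom.comp_apply, dblLift, Tw.lift_left]; rfl

theorem dblAct_right (b : B) : P.dblAct (P.dblB b) = adRep P.heisB b := by
  rw [dblAct, AlgHom.comp_apply, dblLift, Tw.lift_right]; rfl

theorem dblComul_left (a : A) : P.dblComul (P.dblA a) = split P.dblA P.dblA a := by
  rw [dblComul, dblLift, Tw.lift_left]

theorem dblComul_right (b : B) : P.dblComul (P.dblB b) = split P.dblB P.dblB b := by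
  rw [dblComul, dblLift, Tw.lift_right]

theorem dblCounit_left (a : A) : P.dblCounit (P.dblA a) = counit (R := ℂ) a := by
  rw [dblCounit, dblLift, Tw.lift_left]; rfl

theorem dblCounit_right (b : B) : P.dblCounit (P.dblB b) = counit (R := ℂ) b := by
  rw [dblCounit, dblLift, Tw.lift_right]; rfl

/-- The diagonal action of `D ⊗ D` on the tensor square of the Heisenberg double, where `D` is the
quantum double. -/
def dblActSquare : P.Dbl ⊗[ℂ] P.Dbl →ₐ[ℂ] Module.End ℂ (P.Heis ⊗[ℂ] P.Heis) :=
  Module.endTensorEndAlgHom.comp (Algebra.TensorProduct.map P.dblAct P.dblAct)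

theorem dblActSquare_tmul (h k : P.Dbl) (x y : P.Heis) :
    P.dblActSquare (h ⊗ₜ k) (x ⊗ₜ y) = P.dblAct h x ⊗ₜ P.dblAct k y :=
  rfl

theorem dblAct_mul (h : P.Dbl) (u : P.Heis ⊗[ℂ] P.Heis) :
    P.dblAct h (LinearMap.mul' ℂ P.Heis u) =
      LinearMap.mul' ℂ P.Heis (P.dblActSquare (P.dblComul h) u) := by
  have hA : ∀ (a : A) u, P.dblAct (P.dblA a) (LinearMap.mul' ℂ P.Heis u) =
      LinearMap.mul' ℂ P.Heis (P.dblActSquare (P.dblComul (P.dblA a)) u) := fun a u => by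
    induction u with
    | zero => simp
    | add x y hx hy => simp only [map_add, hx, hy]
    | tmul x y =>
      rw [dblComul_left, split_apply, dblAct_left, LinearMap.mul'_apply, adRep_mul, map_sum,
        LinearMap.sum_apply, map_sum]
      simp only [dblActSquare_tmul, dblAct_left, LinearMap.mul'_apply]
  have hB : ∀ (b : B) u, P.dblAct (P.dblB b) (LinearMap.mul' ℂ P.Heis u) =
      LinearMap.mul' ℂ P.Heis (P.dblActSquare (P.dblComul (P.dblB b)) u) := fun b u => by
    induction u with
    | zero => simp
    | add x y hx hy => simp only [map_add, hx, hy]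
    | tmul x y =>
      rw [dblComul_right, split_apply, dblAct_right, LinearMap.mul'_apply, adRep_mul, map_sum,
        LinearMap.sum_apply, map_sum]
      simp only [dblActSquare_tmul, dblAct_right, LinearMap.mul'_apply]
  induction h using Tw.induction_on generalizing u with
  | zero => simp
  | add h k hh hk => simp only [map_add, LinearMap.add_apply, hh, hk]
  | mul a b =>
    rw [map_mul, map_mul, map_mul, Module.End.mul_apply, Module.End.mul_apply, hB, hA]

theorem dblAct_one (h : P.Dbl) : P.dblAct h 1 = P.dblCounit h • (1 : P.Heis) := by
  induction h using Tw.induction_on with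
  | zero => simp
  | add h k hh hk => simp only [map_add, LinearMap.add_apply, hh, hk, add_smul]
  | mul a b =>
    rw [map_mul, map_mul, Module.End.mul_apply, dblAct_right, adRep_one, map_smul, dblAct_left,
      adRep_one, dblCounit_left, dblCounit_right, smul_smul, mul_comm]

theorem isModule_dblAct : IsModule P.dblData P.dblAct.toLinearMap where
  one_act v := by
    change P.dblAct 1 v = v
    rw [map_one]; rfl
  mul_act x y v := by
    change P.dblAct (x * y) v = P.dblAct x (P.dblAct y v)
    rw [map_mul]; rfl

theorem isModuleAlgebra_heis :
    IsModuleAlgebra P.dblData (LinearMap.mul' ℂ P.Heis) 1 P.dblAct.toLinearMap where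
  isAlgebra := isAlgebra_mul' P.Heis
  isModule := P.isModule_dblAct
  act_mul h x y := by
    have e : TensorProduct.lift ((TensorProduct.mapBilinear (RingHom.id ℂ) P.Heis P.Heis P.Heis
        P.Heis).compl₁₂ P.dblAct.toLinearMap P.dblAct.toLinearMap) =
        P.dblActSquare.toLinearMap :=
      TensorProduct.ext' fun h k => TensorProduct.ext' fun x y => by
        rw [AlgHom.toLinearMap_apply, dblActSquare_tmul]; simp
    rw [e]
    exact P.dblAct_mul h (x ⊗ₜ y)
  act_one h := P.dblAct_one h

end SkewPairing

/-! ### The Yetter-Drinfeld condition -/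

namespace SkewPairing

variable {A B : Type*} [Ring A] [Algebra ℂ A] [Ring B] [Algebra ℂ B] [HopfStr A] [HopfStr B]
  (P : SkewPairing A B)

/-- The coaction of the quantum double on the Heisenberg double, as the homomorphism with
`a ↦ ∑ a₁ ⊗ a₂` and `b ↦ ∑ b₁ ⊗ b₂`. -/
def coact : P.Heis →ₐ[ℂ] P.Dbl ⊗[ℂ] P.Heis :=
  P.heisLift (P.isDbl_dbl.isHeis_split P.isHeis_heis)

theorem coact_right (a : A) : P.coact (P.heisA a) = split P.dblA P.heisA a := by
  rw [coact, heisLift, Tw.lift_right]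

theorem coact_left (b : B) : P.coact (P.heisB b) = split P.dblB P.heisB b := by
  rw [coact, heisLift, Tw.lift_left]

section Comodule

variable {K D V : Type*} [Ring K] [Algebra ℂ K] [HopfStr K] [Ring D] [Algebra ℂ D]
  [Ring V] [Algebra ℂ V] {f : K →ₐ[ℂ] D} {g : K →ₐ[ℂ] V}

theorem split_eq (k : K) :
    split f g k = TensorProduct.map f.toLinearMap g.toLinearMap (comul (R := ℂ) k) := rfl

/-- If `f : K → D` respects comultiplications, then a coaction on `V` that is given by
`g(k) ↦ ∑ f(k₁) ⊗ g(k₂)` is coassociative on the image of `g`. -/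
theorem assoc_split {Δ : D →ₐ[ℂ] D ⊗[ℂ] D} {δ : V →ₐ[ℂ] D ⊗[ℂ] V}
    (hΔ : ∀ k, Δ (f k) = split f f k) (hδ : ∀ k, δ (g k) = split f g k) (k : K) :
    TensorProduct.assoc ℂ D D V (Δ.toLinearMap.rTensor V (split f g k)) =
      δ.toLinearMap.lTensor D (split f g k) := by
  have hΔ' : Δ.toLinearMap ∘ₗ f.toLinearMap =
      TensorProduct.map f.toLinearMap f.toLinearMap ∘ₗ comul := LinearMap.ext hΔ
  have hδ' : δ.toLinearMap ∘ₗ g.toLinearMap =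
      TensorProduct.map f.toLinearMap g.toLinearMap ∘ₗ comul := LinearMap.ext hδ
  have h := congrArg (TensorProduct.map f.toLinearMap (TensorProduct.map f.toLinearMap
    g.toLinearMap)) (coassoc_apply (R := ℂ) k)
  rw [split_eq, ← LinearMap.comp_apply, ← LinearMap.comp_apply (LinearMap.lTensor _ _),
    LinearMap.rTensor_comp_map, LinearMap.lTensor_comp_map, hΔ', hδ']
  have e1 : ∀ z : K ⊗[ℂ] K, TensorProduct.assoc ℂ D D V (TensorProduct.map
      (TensorProduct.map f.toLinearMap f.toLinearMap ∘ₗ comul) g.toLinearMap z) =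
      TensorProduct.map f.toLinearMap (TensorProduct.map f.toLinearMap g.toLinearMap)
        (TensorProduct.assoc ℂ K K K ((comul (R := ℂ)).rTensor K z)) := fun z => by
    induction z with
    | zero => simp
    | add x y hx hy => simp only [map_add, hx, hy]
    | tmul x y =>
      simp only [TensorProduct.map_tmul, LinearMap.comp_apply, LinearMap.rTensor_tmul]
      generalize comul (R := ℂ) x = w
      induction w with
      | zero => simp
      | add x y hx hy => simp only [map_add, TensorProduct.add_tmul, hx, hy]
      | tmul x' y' => simp
  have e2 : ∀ z : K ⊗[ℂ] K, TensorProduct.map f.toLinearMap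
      (TensorProduct.map f.toLinearMap g.toLinearMap ∘ₗ comul) z =
      TensorProduct.map f.toLinearMap (TensorProduct.map f.toLinearMap g.toLinearMap)
        ((comul (R := ℂ)).lTensor K z) := fun z => by
    induction z with
    | zero => simp
    | add x y hx hy => simp only [map_add, hx, hy]
    | tmul x y => simp
  rw [e1, e2, h]

theorem counit_split {ε : D →ₐ[ℂ] ℂ} (hε : ∀ k, ε (f k) = counit (R := ℂ) k) (k : K) :
    TensorProduct.lid ℂ V (ε.toLinearMap.rTensor V (split f g k)) = g k := by
  rw [split_apply]
  simp only [map_sum, LinearMap.rTensor_tmul, TensorProduct.lid_tmul, AlgHom.toLinearMap_apply, hε]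
  exact sum_counit_smul_map g.toLinearMap k

end Comodule

theorem isComodule_coact : IsComodule P.dblData P.coact.toLinearMap where
  coassoc v := by
    let F : P.Heis →ₐ[ℂ] P.Dbl ⊗[ℂ] (P.Dbl ⊗[ℂ] P.Heis) :=
      ((Algebra.TensorProduct.assoc ℂ ℂ ℂ P.Dbl P.Dbl P.Heis).toAlgHom.comp
        (Algebra.TensorProduct.map P.dblComul (AlgHom.id ℂ P.Heis))).comp P.coact
    let G : P.Heis →ₐ[ℂ] P.Dbl ⊗[ℂ] (P.Dbl ⊗[ℂ] P.Heis) :=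
      (Algebra.TensorProduct.map (AlgHom.id ℂ P.Dbl) P.coact).comp P.coact
    have h : F = G := Tw.algHom_ext
      (fun b => by
        have := assoc_split P.dblComul_right P.coact_left b
        rw [← P.coact_left] at this
        exact this)
      (fun a => by
        have := assoc_split P.dblComul_left P.coact_right a
        rw [← P.coact_right] at this
        exact this)
    exact DFunLike.congr_fun h v
  counit v := by
    let F : P.Heis →ₐ[ℂ] P.Heis :=
      ((Algebra.TensorProduct.lid ℂ P.Heis).toAlgHom.comp
        (Algebra.TensorProduct.map P.dblCounit (AlgHom.id ℂ P.Heis))).comp P.coact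
    have h : F = AlgHom.id ℂ P.Heis := Tw.algHom_ext
      (fun b => by
        have := counit_split (V := P.Heis) (g := P.heisB) P.dblCounit_right b
        rw [← P.coact_left] at this
        exact this)
      (fun a => by
        have := counit_split (V := P.Heis) (g := P.heisA) P.dblCounit_left a
        rw [← P.coact_right] at this
        exact this)
    exact DFunLike.congr_fun h v

section YD

/-- The action `(h ⊗ k)(d ⊗ x) = h d ⊗ k · x` of `D ⊗ D` on `D ⊗ V`, where `V` is an algebra on
which the algebra `D` acts. -/
def mulAct {D V : Type*} [Ring D] [Algebra ℂ D] [Ring V] [Algebra ℂ V]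
    (act : D →ₐ[ℂ] Module.End ℂ V) : D ⊗[ℂ] D →ₐ[ℂ] Module.End ℂ (D ⊗[ℂ] V) :=
  Module.endTensorEndAlgHom.comp (Algebra.TensorProduct.map (Algebra.lmul ℂ D) act)

variable {D V : Type*} [Ring D] [Algebra ℂ D] [Ring V] [Algebra ℂ V]
    (act : D →ₐ[ℂ] Module.End ℂ V) (δ : V →ₐ[ℂ] D ⊗[ℂ] V)

theorem mulAct_tmul (h k d : D) (x : V) :
    mulAct act (h ⊗ₜ k) (d ⊗ₜ x) = (h * d) ⊗ₜ act k x := rfl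

/-- The map `h ⊗ k ↦ (h · v)₍₋₁₎ k ⊗ (h · v)₍₀₎`. -/
def actCoact (v : V) : D ⊗[ℂ] D →ₗ[ℂ] D ⊗[ℂ] V :=
  LinearMap.mul' ℂ (D ⊗[ℂ] V) ∘ₗ
    TensorProduct.map (δ.toLinearMap ∘ₗ act.toLinearMap.flip v) (incL D V).toLinearMap

theorem actCoact_tmul (v : V) (h k : D) :
    actCoact act δ v (h ⊗ₜ k) = δ (act h v) * (k ⊗ₜ 1) := rfl

theorem map_mul_lift_eq_mulAct (t : D ⊗[ℂ] D) (z : D ⊗[ℂ] V) :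
    TensorProduct.map (LinearMap.mul' ℂ D) (TensorProduct.lift act.toLinearMap)
      (TensorProduct.tensorTensorTensorComm ℂ D D D V (t ⊗ₜ z)) = mulAct act t z := by
  induction t with
  | zero => simp
  | add s t hs ht => simp only [map_add, LinearMap.add_apply, TensorProduct.add_tmul, hs, ht]
  | tmul h h' =>
    induction z with
    | zero => simp
    | add s t hs ht => simp only [map_add, TensorProduct.tmul_add, hs, ht]
    | tmul d x => rw [mulAct_tmul]; simp

theorem rightComm_eq_actCoact (v : V) (t : D ⊗[ℂ] D) :
    (LinearMap.mul' ℂ D).rTensor V (TensorProduct.rightComm ℂ D V D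
      ((δ.toLinearMap ∘ₗ TensorProduct.lift act.toLinearMap).rTensor D
        (TensorProduct.rightComm ℂ D D V (t ⊗ₜ v)))) = actCoact act δ v t := by
  induction t with
  | zero => simp
  | add s t hs ht => simp only [map_add, TensorProduct.add_tmul, hs, ht]
  | tmul h h' =>
    rw [actCoact_tmul]
    simp only [TensorProduct.rightComm_tmul, LinearMap.rTensor_tmul, LinearMap.comp_apply,
      TensorProduct.lift.tmul, AlgHom.toLinearMap_apply]
    generalize δ (act h v) = z
    induction z with
    | zero => simp
    | add s t hs ht => simp only [map_add, TensorProduct.add_tmul, add_mul, hs, ht]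
    | tmul d x => simp

theorem mulAct_mul (t : D ⊗[ℂ] D) (z : D ⊗[ℂ] V) (k : D) :
    mulAct act t z * (k ⊗ₜ 1) = mulAct act t (z * (k ⊗ₜ 1)) := by
  induction t with
  | zero => simp
  | add s t hs ht => simp only [map_add, LinearMap.add_apply, add_mul, hs, ht]
  | tmul h h' =>
    induction z with
    | zero => simp
    | add s t hs ht => simp only [map_add, add_mul, hs, ht]
    | tmul d x => simp [mulAct_tmul, mul_assoc]

theorem actCoact_mul_tmul (v : V) (t : D ⊗[ℂ] D) (h k : D) :
    actCoact act δ v (t * (h ⊗ₜ k)) = actCoact act δ (act h v) t * (k ⊗ₜ 1) := by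
  induction t with
  | zero => simp
  | add s t hs ht => simp only [map_add, add_mul, hs, ht]
  | tmul h' k' =>
    simp [actCoact_tmul, mul_assoc]

/-- The elements `t = Δ(h)` that satisfy the Yetter-Drinfeld condition are closed under
multiplication. -/
theorem yd_mul {t t' : D ⊗[ℂ] D} (ht : ∀ v, mulAct act t (δ v) = actCoact act δ v t)
    (ht' : ∀ v, mulAct act t' (δ v) = actCoact act δ v t') (v : V) :
    mulAct act (t * t') (δ v) = actCoact act δ v (t * t') := by
  have key : ∀ s : D ⊗[ℂ] D, actCoact act δ v (t * s) = mulAct act t (actCoact act δ v s) :=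
    fun s => by
      induction s with
      | zero => simp
      | add a b ha hb => simp only [map_add, mul_add, ha, hb]
      | tmul h k => rw [actCoact_mul_tmul, ← ht, mulAct_mul, actCoact_tmul]
  rw [key, map_mul, Module.End.mul_apply, ht']

variable {K : Type*} [Ring K] [Algebra ℂ K] [HopfStr K] {f : K →ₐ[ℂ] D} {g : K →ₐ[ℂ] V}

/-- The Yetter-Drinfeld condition for the adjoint action through `g`. In the convolution algebra
both sides are `f g v g⁻¹`, where `f` and `g` have values in the two factors of `D ⊗ V`. -/
theorem yd_split {act : D →ₐ[ℂ] Module.End ℂ V} {δ : V →ₐ[ℂ] D ⊗[ℂ] V}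
    (hact : ∀ k, act (f k) = adRep g k) (hδ : ∀ k, δ (g k) = split f g k) (k : K) (v : V) :
    mulAct act (split f f k) (δ v) = actCoact act δ v (split f f k) := by
  have h1 : ∀ z, mulAct act (split f f k) z =
      (hom ((incL D V).comp f) * hom ((incR D V).comp g) * const K z *
        homInv ((incR D V).comp g)) k := fun z => by
    induction z with
    | zero =>
      have : const K (0 : D ⊗[ℂ] V) = 0 := conv_ext fun c => by simp
      rw [this, mul_zero, zero_mul, map_zero]; rfl
    | add x y hx hy =>
      have : const K (x + y : D ⊗[ℂ] V) = const K x + const K y := conv_ext fun c => by simp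
      rw [this, mul_add, add_mul, map_add, hx, hy]; rfl
    | tmul d x =>
      have e1 : const K (d ⊗ₜ[ℂ] x) = const K (d ⊗ₜ[ℂ] (1 : V)) * const K ((1 : D) ⊗ₜ[ℂ] x) := by
        rw [const_mul_const]; simp
      have e2 : const K (d ⊗ₜ[ℂ] (1 : V)) * hom ((incR D V).comp g) =
          hom ((incR D V).comp g) * const K (d ⊗ₜ[ℂ] (1 : V)) :=
        const_mul_comm fun c => by simp [Commute, SemiconjBy]
      have e3 : hom ((incR D V).comp g) * const K ((1 : D) ⊗ₜ[ℂ] x) * homInv ((incR D V).comp g) =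
          convMap (incR D V).toLinearMap (hom g * const K x * homInv g) := by
        rw [convMap_mul, convMap_mul, convMap_const]; rfl
      have e4 : hom ((incL D V).comp f) * hom ((incR D V).comp g) * const K (d ⊗ₜ[ℂ] x) *
          homInv ((incR D V).comp g) = hom ((incL D V).comp f) * const K (d ⊗ₜ[ℂ] (1 : V)) *
          convMap (incR D V).toLinearMap (hom g * const K x * homInv g) := by
        rw [← e3, e1]
        simp only [mul_assoc]
        rw [← mul_assoc (const K (d ⊗ₜ[ℂ] (1 : V))) (hom _), e2]
        simp only [mul_assoc]
      rw [e4, split_apply, map_sum, LinearMap.sum_apply, (ℛ ℂ k).convMul_apply]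
      refine Finset.sum_congr rfl fun i _ => ?_
      rw [mulAct_tmul, hact, mul_const_apply, convMap_apply, ← adRep_eq_conv]
      simp
  have hg : δ.comp g = split f g := AlgHom.ext hδ
  have e5 : convMap δ.toLinearMap (hom g * const K v * homInv g) =
      hom ((incL D V).comp f) * hom ((incR D V).comp g) * const K (δ v) *
        homInv ((incR D V).comp g) * homInv ((incL D V).comp f) := by
    have e6 : convMap δ.toLinearMap (homInv g) = homInv (δ.comp g) := rfl
    rw [convMap_mul, convMap_mul, convMap_const, convMap_hom, e6, hg, hom_split, homInv_split]
    simp only [mul_assoc]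
    rfl
  have h2 : actCoact act δ v (split f f k) =
      (convMap δ.toLinearMap (hom g * const K v * homInv g) * hom ((incL D V).comp f)) k := by
    rw [split_apply, map_sum, (ℛ ℂ k).convMul_apply]
    refine Finset.sum_congr rfl fun i _ => ?_
    rw [actCoact_tmul, hact, convMap_apply, ← adRep_eq_conv]
    rfl
  rw [h1, h2, e5, mul_assoc _ _ (hom ((incL D V).comp f)), homInv_mul_hom, mul_one]

end YD

theorem yd_dbl (h : P.Dbl) (v : P.Heis) :
    mulAct P.dblAct (P.dblComul h) (P.coact v) = actCoact P.dblAct P.coact v (P.dblComul h) := by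
  induction h using Tw.induction_on generalizing v with
  | zero => simp
  | add h k hh hk => simp only [map_add, LinearMap.add_apply, hh, hk]
  | mul a b =>
    rw [map_mul]
    refine yd_mul _ _ (fun v => ?_) (fun v => ?_) v
    · rw [dblComul_left]; exact yd_split P.dblAct_left P.coact_right a v
    · rw [dblComul_right]; exact yd_split P.dblAct_right P.coact_left b v

theorem isYetterDrinfeld_heis :
    IsYetterDrinfeld P.dblData P.dblAct.toLinearMap P.coact.toLinearMap where
  isModule := P.isModule_dblAct
  isComodule := P.isComodule_coact
  compat h v := ((map_mul_lift_eq_mulAct _ _ _).trans (P.yd_dbl h v)).trans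
    (rightComm_eq_actCoact _ _ _ _).symm

end SkewPairing

/-! ### The explicit formulas for the doubles, the action and the coaction -/

section Adjoint

variable {K R R' : Type*} [Ring K] [Algebra ℂ K] [HopfStr K] [Ring R] [Algebra ℂ R]
  [Ring R'] [Algebra ℂ R']

theorem adRep_comp (F : R →ₐ[ℂ] R') (f : K →ₐ[ℂ] R) (k : K) (x : R) :
    adRep (F.comp f) k (F x) = F (adRep f k x) := by
  simp [adRep_sum]

theorem adjointAction_eq (k x : K) :
    adjointAction HopfStr.str k x = adRep (AlgHom.id ℂ K) k x := by
  rw [adRep_sum, adjointAction, LinearMap.comp_apply]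
  have hk : (HopfStr.str (A := K)).comul.toLinearMap k = ∑ i ∈ (ℛ ℂ k).index,
      (ℛ ℂ k).left i ⊗ₜ[ℂ] (ℛ ℂ k).right i := (ℛ ℂ k).eq.symm
  rw [hk]
  simp only [map_sum, LinearMap.sum_apply]
  refine Finset.sum_congr rfl fun i _ => ?_
  exact (mul_assoc _ _ _).symm

end Adjoint

namespace SkewPairing

variable {A B : Type*} [Ring A] [Algebra ℂ A] [Ring B] [Algebra ℂ B] [HopfStr A] [HopfStr B]
  (P : SkewPairing A B)

theorem heisenbergMul_eq :
    (heisenbergMul HopfStr.str HopfStr.str P.form :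
      (B ⊗[ℂ] A) ⊗[ℂ] (B ⊗[ℂ] A) →ₗ[ℂ] B ⊗[ℂ] A) = LinearMap.mul' ℂ P.Heis :=
  TensorProduct.ext' fun _ _ => rfl

variable {R : Type*} [Ring R] [Algebra ℂ R]

theorem inl_mul_inr_mul_inl_apply (f f' : Conv A R) (g : Conv B R) (a : A) (b : B) :
    (inl B f * inr A g * inl B f') (a ⊗ₜ b) = (f * const A (g b) * f') a := by
  rw [conv_tensor_apply, (ℛ ℂ a).convMul_apply]
  refine Finset.sum_congr rfl fun i _ => ?_
  rw [mul_const_apply]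
  conv_rhs => rw [← sum_map_smul_counit g.ofConv b]
  simp only [inl_mul_inr_apply, inl_apply, mul_smul_comm, Finset.mul_sum, Finset.sum_mul,
    smul_mul_assoc]

theorem inr_mul_inl_mul_inr_apply (f : Conv A R) (g g' : Conv B R) (a : A) (b : B) :
    (inr A g * inl B f * inr A g') (a ⊗ₜ b) = (g * const B (f a) * g') b := by
  rw [conv_tensor_apply, (ℛ ℂ b).convMul_apply, Finset.sum_comm]
  refine Finset.sum_congr rfl fun i _ => ?_
  rw [mul_const_apply]
  conv_rhs => rw [← sum_map_smul_counit f.ofConv a]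
  simp only [inr_mul_inl_apply, inr_apply, mul_smul_comm, Finset.mul_sum, Finset.sum_mul,
    smul_mul_assoc]

variable {P}

/-- Wherever the Heisenberg rule holds, the adjoint action of `A` on `B` is
`a · y = ∑ φ(a, y₁) y₂`. -/
theorem IsHeis.adRep_left {f : A →ₐ[ℂ] R} {g : B →ₐ[ℂ] R} (h : P.IsHeis f g) (a : A) (y : B) :
    adRep f a (g y) = g (P.sliceHom a y) := by
  have e1 : inl B (hom f) * inr A (hom g) * inl B (homInv f) = scalar R P.val * inr A (hom g) := by
    rw [h, mul_assoc, mul_assoc, ← inl_mul, hom_mul_homInv, inl_one, mul_one]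
  have e2 := congrArg (fun u : Conv (A ⊗[ℂ] B) R => u (a ⊗ₜ y)) e1
  simp only [inl_mul_inr_mul_inl_apply] at e2
  refine (adRep_eq_conv f a (g y)).trans (e2.trans ?_)
  rw [conv_tensor_apply, Finset.sum_comm, sliceHom_apply, map_sum]
  refine Finset.sum_congr rfl fun j _ => ?_
  have e3 := sum_map_smul_counit (P.form.flip ((ℛ ℂ y).left j)) a
  simp only [LinearMap.flip_apply, smul_eq_mul] at e3
  simp only [scalar_apply, val_apply, inr_apply, hom_apply, ← Algebra.smul_def, smul_smul, map_smul]
  rw [← Finset.sum_smul, ← e3]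
  simp only [mul_comm]

/-- Wherever the Heisenberg rule holds, the adjoint action of `B` on `A` is
`b · x = ∑ φ(x₁, S(b)) x₂`. -/
theorem IsHeis.adRep_right {f : A →ₐ[ℂ] R} {g : B →ₐ[ℂ] R} (h : P.IsHeis f g) (b : B) (x : A) :
    adRep g b (f x) = f (slice comul (P.form.flip (antipode ℂ b)) x) := by
  have e1 : inr A (hom g) * inl B (hom f) * inr A (homInv g) = scalar R P.inv * inl B (hom f) := by
    have e0 : inr A (hom g) * inl B (hom f) =
        scalar R P.inv * (inl B (hom f) * inr A (hom g)) := by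
      rw [h, ← mul_assoc, scalar_inv_mul_val, one_mul]
    rw [e0, mul_assoc, mul_assoc, ← inr_mul, hom_mul_homInv, inr_one, mul_one]
  have e2 := congrArg (fun u : Conv (A ⊗[ℂ] B) R => u (x ⊗ₜ b)) e1
  simp only [inr_mul_inl_mul_inr_apply] at e2
  refine (adRep_eq_conv g b (f x)).trans (e2.trans ?_)
  rw [conv_tensor_apply, slice_apply _ (ℛ ℂ x), map_sum]
  refine Finset.sum_congr rfl fun i _ => ?_
  have e3 := sum_map_smul_counit (P.form ((ℛ ℂ x).left i) ∘ₗ antipode ℂ) b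
  simp only [LinearMap.comp_apply, smul_eq_mul] at e3
  simp only [scalar_apply, inv_apply', inl_apply, hom_apply, ← Algebra.smul_def, smul_smul,
    map_smul, LinearMap.flip_apply]
  rw [← Finset.sum_smul, ← e3]
  simp only [mul_comm]

variable (P)

theorem schrodingerRight_tmul (a : A) (b y : B) :
    schrodingerRight (HopfStr.str (A := A)) HopfStr.str P.form (a ⊗ₜ b) y =
      P.sliceHom a (adRep (AlgHom.id ℂ B) b y) :=
  congrArg (P.sliceHom a) (adjointAction_eq b y)

theorem schrodingerLeft_tmul (a : A) (b : B) (x : A) :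
    schrodingerLeft HopfStr.str HopfStr.str P.form (a ⊗ₜ b) x =
      adRep (AlgHom.id ℂ A) a (slice comul (P.form.flip (antipode ℂ b)) x) :=
  adjointAction_eq a _

/-- The diagonal action of the quantum double on `B ⊗ A` is its inner action on the Heisenberg
double. -/
theorem heisenbergAction_eq :
    (heisenbergAction HopfStr.str HopfStr.str P.form :
      A ⊗[ℂ] B →ₗ[ℂ] B ⊗[ℂ] A →ₗ[ℂ] B ⊗[ℂ] A) = P.dblAct.toLinearMap := by
  refine TensorProduct.ext' fun a b => TensorProduct.ext' fun y x => ?_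
  have e1 : heisenbergAction HopfStr.str HopfStr.str P.form (a ⊗ₜ b) (y ⊗ₜ x) =
      ∑ i ∈ (ℛ ℂ a).index, ∑ j ∈ (ℛ ℂ b).index,
        P.sliceHom ((ℛ ℂ a).left i) (adRep (AlgHom.id ℂ B) ((ℛ ℂ b).left j) y) ⊗ₜ[ℂ]
          adRep (AlgHom.id ℂ A) ((ℛ ℂ a).right i)
            (slice comul (P.form.flip (antipode ℂ ((ℛ ℂ b).right j))) x) := by
    rw [heisenbergAction, LinearMap.comp_apply, tensorComul_eq, comul_tensor]
    simp only [map_sum, LinearMap.sum_apply]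
    refine Finset.sum_congr rfl fun i _ => Finset.sum_congr rfl fun j _ => ?_
    rw [← schrodingerRight_tmul, ← schrodingerLeft_tmul]
    rfl
  have e2 : P.dblAct (Tw.of P.dblTwist (a ⊗ₜ b)) (Tw.of P.heisTwist (y ⊗ₜ x)) =
      Tw.of P.heisTwist (∑ i ∈ (ℛ ℂ a).index, ∑ j ∈ (ℛ ℂ b).index,
        P.sliceHom ((ℛ ℂ a).left i) (adRep (AlgHom.id ℂ B) ((ℛ ℂ b).left j) y) ⊗ₜ[ℂ]
          adRep (AlgHom.id ℂ A) ((ℛ ℂ a).right i)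
            (slice comul (P.form.flip (antipode ℂ ((ℛ ℂ b).right j))) x)) := by
    rw [← Tw.left_mul_right, ← Tw.left_mul_right, map_mul P.dblAct, Module.End.mul_apply,
      dblAct_left, dblAct_right, adRep_mul, map_sum, Finset.sum_comm, map_sum]
    refine Finset.sum_congr rfl fun j _ => ?_
    have h1 : ∀ b y, adRep P.heisB b (P.heisB y) = P.heisB (adRep (AlgHom.id ℂ B) b y) :=
      fun b y => adRep_comp P.heisB (AlgHom.id ℂ B) b y
    have h2 : ∀ a x, adRep P.heisA a (P.heisA x) = P.heisA (adRep (AlgHom.id ℂ A) a x) :=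
      fun a x => adRep_comp P.heisA (AlgHom.id ℂ A) a x
    rw [h1, P.isHeis_heis.adRep_right, adRep_mul, map_sum]
    refine Finset.sum_congr rfl fun i _ => ?_
    rw [h2, P.isHeis_heis.adRep_left, ← Tw.left_mul_right]
  exact e1.trans e2.symm

theorem heisenbergCoaction_eq :
    (heisenbergCoaction HopfStr.str HopfStr.str P.form :
      B ⊗[ℂ] A →ₗ[ℂ] (A ⊗[ℂ] B) ⊗[ℂ] (B ⊗[ℂ] A)) = P.coact.toLinearMap := by
  refine TensorProduct.ext' fun y x => ?_
  have e1 : P.coact (Tw.of P.heisTwist (y ⊗ₜ x)) =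
      ∑ j ∈ (ℛ ℂ y).index, ∑ i ∈ (ℛ ℂ x).index,
        (P.dblB ((ℛ ℂ y).left j) * P.dblA ((ℛ ℂ x).left i)) ⊗ₜ[ℂ]
          Tw.of P.heisTwist ((ℛ ℂ y).right j ⊗ₜ (ℛ ℂ x).right i) := by
    rw [← Tw.left_mul_right, map_mul, coact_left, coact_right, split_apply, split_apply,
      Finset.sum_mul_sum]
    refine Finset.sum_congr rfl fun i _ => Finset.sum_congr rfl fun j _ => ?_
    rw [Algebra.TensorProduct.tmul_mul_tmul, Tw.left_mul_right]
  refine Eq.trans ?_ e1.symm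
  simp only [heisenbergCoaction, LinearMap.comp_apply, TensorProduct.map_tmul]
  have hy : (HopfStr.str (A := B)).comul.toLinearMap y = ∑ j ∈ (ℛ ℂ y).index,
      (ℛ ℂ y).left j ⊗ₜ[ℂ] (ℛ ℂ y).right j := (ℛ ℂ y).eq.symm
  have hx : (HopfStr.str (A := A)).comul.toLinearMap x = ∑ i ∈ (ℛ ℂ x).index,
      (ℛ ℂ x).left i ⊗ₜ[ℂ] (ℛ ℂ x).right i := (ℛ ℂ x).eq.symm
  rw [hy, hx, TensorProduct.sum_tmul]
  simp only [TensorProduct.tmul_sum, map_sum]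
  refine Finset.sum_congr rfl fun i _ => Finset.sum_congr rfl fun j _ => ?_
  rfl

theorem isHopfAlgebra_quantumDouble :
    (quantumDouble HopfStr.str HopfStr.str P.form : BialgData (A ⊗[ℂ] B)).IsHopfAlgebra := by
  rw [quantumDouble_eq]
  exact P.isHopfAlgebra_dbl

theorem isModuleAlgebra_heisenberg :
    IsModuleAlgebra (quantumDouble HopfStr.str HopfStr.str P.form : BialgData (A ⊗[ℂ] B))
      (heisenbergMul HopfStr.str HopfStr.str P.form) (1 ⊗ₜ 1)
      (heisenbergAction HopfStr.str HopfStr.str P.form) := by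
  rw [quantumDouble_eq, heisenbergMul_eq, heisenbergAction_eq]
  exact P.isModuleAlgebra_heis

theorem isYetterDrinfeld_heisenberg :
    IsYetterDrinfeld (quantumDouble HopfStr.str HopfStr.str P.form : BialgData (A ⊗[ℂ] B))
      (heisenbergAction HopfStr.str HopfStr.str P.form)
      (heisenbergCoaction HopfStr.str HopfStr.str P.form) := by
  rw [quantumDouble_eq, heisenbergCoaction_eq, heisenbergAction_eq]
  exact P.isYetterDrinfeld_heis

end SkewPairing

/-! ### Restriction to subspaces -/

section Restrict

variable {X V : Type*} [AddCommGroup X] [Module ℂ X] [AddCommGroup V] [Module ℂ V]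
  (W : Submodule ℂ V)

theorem lTensor_subtype_injective (Y : Type*) [AddCommGroup Y] [Module ℂ Y] :
    Function.Injective (W.subtype.lTensor Y) := by
  obtain ⟨p, hp⟩ := W.subtype.exists_leftInverse_of_injective W.ker_subtype
  refine Function.LeftInverse.injective (g := p.lTensor Y) fun x => ?_
  rw [← LinearMap.comp_apply, ← LinearMap.lTensor_comp, hp, LinearMap.lTensor_id]
  rfl

/-- A subspace that is closed under the product, the action and the coaction inherits the
structures of a module algebra and of a Yetter-Drinfeld module. -/
theorem exists_restriction {H : BialgData X} {mul : V ⊗[ℂ] V →ₗ[ℂ] V} {one : V}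
    {act : X →ₗ[ℂ] V →ₗ[ℂ] V} {δ : V →ₗ[ℂ] X ⊗[ℂ] V} (hA : IsModuleAlgebra H mul one act)
    (hY : IsYetterDrinfeld H act δ) (h1 : one ∈ W) (hm : ∀ x ∈ W, ∀ y ∈ W, mul (x ⊗ₜ y) ∈ W)
    (ha : ∀ h, ∀ x ∈ W, act h x ∈ W)
    (hd : ∀ x ∈ W, δ x ∈ LinearMap.range (W.subtype.lTensor X)) :
    ∃ (mulW : W ⊗[ℂ] W →ₗ[ℂ] W) (oneW : W) (actW : X →ₗ[ℂ] W →ₗ[ℂ] W)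
      (coactW : W →ₗ[ℂ] X ⊗[ℂ] W),
      (∀ x y : W, (mulW (x ⊗ₜ y) : V) = mul ((x : V) ⊗ₜ (y : V))) ∧ (oneW : V) = one ∧
      (∀ u (x : W), (actW u x : V) = act u x) ∧
      (∀ x : W, W.subtype.lTensor X (coactW x) = δ x) ∧
      IsModuleAlgebra H mulW oneW actW ∧ IsYetterDrinfeld H actW coactW := by
  -- the restricted maps are obtained by composition with a projection `p` onto `W`
  obtain ⟨p, hp⟩ := W.subtype.exists_leftInverse_of_injective W.ker_subtype
  have hp' : ∀ x ∈ W, (p x : V) = x := fun x hx =>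
    congrArg Subtype.val (LinearMap.congr_fun hp ⟨x, hx⟩)
  let mulW : W ⊗[ℂ] W →ₗ[ℂ] W := p ∘ₗ mul ∘ₗ TensorProduct.map W.subtype W.subtype
  let actW : X →ₗ[ℂ] W →ₗ[ℂ] W := (act.compl₂ W.subtype).compr₂ p
  let coactW : W →ₗ[ℂ] X ⊗[ℂ] W := p.lTensor X ∘ₗ δ ∘ₗ W.subtype
  have emul : ∀ x y : W, (mulW (x ⊗ₜ y) : V) = mul ((x : V) ⊗ₜ (y : V)) := fun x y =>
    hp' _ (hm _ x.2 _ y.2)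
  have emul' : ∀ t : W ⊗[ℂ] W, (mulW t : V) = mul (TensorProduct.map W.subtype W.subtype t) :=
    fun t => by
      induction t with
      | zero => simp
      | add s t hs ht => simp only [map_add, Submodule.coe_add, hs, ht]
      | tmul x y => rw [emul]; rfl
  have eact : ∀ u (x : W), (actW u x : V) = act u x := fun u x => hp' _ (ha u _ x.2)
  have ecoact : ∀ x : W, W.subtype.lTensor X (coactW x) = δ x := fun x => by
    obtain ⟨z, hz⟩ := hd x x.2
    have : coactW x = p.lTensor X (δ x) := rfl
    rw [this, ← hz, ← LinearMap.comp_apply (p.lTensor X), ← LinearMap.lTensor_comp, hp,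
      LinearMap.lTensor_id]
    rfl
  have hmod : IsModule H actW :=
    { one_act := fun v => Subtype.ext (by rw [eact, hY.isModule.one_act])
      mul_act := fun x y v => Subtype.ext (by rw [eact, eact, eact, hY.isModule.mul_act]) }
  refine ⟨mulW, ⟨one, h1⟩, actW, coactW, emul, rfl, eact, ecoact, ⟨⟨?_, ?_, ?_⟩, hmod, ?_, ?_⟩,
    ⟨hmod, ⟨?_, ?_⟩, ?_⟩⟩
  · exact fun x => Subtype.ext (by rw [emul, hA.isAlgebra.one_mul])
  · exact fun x => Subtype.ext (by rw [emul, hA.isAlgebra.mul_one])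
  · exact fun x y z => Subtype.ext (by simp only [emul, hA.isAlgebra.mul_assoc])
  · refine fun h x y => Subtype.ext ?_
    rw [eact, emul, hA.act_mul, emul']
    congr 1
    induction H.comul h with
    | zero => simp
    | add s t hs ht => simp only [map_add, LinearMap.add_apply, hs, ht]
    | tmul h k => simp [eact]
  · exact fun h => Subtype.ext (by rw [eact]; exact hA.act_one h)
  · intro v
    have h2 : Function.Injective ((W.subtype.lTensor X).lTensor X) := by
      refine Function.LeftInverse.injective (g := (p.lTensor X).lTensor X) fun x => ?_
      rw [← LinearMap.comp_apply, ← LinearMap.lTensor_comp, ← LinearMap.lTensor_comp, hp,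
        LinearMap.lTensor_id, LinearMap.lTensor_id]
      rfl
    apply h2
    have e1 : ∀ z : X ⊗[ℂ] W, (W.subtype.lTensor X).lTensor X
        (TensorProduct.assoc ℂ X X W (H.comul.rTensor W z)) =
        TensorProduct.assoc ℂ X X V (H.comul.rTensor V (W.subtype.lTensor X z)) := fun z => by
      induction z with
      | zero => simp
      | add s t hs ht => simp only [map_add, hs, ht]
      | tmul x w =>
        simp only [LinearMap.rTensor_tmul, LinearMap.lTensor_tmul]
        induction H.comul x with
        | zero => simp
        | add s t hs ht => simp only [map_add, TensorProduct.add_tmul, hs, ht]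
        | tmul x y => simp
    have e2 : ∀ z : X ⊗[ℂ] W, (W.subtype.lTensor X).lTensor X (coactW.lTensor X z) =
        δ.lTensor X (W.subtype.lTensor X z) := fun z => by
      induction z with
      | zero => simp
      | add s t hs ht => simp only [map_add, hs, ht]
      | tmul x w => simp only [LinearMap.lTensor_tmul, ecoact, Submodule.subtype_apply]
    rw [e1, e2, ecoact, hY.isComodule.coassoc]
  · intro v
    apply Subtype.ext
    have e1 : ∀ z : X ⊗[ℂ] W, (TensorProduct.lid ℂ W (H.counit.rTensor W z) : V) =
        TensorProduct.lid ℂ V (H.counit.rTensor V (W.subtype.lTensor X z)) := fun z => by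
      induction z with
      | zero => simp
      | add s t hs ht => simp only [map_add, Submodule.coe_add, hs, ht]
      | tmul x w => simp
    rw [e1, ecoact, hY.isComodule.counit]
  · intro h v
    apply lTensor_subtype_injective W X
    have e1 : W.subtype.lTensor X (ydLeft H actW coactW (h ⊗ₜ v)) =
        ydLeft H act δ (h ⊗ₜ (v : V)) := by
      have e : ∀ (t : X ⊗[ℂ] X) (z : X ⊗[ℂ] W),
          W.subtype.lTensor X (TensorProduct.map H.mul (TensorProduct.lift actW)
            (TensorProduct.tensorTensorTensorComm ℂ X X X W (t ⊗ₜ z))) =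
          TensorProduct.map H.mul (TensorProduct.lift act)
            (TensorProduct.tensorTensorTensorComm ℂ X X X V (t ⊗ₜ W.subtype.lTensor X z)) :=
        fun t z => by
          induction t with
          | zero => simp
          | add s t hs ht => simp only [map_add, TensorProduct.add_tmul, hs, ht]
          | tmul x y =>
            induction z with
            | zero => simp
            | add s t hs ht => simp only [map_add, TensorProduct.tmul_add, hs, ht]
            | tmul x' w => simp [eact]
      refine (e (H.comul h) (coactW v)).trans ?_
      rw [ecoact]
      rfl
    have e2 : W.subtype.lTensor X (ydRight H actW coactW (h ⊗ₜ v)) =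
        ydRight H act δ (h ⊗ₜ (v : V)) := by
      have e : ∀ (t : X ⊗[ℂ] X), W.subtype.lTensor X (H.mul.rTensor W
            (TensorProduct.rightComm ℂ X W X ((coactW ∘ₗ TensorProduct.lift actW).rTensor X
            (TensorProduct.rightComm ℂ X X W (t ⊗ₜ v))))) =
          H.mul.rTensor V (TensorProduct.rightComm ℂ X V X ((δ ∘ₗ TensorProduct.lift act).rTensor X
            (TensorProduct.rightComm ℂ X X V (t ⊗ₜ (v : V))))) := fun t => by
        induction t with
        | zero => simp
        | add s t hs ht => simp only [map_add, TensorProduct.add_tmul, hs, ht]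
        | tmul x y =>
          simp only [TensorProduct.rightComm_tmul, LinearMap.rTensor_tmul, LinearMap.comp_apply,
            TensorProduct.lift.tmul, ← eact, ← ecoact]
          induction coactW (actW x v) with
          | zero => simp
          | add s t hs ht => simp only [map_add, TensorProduct.add_tmul, hs, ht]
          | tmul x' w => simp
      exact e (H.comul h)
    rw [e1, e2, hY.compat]

end Restrict

section Generated

theorem subalgebraGenerated_mul' {V : Type*} [Ring V] [Algebra ℂ V] (G : Set V) :
    subalgebraGenerated (LinearMap.mul' ℂ V) 1 G =
      Subalgebra.toSubmodule (Algebra.adjoin ℂ G) := by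
  apply le_antisymm
  · refine sInf_le ⟨one_mem (Algebra.adjoin ℂ G), Algebra.subset_adjoin, fun x hx y hy => ?_⟩
    rw [LinearMap.mul'_apply]
    exact mul_mem (S := Subalgebra ℂ V) hx hy
  · refine le_sInf fun p hp x hx => ?_
    refine Algebra.adjoin_induction (p := fun x _ => x ∈ p) (fun x hx => hp.2.1 hx)
      (fun c => ?_) (fun x y _ _ hx hy => add_mem hx hy) (fun x y _ _ hx hy => ?_) hx
    · rw [Algebra.algebraMap_eq_smul_one]
      exact p.smul_mem c hp.1
    · exact hp.2.2 x hx y hy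

end Generated

/-! ### The relations of `U^≥` and `U^≤` -/

namespace CartanDatum

variable {n : ℕ} (C : CartanDatum n) (r s : ℂ)

/-- The number `q_ij = r^(-⟨i,j⟩) s^⟨j,i⟩` with `K'_i E_j = q_ij E_j K'_i` and
`K_i F_j = q_ji F_j K_i`. -/
def q (i j : Fin n) : ℂ := r ^ (-C.euler i j) * s ^ C.euler j i

/-- The generator `K'_i⁻¹` as an element of the algebra. -/
abbrev Kinv' (i : Fin n) : C.UGe r s := ((C.K' r s i)⁻¹ : (C.UGe r s)ˣ)

/-- The generator `K_i⁻¹` as an element of the algebra. -/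
abbrev Kinv (i : Fin n) : C.ULe r s := ((C.K r s i)⁻¹ : (C.ULe r s)ˣ)

variable {C r s}

theorem K'_mul_E (i j : Fin n) :
    (C.K' r s i : C.UGe r s) * C.E r s j = C.q r s i j • (C.E r s j * C.K' r s i) := by
  have h := RingQuot.mkAlgHom_rel ℂ (RelGe.k_x (C := C) (r := r) (s := s) i j)
  simp only [map_mul, map_smul] at h
  change (C.K' r s i : C.UGe r s) * C.E r s j * C.Kinv' r s i = C.q r s i j • C.E r s j at h
  rw [← smul_mul_assoc, ← h, mul_assoc _ (C.Kinv' r s i), Units.inv_mul, mul_one]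

theorem K_mul_F (i j : Fin n) :
    (C.K r s i : C.ULe r s) * C.F r s j = C.q r s j i • (C.F r s j * C.K r s i) := by
  have h := RingQuot.mkAlgHom_rel ℂ (RelLe.k_x (C := C) (r := r) (s := s) i j)
  simp only [map_mul, map_smul] at h
  change (C.K r s i : C.ULe r s) * C.F r s j * C.Kinv r s i = C.q r s j i • C.F r s j at h
  rw [← smul_mul_assoc, ← h, mul_assoc _ (C.Kinv r s i), Units.inv_mul, mul_one]

theorem K'_comm (i j : Fin n) : Commute (C.K' r s i) (C.K' r s j) := by
  have h := RingQuot.mkAlgHom_rel ℂ (RelGe.k_comm (C := C) (r := r) (s := s) i j)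
  simp only [map_mul] at h
  exact Units.ext h

theorem K_comm (i j : Fin n) : Commute (C.K r s i) (C.K r s j) := by
  have h := RingQuot.mkAlgHom_rel ℂ (RelLe.k_comm (C := C) (r := r) (s := s) i j)
  simp only [map_mul] at h
  exact Units.ext h

/-- `U^≥` is generated by the `E_i`, `K'_i` and `K'_i⁻¹`. -/
theorem UGe_generated (S : Subalgebra ℂ (C.UGe r s)) (hE : ∀ i, C.E r s i ∈ S)
    (hK : ∀ i, (C.K' r s i : C.UGe r s) ∈ S) (hK' : ∀ i, C.Kinv' r s i ∈ S) (x : C.UGe r s) :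
    x ∈ S := by
  obtain ⟨y, rfl⟩ := RingQuot.mkAlgHom_surjective ℂ (C.RelGe r s) x
  induction y using FreeAlgebra.induction with
  | grade0 c => rw [AlgHom.commutes]; exact S.algebraMap_mem c
  | grade1 g =>
    cases g with
    | x i => exact hE i
    | k i => exact hK i
    | kinv i => exact hK' i
  | mul a b ha hb => rw [map_mul]; exact mul_mem ha hb
  | add a b ha hb => rw [map_add]; exact add_mem ha hb

/-- `U^≤` is generated by the `F_i`, `K_i` and `K_i⁻¹`. -/
theorem ULe_generated (S : Subalgebra ℂ (C.ULe r s)) (hF : ∀ i, C.F r s i ∈ S)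
    (hK : ∀ i, (C.K r s i : C.ULe r s) ∈ S) (hK' : ∀ i, C.Kinv r s i ∈ S) (x : C.ULe r s) :
    x ∈ S := by
  obtain ⟨y, rfl⟩ := RingQuot.mkAlgHom_surjective ℂ (C.RelLe r s) x
  induction y using FreeAlgebra.induction with
  | grade0 c => rw [AlgHom.commutes]; exact S.algebraMap_mem c
  | grade1 g =>
    cases g with
    | x i => exact hF i
    | k i => exact hK i
    | kinv i => exact hK' i
  | mul a b ha hb => rw [map_mul]; exact mul_mem ha hb
  | add a b ha hb => rw [map_add]; exact add_mem ha hb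

theorem q_ne_zero (hr : r ≠ 0) (hs : s ≠ 0) (i j : Fin n) : C.q r s i j ≠ 0 :=
  mul_ne_zero (zpow_ne_zero _ hr) (zpow_ne_zero _ hs)

theorem parameter_sub_ne_zero (hs : s ≠ 0) (hrs : ∀ m : ℕ, 0 < m → (r * s⁻¹) ^ m ≠ 1)
    (i : Fin n) : s ^ C.d i - r ^ C.d i ≠ 0 := fun h => by
  apply hrs (C.d i) (C.d_pos i)
  rw [mul_pow, inv_pow, ← sub_eq_zero.1 h, mul_inv_cancel₀ (pow_ne_zero _ hs)]

end CartanDatum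

/-! ### The quantized Weyl algebra is stable -/

section Explicit

variable {K R R₁ R₂ : Type*} [Ring K] [Algebra ℂ K] [HopfStr K] [Ring R] [Algebra ℂ R]
  [Ring R₁] [Algebra ℂ R₁] [Ring R₂] [Algebra ℂ R₂]

theorem adRep_eq_comul (f : K →ₐ[ℂ] R) (k : K) (x : R) :
    adRep f k x = AlgHom.mulLeftRight ℂ R (TensorProduct.map f.toLinearMap
      (f.op.comp (antipodeAlgHomOp ℂ K)).toLinearMap (comul (R := ℂ) k)) x := rfl

theorem adRep_groupLike {k k' : K} (h : comul (R := ℂ) k = k ⊗ₜ k) (h' : antipode ℂ k = k')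
    (f : K →ₐ[ℂ] R) (x : R) : adRep f k x = f k * x * f k' := by
  rw [adRep_eq_comul, h]
  simp [h']

theorem adRep_skewPrimitive {k a b c d b' d' : K} (h : comul (R := ℂ) k = a ⊗ₜ b + c ⊗ₜ d)
    (hb : antipode ℂ b = b') (hd : antipode ℂ d = d') (f : K →ₐ[ℂ] R) (x : R) :
    adRep f k x = f a * x * f b' + f c * x * f d' := by
  rw [adRep_eq_comul, h]
  simp [hb, hd]

theorem split_skewPrimitive {k a b c d : K} (h : comul (R := ℂ) k = a ⊗ₜ b + c ⊗ₜ d)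
    (f : K →ₐ[ℂ] R₁) (g : K →ₐ[ℂ] R₂) : split f g k = f a ⊗ₜ g b + f c ⊗ₜ g d := by
  rw [SkewPairing.split_eq, h]
  simp

end Explicit

theorem comul_inv {K : Type*} [Ring K] [Algebra ℂ K] [HopfStr K] (u : Kˣ)
    (h : comul (R := ℂ) (u : K) = (u : K) ⊗ₜ (u : K)) :
    comul (R := ℂ) ((u⁻¹ : Kˣ) : K) = ((u⁻¹ : Kˣ) : K) ⊗ₜ ((u⁻¹ : Kˣ) : K) := by
  refine left_inv_eq_right_inv (a := comul (R := ℂ) (u : K)) ?_ ?_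
  · rw [← Bialgebra.comul_mul, Units.inv_mul, Bialgebra.comul_one]
  · rw [h]
    simp [Algebra.TensorProduct.one_def]

theorem antipode_inv {K : Type*} [Ring K] [Algebra ℂ K] [HopfStr K] (u : Kˣ)
    (h : antipode ℂ (u : K) = ((u⁻¹ : Kˣ) : K)) : antipode ℂ ((u⁻¹ : Kˣ) : K) = u := by
  refine left_inv_eq_right_inv (a := antipode ℂ (u : K)) ?_ ?_
  · rw [← antipode_mul_antidistrib, Units.mul_inv, antipode_one]
  · rw [h]; simp

/-- Generators `E_i`, `K'_i` of `A` and `F_i`, `K_i` of `B` for which the relations between the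
`K`s and the others, the comultiplications and the antipodes have the form that they have in `U^≥`
and `U^≤`. -/
structure BorelPair (I A B : Type*) [Ring A] [Algebra ℂ A] [HopfStr A] [Ring B] [Algebra ℂ B]
    [HopfStr B] where
  E : I → A
  K' : I → Aˣ
  F : I → B
  K : I → Bˣ
  q : I → I → ℂ
  q_ne_zero : ∀ i j, q i j ≠ 0
  generatedA : ∀ S : Subalgebra ℂ A, (∀ i, E i ∈ S) → (∀ i, (K' i : A) ∈ S) →
    (∀ i, ((K' i)⁻¹ : Aˣ).val ∈ S) → ∀ x, x ∈ S
  generatedB : ∀ S : Subalgebra ℂ B, (∀ i, F i ∈ S) → (∀ i, (K i : B) ∈ S) →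
    (∀ i, ((K i)⁻¹ : Bˣ).val ∈ S) → ∀ x, x ∈ S
  K'_comm : ∀ i j, Commute (K' i) (K' j)
  K'_mul_E : ∀ i j, (K' i : A) * E j = q i j • (E j * K' i)
  K_mul_F : ∀ i j, (K i : B) * F j = q j i • (F j * K i)
  comul_K' : ∀ i, comul (R := ℂ) (K' i : A) = (K' i : A) ⊗ₜ (K' i : A)
  comul_E : ∀ i, comul (R := ℂ) (E i) = E i ⊗ₜ (K' i : A) + 1 ⊗ₜ E i
  antipode_K' : ∀ i, antipode ℂ (K' i : A) = ((K' i)⁻¹ : Aˣ)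
  antipode_E : ∀ i, antipode ℂ (E i) = -(E i * ((K' i)⁻¹ : Aˣ))
  comul_K : ∀ i, comul (R := ℂ) (K i : B) = (K i : B) ⊗ₜ (K i : B)
  comul_F : ∀ i, comul (R := ℂ) (F i) = F i ⊗ₜ 1 + (K i : B) ⊗ₜ F i
  antipode_K : ∀ i, antipode ℂ (K i : B) = ((K i)⁻¹ : Bˣ)
  antipode_F : ∀ i, antipode ℂ (F i) = -(((K i)⁻¹ : Bˣ) * F i)

namespace BorelPair

variable {I A B : Type*} [Ring A] [Algebra ℂ A] [HopfStr A] [Ring B] [Algebra ℂ B] [HopfStr B]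
  (H : BorelPair I A B)

/-- The generator `K'_i⁻¹` as an element of the algebra. -/
abbrev Kinv' (i : I) : A := ((H.K' i)⁻¹ : Aˣ)

/-- The generator `K_i⁻¹` as an element of the algebra. -/
abbrev Kinv (i : I) : B := ((H.K i)⁻¹ : Bˣ)

/-- The element `K'_i⁻¹ E_i`, which generates the quantized Weyl algebra together with the `F_i`. -/
def e0 (i : I) : A := H.Kinv' i * H.E i

theorem K'_mul_e0 (i j : I) :
    (H.K' i : A) * H.e0 j = H.q i j • (H.e0 j * H.K' i) := by
  have h : (H.K' i : A) * H.Kinv' j = H.Kinv' j * H.K' i :=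
    congrArg Units.val (H.K'_comm i j).inv_right.eq
  rw [e0, ← mul_assoc, h, mul_assoc, H.K'_mul_E, mul_smul_comm, mul_assoc]

theorem K'_conj_e0 (i j : I) :
    (H.K' i : A) * H.e0 j * H.Kinv' i = H.q i j • H.e0 j := by
  rw [H.K'_mul_e0, smul_mul_assoc, mul_assoc, Units.mul_inv, mul_one]

theorem Kinv'_conj_e0 (i j : I) :
    H.Kinv' i * H.e0 j * H.K' i = (H.q i j)⁻¹ • H.e0 j := by
  have h := H.K'_mul_e0 i j
  rw [mul_assoc, ← inv_smul_smul₀ (H.q_ne_zero i j) (H.e0 j * _), ← h, mul_smul_comm,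
    ← mul_assoc, Units.inv_mul, one_mul]

theorem K_conj_F (i j : I) :
    (H.K i : B) * H.F j * H.Kinv i = H.q j i • H.F j := by
  rw [H.K_mul_F, smul_mul_assoc, mul_assoc, Units.mul_inv, mul_one]

theorem Kinv_conj_F (i j : I) :
    H.Kinv i * H.F j * H.K i = (H.q j i)⁻¹ • H.F j := by
  have h := H.K_mul_F i j
  rw [mul_assoc, ← inv_smul_smul₀ (H.q_ne_zero j i) (H.F j * _), ← h, mul_smul_comm,
    ← mul_assoc, Units.inv_mul, one_mul]

theorem comul_e0 (i : I) :
    comul (R := ℂ) (H.e0 i) = H.e0 i ⊗ₜ 1 + H.Kinv' i ⊗ₜ H.e0 i := by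
  rw [e0, Bialgebra.comul_mul, H.comul_E, comul_inv _ (H.comul_K' i)]
  simp [mul_add]

variable (P : SkewPairing A B)

/-- The quantized Weyl algebra, as a subalgebra of the Heisenberg double. -/
def weylAlg : Subalgebra ℂ P.Heis :=
  Algebra.adjoin ℂ (Set.range (fun i => P.heisA (H.e0 i)) ∪
    Set.range (fun i => P.heisB (H.F i)))

theorem e0_mem_weylAlg (i : I) : P.heisA (H.e0 i) ∈ H.weylAlg P :=
  Algebra.subset_adjoin (Or.inl ⟨i, rfl⟩)

theorem F_mem_weylAlg (i : I) : P.heisB (H.F i) ∈ H.weylAlg P :=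
  Algebra.subset_adjoin (Or.inr ⟨i, rfl⟩)

variable {H P}

@[elab_as_elim]
theorem weylAlg_induction {p : ∀ x : P.Heis, x ∈ H.weylAlg P → Prop} (h1 : p 1 (one_mem _))
    (hadd : ∀ x y hx hy, p x hx → p y hy → p (x + y) (add_mem hx hy))
    (hsmul : ∀ (c : ℂ) x hx, p x hx → p (c • x) (Subalgebra.smul_mem _ hx c))
    (hmul : ∀ x hx y hy, p x hx → p y hy → p (x * y) (mul_mem hx hy))
    (he : ∀ i, p (P.heisA (H.e0 i)) (H.e0_mem_weylAlg P i))
    (hF : ∀ i, p (P.heisB (H.F i)) (H.F_mem_weylAlg P i)) {x : P.Heis}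
    (hx : x ∈ H.weylAlg P) : p x hx := by
  refine Algebra.adjoin_induction (p := p) ?_ (fun c => ?_)
    (fun x y hx hy => hadd x y hx hy) (fun x y hx hy => hmul x hx y hy) hx
  · rintro x (⟨i, rfl⟩ | ⟨i, rfl⟩)
    · exact he i
    · exact hF i
  · have : ∀ (y) (hy : y ∈ H.weylAlg P), y = c • 1 → p y hy := by
      rintro _ _ rfl
      exact hsmul c 1 (one_mem _) h1
    exact this _ _ (Algebra.algebraMap_eq_smul_one c)

variable (H)

/-- The map `y ↦ ∑ φ(a, y₁) y₂` sends `F_i` to the span of `1` and `F_i`. -/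
theorem adRep_heisA_F (a : A) (i : I) :
    adRep P.heisA a (P.heisB (H.F i)) ∈ H.weylAlg P := by
  have e : P.sliceHom a (H.F i) =
      P.form a (H.F i) • 1 + P.form a (H.K i) • H.F i := by
    change TensorProduct.lid ℂ _ ((P.form a).rTensor _ (comul (H.F i))) = _
    rw [H.comul_F]
    simp
  rw [P.isHeis_heis.adRep_left, e, map_add, map_smul, map_smul, map_one]
  exact add_mem (Subalgebra.smul_mem _ (one_mem _) _)
    (Subalgebra.smul_mem _ (H.F_mem_weylAlg P i) _)

/-- The map `x ↦ ∑ φ(x₁, S(b)) x₂` sends `K'_i⁻¹ E_i` to the span of `1` and `K'_i⁻¹ E_i`. -/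
theorem adRep_heisB_e0 (b : B) (i : I) :
    adRep P.heisB b (P.heisA (H.e0 i)) ∈ H.weylAlg P := by
  have e : slice comul (P.form.flip (antipode ℂ b)) (H.e0 i) =
      P.form (H.e0 i) (antipode ℂ b) • 1 +
        P.form (H.Kinv' i) (antipode ℂ b) • H.e0 i := by
    change TensorProduct.lid ℂ _ ((P.form.flip (antipode ℂ b)).rTensor _ (comul (H.e0 i))) = _
    rw [H.comul_e0]
    simp
  rw [P.isHeis_heis.adRep_right, e, map_add, map_smul, map_smul, map_one]
  exact add_mem (Subalgebra.smul_mem _ (one_mem _) _)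
    (Subalgebra.smul_mem _ (H.e0_mem_weylAlg P i) _)

theorem adRep_K' (j : I) (x : P.Heis) :
    adRep P.heisA (H.K' j) x = P.heisA (H.K' j) * x * P.heisA (H.Kinv' j) :=
  adRep_groupLike (H.comul_K' j) (H.antipode_K' j) _ x

theorem adRep_Kinv' (j : I) (x : P.Heis) :
    adRep P.heisA (H.Kinv' j) x = P.heisA (H.Kinv' j) * x * P.heisA (H.K' j) :=
  adRep_groupLike (comul_inv _ (H.comul_K' j)) (antipode_inv _ (H.antipode_K' j)) _ x

theorem adRep_E (j : I) (x : P.Heis) :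
    adRep P.heisA (H.E j) x = P.heisA (H.E j) * x * P.heisA (H.Kinv' j) -
      x * P.heisA (H.E j) * P.heisA (H.Kinv' j) := by
  rw [adRep_skewPrimitive (H.comul_E j) (H.antipode_K' j) (H.antipode_E j), map_neg, map_one,
    one_mul, mul_neg, map_mul, sub_eq_add_neg, mul_assoc x]

theorem adRep_K (j : I) (x : P.Heis) :
    adRep P.heisB (H.K j) x = P.heisB (H.K j) * x * P.heisB (H.Kinv j) :=
  adRep_groupLike (H.comul_K j) (H.antipode_K j) _ x

theorem adRep_Kinv (j : I) (x : P.Heis) :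
    adRep P.heisB (H.Kinv j) x = P.heisB (H.Kinv j) * x * P.heisB (H.K j) :=
  adRep_groupLike (comul_inv _ (H.comul_K j)) (antipode_inv _ (H.antipode_K j)) _ x

theorem adRep_F (j : I) (x : P.Heis) :
    adRep P.heisB (H.F j) x = P.heisB (H.F j) * x -
      P.heisB (H.K j) * x * P.heisB (H.Kinv j) * P.heisB (H.F j) := by
  rw [adRep_skewPrimitive (H.comul_F j) antipode_one (H.antipode_F j), map_neg, map_one,
    mul_one, mul_neg, map_mul, sub_eq_add_neg, mul_assoc (_ * x)]

theorem mem_mul_conj {V : Type*} [Ring V] [Algebra ℂ V] {S : Subalgebra ℂ V} {u v x y : V}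
    (h : v * u = 1) (hx : u * x * v ∈ S) (hy : u * y * v ∈ S) : u * (x * y) * v ∈ S := by
  have : u * (x * y) * v = (u * x * v) * (u * y * v) := by
    simp only [mul_assoc]
    rw [← mul_assoc v u, h, one_mul]
  rw [this]
  exact mul_mem hx hy

theorem conj_K'_mem (j : I) {x : P.Heis} (hx : x ∈ H.weylAlg P) :
    P.heisA (H.K' j) * x * P.heisA (H.Kinv' j) ∈ H.weylAlg P := by
  induction hx using weylAlg_induction with
  | h1 => rw [mul_one, ← map_mul, Units.mul_inv, map_one]; exact one_mem _
  | hadd x y _ _ hx hy => rw [mul_add, add_mul]; exact add_mem hx hy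
  | hsmul c x _ hx => rw [mul_smul_comm, smul_mul_assoc]; exact Subalgebra.smul_mem _ hx c
  | hmul x _ y _ hx hy =>
    exact mem_mul_conj (by rw [← map_mul, Units.inv_mul, map_one]) hx hy
  | he i =>
    rw [← map_mul, ← map_mul, H.K'_conj_e0, map_smul]
    exact Subalgebra.smul_mem _ (H.e0_mem_weylAlg P i) _
  | hF i => rw [← H.adRep_K']; exact H.adRep_heisA_F _ i

theorem conj_Kinv'_mem (j : I) {x : P.Heis} (hx : x ∈ H.weylAlg P) :
    P.heisA (H.Kinv' j) * x * P.heisA (H.K' j) ∈ H.weylAlg P := by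
  induction hx using weylAlg_induction with
  | h1 => rw [mul_one, ← map_mul, Units.inv_mul, map_one]; exact one_mem _
  | hadd x y _ _ hx hy => rw [mul_add, add_mul]; exact add_mem hx hy
  | hsmul c x _ hx => rw [mul_smul_comm, smul_mul_assoc]; exact Subalgebra.smul_mem _ hx c
  | hmul x _ y _ hx hy =>
    exact mem_mul_conj (by rw [← map_mul, Units.mul_inv, map_one]) hx hy
  | he i =>
    rw [← map_mul, ← map_mul, H.Kinv'_conj_e0, map_smul]
    exact Subalgebra.smul_mem _ (H.e0_mem_weylAlg P i) _
  | hF i => rw [← H.adRep_Kinv']; exact H.adRep_heisA_F _ i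

theorem conj_K_mem (j : I) {x : P.Heis} (hx : x ∈ H.weylAlg P) :
    P.heisB (H.K j) * x * P.heisB (H.Kinv j) ∈ H.weylAlg P := by
  induction hx using weylAlg_induction with
  | h1 => rw [mul_one, ← map_mul, Units.mul_inv, map_one]; exact one_mem _
  | hadd x y _ _ hx hy => rw [mul_add, add_mul]; exact add_mem hx hy
  | hsmul c x _ hx => rw [mul_smul_comm, smul_mul_assoc]; exact Subalgebra.smul_mem _ hx c
  | hmul x _ y _ hx hy =>
    exact mem_mul_conj (by rw [← map_mul, Units.inv_mul, map_one]) hx hy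
  | he i => rw [← H.adRep_K]; exact H.adRep_heisB_e0 _ i
  | hF i =>
    rw [← map_mul, ← map_mul, H.K_conj_F, map_smul]
    exact Subalgebra.smul_mem _ (H.F_mem_weylAlg P i) _

theorem conj_Kinv_mem (j : I) {x : P.Heis} (hx : x ∈ H.weylAlg P) :
    P.heisB (H.Kinv j) * x * P.heisB (H.K j) ∈ H.weylAlg P := by
  induction hx using weylAlg_induction with
  | h1 => rw [mul_one, ← map_mul, Units.inv_mul, map_one]; exact one_mem _
  | hadd x y _ _ hx hy => rw [mul_add, add_mul]; exact add_mem hx hy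
  | hsmul c x _ hx => rw [mul_smul_comm, smul_mul_assoc]; exact Subalgebra.smul_mem _ hx c
  | hmul x _ y _ hx hy =>
    exact mem_mul_conj (by rw [← map_mul, Units.mul_inv, map_one]) hx hy
  | he i => rw [← H.adRep_Kinv]; exact H.adRep_heisB_e0 _ i
  | hF i =>
    rw [← map_mul, ← map_mul, H.Kinv_conj_F, map_smul]
    exact Subalgebra.smul_mem _ (H.F_mem_weylAlg P i) _

/-- `E_j` acts as a twisted derivation, `E_j · (x y) = (E_j · x) (K'_j · y) + x (E_j · y)`. -/
theorem adRep_E_mem (j : I) {x : P.Heis} (hx : x ∈ H.weylAlg P) :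
    adRep P.heisA (H.E j) x ∈ H.weylAlg P := by
  induction hx using weylAlg_induction with
  | h1 => rw [adRep_one]; exact Subalgebra.smul_mem _ (one_mem _) _
  | hadd x y _ _ hx hy => rw [map_add]; exact add_mem hx hy
  | hsmul c x _ hx => rw [map_smul]; exact Subalgebra.smul_mem _ hx c
  | hmul x hxW y hyW hx hy =>
    have e : adRep P.heisA (H.E j) (x * y) = adRep P.heisA (H.E j) x *
        (P.heisA (H.K' j) * y * P.heisA (H.Kinv' j)) +
        x * adRep P.heisA (H.E j) y := by
      have hK : P.heisA (H.Kinv' j) * P.heisA (H.K' j) = 1 := by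
        rw [← map_mul, Units.inv_mul, map_one]
      rw [H.adRep_E, H.adRep_E, H.adRep_E]
      simp only [sub_mul, mul_sub, mul_assoc]
      simp only [← mul_assoc (P.heisA (H.Kinv' j)) (P.heisA (H.K' j)), hK, one_mul]
      abel
    rw [e]
    exact add_mem (mul_mem hx (H.conj_K'_mem j hyW)) (mul_mem hxW hy)
  | he i =>
    have e : H.E j = H.K' j * H.e0 j := by
      rw [e0, ← mul_assoc, Units.mul_inv, one_mul]
    have e1 : adRep P.heisA (H.E j) (P.heisA (H.e0 i)) =
        (H.q j j * H.q j i) • (P.heisA (H.e0 j) * P.heisA (H.e0 i)) -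
          H.q j j • (P.heisA (H.e0 i) * P.heisA (H.e0 j)) := by
      have e2 : H.E j * H.e0 i * H.Kinv' j =
          (H.q j j * H.q j i) • (H.e0 j * H.e0 i) := by
        rw [e, H.K'_mul_e0, smul_mul_assoc, mul_assoc (H.e0 j), smul_mul_assoc, mul_assoc,
          H.K'_conj_e0, mul_smul_comm, smul_smul]
      have e3 : H.E j * H.Kinv' j = H.q j j • H.e0 j := by
        rw [e, H.K'_conj_e0]
      rw [H.adRep_E, mul_assoc (P.heisA (H.e0 i)), ← map_mul, ← map_mul, ← map_mul, e2, e3]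
      simp only [map_smul, map_mul, mul_smul_comm]
    rw [e1]
    exact sub_mem
      (Subalgebra.smul_mem _ (mul_mem (H.e0_mem_weylAlg P j) (H.e0_mem_weylAlg P i)) _)
      (Subalgebra.smul_mem _ (mul_mem (H.e0_mem_weylAlg P i) (H.e0_mem_weylAlg P j)) _)
  | hF i => exact H.adRep_heisA_F _ i

theorem adRep_F_mem (j : I) {x : P.Heis} (hx : x ∈ H.weylAlg P) :
    adRep P.heisB (H.F j) x ∈ H.weylAlg P := by
  rw [H.adRep_F]
  exact sub_mem (mul_mem (H.F_mem_weylAlg P j) hx)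
    (mul_mem (H.conj_K_mem j hx) (H.F_mem_weylAlg P j))

theorem dblAct_mem (u : P.Dbl) {x : P.Heis} (hx : x ∈ H.weylAlg P) :
    P.dblAct u x ∈ H.weylAlg P := by
  let S : Subalgebra ℂ P.Dbl :=
    { carrier := {u | ∀ x ∈ H.weylAlg P, P.dblAct u x ∈ H.weylAlg P}
      mul_mem' := fun {u v} hu hv x hx => by
        rw [map_mul]; exact hu _ (hv x hx)
      add_mem' := fun {u v} hu hv x hx => by
        rw [map_add]; exact add_mem (hu x hx) (hv x hx)
      algebraMap_mem' := fun c x hx => by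
        rw [AlgHom.commutes]; exact Subalgebra.smul_mem _ hx c }
  have hA : ∀ a, P.dblA a ∈ S := H.generatedA (S.comap P.dblA)
    (fun i x hx => by
      change P.dblAct (P.dblA _) x ∈ _
      rw [P.dblAct_left]; exact H.adRep_E_mem i hx)
    (fun i x hx => by
      change P.dblAct (P.dblA _) x ∈ _
      rw [P.dblAct_left, H.adRep_K']; exact H.conj_K'_mem i hx)
    (fun i x hx => by
      change P.dblAct (P.dblA _) x ∈ _
      rw [P.dblAct_left, H.adRep_Kinv']; exact H.conj_Kinv'_mem i hx)
  have hB : ∀ b, P.dblB b ∈ S := H.generatedB (S.comap P.dblB)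
    (fun i x hx => by
      change P.dblAct (P.dblB _) x ∈ _
      rw [P.dblAct_right]; exact H.adRep_F_mem i hx)
    (fun i x hx => by
      change P.dblAct (P.dblB _) x ∈ _
      rw [P.dblAct_right, H.adRep_K]; exact H.conj_K_mem i hx)
    (fun i x hx => by
      change P.dblAct (P.dblB _) x ∈ _
      rw [P.dblAct_right, H.adRep_Kinv]; exact H.conj_Kinv_mem i hx)
  have hS : u ∈ S := by
    induction u using Tw.induction_on with
    | zero => exact zero_mem S
    | mul a b => exact mul_mem (hA a) (hB b)
    | add u v hu hv => exact add_mem hu hv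
  exact hS x hx

theorem coact_mem {x : P.Heis} (hx : x ∈ H.weylAlg P) :
    P.coact x ∈ (Algebra.TensorProduct.map (AlgHom.id ℂ P.Dbl) (H.weylAlg P).val).range := by
  have hmem : ∀ (d : P.Dbl) {w : P.Heis}, w ∈ H.weylAlg P →
      d ⊗ₜ[ℂ] w ∈ (Algebra.TensorProduct.map (AlgHom.id ℂ P.Dbl) (H.weylAlg P).val).range :=
    fun d w hw => ⟨d ⊗ₜ ⟨w, hw⟩, rfl⟩
  induction hx using weylAlg_induction with
  | h1 => rw [map_one]; exact one_mem _
  | hadd x y _ _ hx hy => rw [map_add]; exact add_mem hx hy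
  | hsmul c x _ hx => rw [map_smul]; exact Subalgebra.smul_mem _ hx c
  | hmul x _ y _ hx hy => rw [map_mul]; exact mul_mem hx hy
  | he i =>
    rw [P.coact_right, split_skewPrimitive (H.comul_e0 i), map_one]
    exact add_mem (hmem _ (one_mem _)) (hmem _ (H.e0_mem_weylAlg P i))
  | hF i =>
    rw [P.coact_left, split_skewPrimitive (H.comul_F i), map_one]
    exact add_mem (hmem _ (one_mem _)) (hmem _ (H.F_mem_weylAlg P i))

end BorelPair

/-! ### The structures on the quantum group, the Kashiwara algebra and the quantized Weyl algebra -/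

namespace BorelPair

variable {I A B : Type*} [Ring A] [Algebra ℂ A] [HopfStr A] [Ring B] [Algebra ℂ B] [HopfStr B]
  (H : BorelPair I A B) (P : SkewPairing A B)

/-- The generators of the Weyl algebra may be rescaled. -/
theorem adjoin_smul_eq_weylAlg {c : I → ℂ} (hc : ∀ i, c i ≠ 0) :
    Algebra.adjoin ℂ (Set.range (fun i => P.heisA (c i • H.e0 i)) ∪
      Set.range (fun i => P.heisB (H.F i))) = H.weylAlg P := by
  apply le_antisymm
  · refine Algebra.adjoin_le ?_
    rintro x (⟨i, rfl⟩ | ⟨i, rfl⟩)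
    · change P.heisA _ ∈ H.weylAlg P
      rw [map_smul]
      exact Subalgebra.smul_mem _ (H.e0_mem_weylAlg P i) _
    · exact H.F_mem_weylAlg P i
  · refine Algebra.adjoin_le ?_
    rintro x (⟨i, rfl⟩ | ⟨i, rfl⟩)
    · have h : P.heisA (H.e0 i) = (c i)⁻¹ • P.heisA (c i • H.e0 i) := by
        rw [map_smul, inv_smul_smul₀ (hc i)]
      change P.heisA (H.e0 i) ∈ Algebra.adjoin ℂ (Set.range (fun i => P.heisA (c i • H.e0 i)) ∪
        Set.range (fun i => P.heisB (H.F i)))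
      rw [h]
      refine Subalgebra.smul_mem _ ?_ _
      exact Algebra.subset_adjoin (Or.inl ⟨i, rfl⟩)
    · exact Algebra.subset_adjoin (Or.inr ⟨i, rfl⟩)

theorem exists_restriction_weyl {c : I → ℂ} (hc : ∀ i, c i ≠ 0) {W : Submodule ℂ (B ⊗[ℂ] A)}
    (hW : W = subalgebraGenerated (heisenbergMul HopfStr.str HopfStr.str P.form) (1 ⊗ₜ 1)
      (Set.range (fun i => (1 : B) ⊗ₜ[ℂ] (c i • H.e0 i)) ∪
        Set.range (fun i => H.F i ⊗ₜ[ℂ] (1 : A)))) :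
    ∃ (mulW : W ⊗[ℂ] W →ₗ[ℂ] W) (oneW : W)
      (actW : A ⊗[ℂ] B →ₗ[ℂ] W →ₗ[ℂ] W) (coactW : W →ₗ[ℂ] (A ⊗[ℂ] B) ⊗[ℂ] W),
      (∀ x y : W, (mulW (x ⊗ₜ y) : B ⊗[ℂ] A) =
        heisenbergMul HopfStr.str HopfStr.str P.form ((x : B ⊗[ℂ] A) ⊗ₜ (y : B ⊗[ℂ] A))) ∧
      (oneW : B ⊗[ℂ] A) = 1 ⊗ₜ 1 ∧
      (∀ u (x : W), (actW u x : B ⊗[ℂ] A) =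
        heisenbergAction HopfStr.str HopfStr.str P.form u x) ∧
      (∀ x : W, W.subtype.lTensor (A ⊗[ℂ] B) (coactW x) =
        heisenbergCoaction HopfStr.str HopfStr.str P.form x) ∧
      IsModuleAlgebra (quantumDouble HopfStr.str HopfStr.str P.form) mulW oneW actW ∧
      IsYetterDrinfeld (quantumDouble HopfStr.str HopfStr.str P.form) actW coactW := by
  have e : W = Subalgebra.toSubmodule (H.weylAlg P) := by
    rw [hW, P.heisenbergMul_eq, ← H.adjoin_smul_eq_weylAlg P hc]
    exact subalgebraGenerated_mul' (V := P.Heis) _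
  subst e
  refine exists_restriction _ P.isModuleAlgebra_heisenberg P.isYetterDrinfeld_heisenberg ?_ ?_ ?_ ?_
  · exact one_mem (H.weylAlg P)
  · rw [P.heisenbergMul_eq]
    exact fun x hx y hy => mul_mem (S := Subalgebra ℂ P.Heis) hx hy
  · rw [P.heisenbergAction_eq]
    exact fun u x hx => H.dblAct_mem u hx
  · rw [P.heisenbergCoaction_eq]
    intro x hx
    obtain ⟨z, hz⟩ := H.coact_mem (P := P) hx
    exact ⟨z, hz⟩

end BorelPair

namespace CartanDatum

variable {n : ℕ} {C : CartanDatum n} {r s : ℂ}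

theorem HopfPairing.isHopfAlgebra (P : C.HopfPairing r s) : P.quantumGroup.IsHopfAlgebra := by
  let : HopfStr (C.UGe r s) := ⟨P.ge⟩
  let : HopfStr (C.ULe r s) := ⟨P.le⟩
  exact SkewPairing.isHopfAlgebra_quantumDouble ⟨P.φ, P.isSkewHopfPairing⟩

theorem HopfPairing.isModuleAlgebra_kashiwara (P : C.HopfPairing r s) :
    IsModuleAlgebra P.quantumGroup P.kashiwaraMul P.kashiwaraOne P.kashiwaraAction := by
  let : HopfStr (C.UGe r s) := ⟨P.ge⟩
  let : HopfStr (C.ULe r s) := ⟨P.le⟩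
  exact SkewPairing.isModuleAlgebra_heisenberg ⟨P.φ, P.isSkewHopfPairing⟩

theorem HopfPairing.isYetterDrinfeld_kashiwara (P : C.HopfPairing r s) :
    IsYetterDrinfeld P.quantumGroup P.kashiwaraAction P.kashiwaraCoaction := by
  let : HopfStr (C.UGe r s) := ⟨P.ge⟩
  let : HopfStr (C.ULe r s) := ⟨P.le⟩
  exact SkewPairing.isYetterDrinfeld_heisenberg ⟨P.φ, P.isSkewHopfPairing⟩

theorem HopfPairing.exists_restriction_weyl (P : C.HopfPairing r s) (hr : r ≠ 0) (hs : s ≠ 0)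
    (hrs : ∀ m : ℕ, 0 < m → (r * s⁻¹) ^ m ≠ 1) :
    ∃ (mulW : P.weyl ⊗[ℂ] P.weyl →ₗ[ℂ] P.weyl) (oneW : P.weyl)
      (actW : C.UGe r s ⊗[ℂ] C.ULe r s →ₗ[ℂ] P.weyl →ₗ[ℂ] P.weyl)
      (coactW : P.weyl →ₗ[ℂ] (C.UGe r s ⊗[ℂ] C.ULe r s) ⊗[ℂ] P.weyl),
      (∀ x y : P.weyl, (mulW (x ⊗ₜ y) : C.ULe r s ⊗[ℂ] C.UGe r s) =
        P.kashiwaraMul ((x : C.ULe r s ⊗[ℂ] C.UGe r s) ⊗ₜ (y : C.ULe r s ⊗[ℂ] C.UGe r s))) ∧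
      (oneW : C.ULe r s ⊗[ℂ] C.UGe r s) = P.kashiwaraOne ∧
      (∀ u (x : P.weyl), (actW u x : C.ULe r s ⊗[ℂ] C.UGe r s) = P.kashiwaraAction u x) ∧
      (∀ x : P.weyl, P.weyl.subtype.lTensor (C.UGe r s ⊗[ℂ] C.ULe r s) (coactW x) =
        P.kashiwaraCoaction x) ∧
      IsModuleAlgebra P.quantumGroup mulW oneW actW ∧
      IsYetterDrinfeld P.quantumGroup actW coactW := by
  let : HopfStr (C.UGe r s) := ⟨P.ge⟩
  let : HopfStr (C.ULe r s) := ⟨P.le⟩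
  let H : BorelPair (Fin n) (C.UGe r s) (C.ULe r s) :=
    { E := C.E r s
      K' := C.K' r s
      F := C.F r s
      K := C.K r s
      q := C.q r s
      q_ne_zero := q_ne_zero hr hs
      generatedA := UGe_generated
      generatedB := ULe_generated
      K'_comm := K'_comm
      K'_mul_E := K'_mul_E
      K_mul_F := K_mul_F
      comul_K' := P.comul_K'
      comul_E := P.comul_E
      antipode_K' := P.antipode_K'
      antipode_E := P.antipode_E
      comul_K := P.comul_K
      comul_F := P.comul_F
      antipode_K := P.antipode_K
      antipode_F := P.antipode_F }
  exact H.exists_restriction_weyl ⟨P.φ, P.isSkewHopfPairing⟩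
    (c := fun i => s ^ C.d i - r ^ C.d i) (parameter_sub_ne_zero hs hrs) rfl

end CartanDatum

/-! ### Gaussian binomial coefficients and quantum Serre expressions -/

section Gauss

/-- Gaussian binomial coefficients, defined by the Pascal recursion; they vanish for `k > m`. -/
def gauss (v : ℂ) : ℕ → ℕ → ℂ
  | _, 0 => 1
  | 0, _ + 1 => 0
  | m + 1, k + 1 => gauss v m (k + 1) + v ^ (m - k) * gauss v m k

theorem gauss_zero_right (v : ℂ) (m : ℕ) : gauss v m 0 = 1 := by
  cases m <;> rfl

theorem gauss_eq_zero (v : ℂ) {m k : ℕ} (h : m < k) : gauss v m k = 0 := by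
  induction m generalizing k with
  | zero =>
    obtain ⟨k, rfl⟩ := Nat.exists_eq_succ_of_ne_zero h.ne'
    rfl
  | succ m ih =>
    obtain ⟨k, rfl⟩ := Nat.exists_eq_succ_of_ne_zero (Nat.zero_lt_of_lt h).ne'
    rw [Nat.succ_eq_add_one, gauss, ih (by omega), ih (by omega)]
    ring

theorem qFactorial_succ (v : ℂ) (m : ℕ) :
    qFactorial v (m + 1) = qFactorial v m * qNum v (m + 1) :=
  Finset.prod_range_succ _ _

theorem qNum_add (v : ℂ) (a b : ℕ) : qNum v (a + b) = qNum v a + v ^ a * qNum v b := by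
  rw [qNum, Finset.sum_range_add, qNum, qNum, Finset.mul_sum]
  simp only [pow_add]

theorem gauss_mul_qFactorial (v : ℂ) (m k : ℕ) :
    gauss v (k + m) k * (qFactorial v k * qFactorial v m) = qFactorial v (k + m) := by
  induction k generalizing m with
  | zero => simp [gauss_zero_right, qFactorial]
  | succ k ihk =>
    induction m with
    | zero =>
      have := ihk 0
      rw [add_zero] at this ⊢
      rw [gauss, gauss_eq_zero v (Nat.lt_succ_self k), Nat.sub_self, pow_zero, zero_add, one_mul,
        qFactorial_succ]
      linear_combination (qNum v (k + 1)) * this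
    | succ m ihm =>
      have h1 := ihk (m + 1)
      rw [show k + 1 + (m + 1) = (k + 1 + m) + 1 by ring, gauss,
        show k + 1 + m - k = m + 1 by omega, qFactorial_succ v (k + 1 + m),
        show k + 1 + m + 1 = (m + 1) + (k + 1) by ring, qNum_add]
      rw [show k + (m + 1) = k + 1 + m by ring] at h1
      linear_combination (qNum v (m + 1)) * ihm + v ^ (m + 1) * qNum v (k + 1) * h1 +
        gauss v (k + 1 + m) (k + 1) * qFactorial v (k + 1) * qFactorial_succ v m +
        v ^ (m + 1) * gauss v (k + 1 + m) k * qFactorial v (m + 1) * qFactorial_succ v k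

theorem qFactorial_ne_zero {v : ℂ} (hv : ∀ m : ℕ, 0 < m → v ^ m ≠ 1) (m : ℕ) :
    qFactorial v m ≠ 0 := by
  refine Finset.prod_ne_zero_iff.2 fun t _ h => hv (t + 1) t.succ_pos ?_
  have := geom_sum_mul v (t + 1)
  rw [qNum] at h
  rw [h, zero_mul] at this
  exact sub_eq_zero.1 this.symm

theorem qBinom_eq_gauss {v : ℂ} (hv : ∀ m : ℕ, 0 < m → v ^ m ≠ 1) {m k : ℕ} (h : k ≤ m) :
    qBinom v m k = gauss v m k := by
  obtain ⟨m, rfl⟩ := Nat.exists_eq_add_of_le h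
  rw [qBinom, Nat.add_sub_cancel_left, ← gauss_mul_qFactorial, mul_div_cancel_right₀]
  exact mul_ne_zero (qFactorial_ne_zero hv _) (qFactorial_ne_zero hv _)

end Gauss

section Serre

variable {R R' : Type*} [Ring R] [Algebra ℂ R] [Ring R'] [Algebra ℂ R']

/-- The result of applying to `z` the commuting operators `w ↦ x w - v^t c w x` for `0 ≤ t < N`.
By the `v`-binomial theorem it is the left-hand side of a quantum Serre relation. -/
def serre (v c : ℂ) (x z : R) : ℕ → R
  | 0 => z
  | t + 1 => x * serre v c x z t - (v ^ t * c) • (serre v c x z t * x)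

variable {v c : ℂ} {x y z w : R}

theorem serre_eq_sum (v c : ℂ) (x z : R) (N : ℕ) : serre v c x z N =
    ∑ k ∈ Finset.range (N + 1), ((-1) ^ k * gauss v N k * (v ^ (k * (k - 1) / 2) * c ^ k)) •
      (x ^ (N - k) * z * x ^ k) := by
  induction N with
  | zero => simp [serre, gauss]
  | succ N ih =>
    rw [serre, ih]
    have h1 : x * ∑ k ∈ Finset.range (N + 1), ((-1) ^ k * gauss v N k *
        (v ^ (k * (k - 1) / 2) * c ^ k)) • (x ^ (N - k) * z * x ^ k) =
        x ^ (N + 1) * z + ∑ k ∈ Finset.range (N + 1), ((-1) ^ (k + 1) * gauss v N (k + 1) *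
          (v ^ ((k + 1) * k / 2) * c ^ (k + 1))) • (x ^ (N - k) * z * x ^ (k + 1)) := by
      have h : ∀ k ∈ Finset.range (N + 1), x * (((-1) ^ k * gauss v N k *
          (v ^ (k * (k - 1) / 2) * c ^ k)) • (x ^ (N - k) * z * x ^ k)) =
          ((-1) ^ k * gauss v N k *
          (v ^ (k * (k - 1) / 2) * c ^ k)) • (x ^ (N + 1 - k) * z * x ^ k) := fun k hk => by
        rw [Nat.succ_sub (Nat.lt_succ_iff.1 (Finset.mem_range.1 hk)), pow_succ', mul_smul_comm]
        simp only [mul_assoc]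
      rw [Finset.mul_sum, Finset.sum_congr rfl h, Finset.sum_range_succ', Finset.sum_range_succ _ N]
      simp [gauss_zero_right, gauss_eq_zero v (Nat.lt_succ_self N), add_comm]
    rw [h1, Finset.sum_mul, Finset.smul_sum, Finset.sum_range_succ' _ (N + 1), add_comm, add_comm,
      add_sub_assoc, ← Finset.sum_sub_distrib, add_comm]
    congr 1
    · refine Finset.sum_congr rfl fun k hk => ?_
      have e : (k + 1) * k / 2 = k * (k - 1) / 2 + k := Nat.triangle_succ k
      have hk' := Nat.lt_succ_iff.1 (Finset.mem_range.1 hk)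
      rw [smul_mul_assoc, smul_smul, Nat.add_sub_add_right, mul_assoc _ _ x, ← pow_succ, gauss,
        ← sub_smul, Nat.sub_zero, e]
      congr 1
      have : v ^ N = v ^ (N - k) * v ^ k := by rw [← pow_add, Nat.sub_add_cancel hk']
      · rw [this]
        ring
      · rw [Nat.add_sub_add_right]
    · simp [gauss_zero_right]

theorem serre_add (v c : ℂ) (x z z' : R) (N : ℕ) :
    serre v c x (z + z') N = serre v c x z N + serre v c x z' N := by
  induction N with
  | zero => rfl
  | succ N ih =>
    simp only [serre, ih, mul_add, add_mul, smul_add]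
    abel

theorem serre_smul (v c a b : ℂ) (x z : R) (N : ℕ) :
    serre v c (a • x) (b • z) N = (a ^ N * b) • serre v c x z N := by
  induction N with
  | zero => simp [serre]
  | succ N ih =>
    simp only [serre, ih, smul_mul_assoc, mul_smul_comm, smul_sub, smul_smul]
    congr 2 <;> ring

theorem serre_zero (v c : ℂ) (x : R) (N : ℕ) : serre v c x 0 N = 0 := by
  simpa using serre_smul v c 1 0 x 0 N

theorem map_serre (f : R →ₐ[ℂ] R') (v c : ℂ) (x z : R) (N : ℕ) :
    f (serre v c x z N) = serre v c (f x) (f z) N := by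
  induction N with
  | zero => rfl
  | succ N ih => simp only [serre, map_sub, map_mul, map_smul, ih]

/-- The operator with `t = 0` may be applied first. -/
theorem serre_shift (v c : ℂ) (x z : R) (N : ℕ) :
    serre v c x z (N + 1) = serre v (v * c) x (x * z - c • (z * x)) N := by
  induction N with
  | zero => simp [serre]
  | succ N ih =>
    rw [serre, ih, serre, pow_succ, mul_assoc]

theorem serre_sub_comm (v c d : ℂ) (x z : R) (N : ℕ) :
    serre v c x (x * z - d • (z * x)) N =
      x * serre v c x z N - d • (serre v c x z N * x) := by
  induction N with
  | zero => rfl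
  | succ N ih =>
    simp only [serre, ih, mul_sub, sub_mul, smul_sub, mul_smul_comm, smul_mul_assoc, mul_assoc]
    module

/-- The operators may be applied in the reverse order. -/
theorem serre_reverse (hv : v ≠ 0) (c : ℂ) (x z : R) (N : ℕ) :
    serre v⁻¹ (v⁻¹ * v ^ N * c) x z N = serre v c x z N := by
  induction N generalizing z with
  | zero => rfl
  | succ N ih =>
    have e : v⁻¹ * v ^ (N + 1) * c = v ^ N * c := by
      rw [pow_succ']; field_simp
    rw [serre_shift, e, ← mul_assoc, ih, serre_sub_comm, serre]

/-- If `y` commutes with `x` and `z` up to the appropriate scalars, the operator with index `t` for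
`x + y` agrees on the value at step `t` with that for `x`: the contribution of `y` cancels. -/
theorem serre_add_left (hxy : v • (x * y) = y * x) (hz : c • (z * y) = y * z) (N : ℕ) :
    serre v c (x + y) z N = serre v c x z N ∧
      (v ^ N * c) • (serre v c x z N * y) = y * serre v c x z N := by
  induction N with
  | zero => simpa [serre] using hz
  | succ N ih =>
    constructor
    · rw [serre, ih.1, serre, add_mul, mul_add, smul_add, ih.2]
      abel
    · have h := ih.2
      simp only [serre, sub_mul, mul_sub, smul_sub, smul_mul_assoc, mul_smul_comm]
      rw [← mul_assoc y x, ← hxy, ← mul_assoc y, ← h, smul_mul_assoc, smul_mul_assoc,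
        mul_assoc _ y x, ← hxy, mul_assoc x, mul_assoc x, ← h, mul_assoc _ x y]
      simp only [mul_smul_comm, smul_smul, mul_assoc]
      congr 2 <;> ring

/-- With the operators in the reverse order, the contribution of `x` cancels at each step. -/
theorem serre_add_right (hv : v ≠ 0) (hxy : v • (x * y) = y * x) (N : ℕ) {z : R}
    (hz : v • (x * z) = (v ^ N * c) • (z * x)) :
    serre v c (x + y) z N = serre v c y z N := by
  induction N generalizing z with
  | zero => rfl
  | succ N ih =>
    have hz' : x * z = (v ^ N * c) • (z * x) := by
      rw [pow_succ', mul_assoc, mul_smul] at hz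
      exact smul_right_injective R hv hz
    have e : ∀ x : R, serre v c x z (N + 1) =
        serre v c x (x * z - (v ^ N * c) • (z * x)) N := fun x => by rw [serre_sub_comm, serre]
    have e' : (x + y) * z - (v ^ N * c) • (z * (x + y)) = y * z - (v ^ N * c) • (z * y) := by
      rw [add_mul, mul_add, smul_add, hz']; abel
    rw [e, e, e']
    apply ih
    have h1 : v • (x * (y * z)) = (v ^ N * c) • (y * z * x) := by
      rw [← mul_assoc, ← smul_mul_assoc, hxy, mul_assoc, hz', mul_smul_comm, mul_assoc]
    have h2 : v • (x * (z * y)) = (v ^ N * c) • (z * y * x) := by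
      rw [← mul_assoc, hz', smul_mul_assoc, smul_comm v, mul_assoc, ← mul_smul_comm, hxy,
        mul_assoc]
    rw [mul_sub, smul_sub, h1, sub_mul, smul_sub, mul_smul_comm, smul_comm v, h2, smul_mul_assoc]

/-- If both summands of `x + y` and `z + z'` commute up to the appropriate powers of `v`, then the
two mixed terms of the Serre expression vanish: in the first one the operator with index `t`
annihilates the contribution of `y` at step `t`, in the second one the operators are applied in the
reverse order. -/
theorem serre_add_add (hv : v ≠ 0) {z' : R} {N : ℕ} (hxy : v • (x * y) = y * x)
    (hz : c • (z * y) = y * z) (hz' : v • (x * z') = (v ^ N * c) • (z' * x)) :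
    serre v c (x + y) (z + z') N = serre v c x z N + serre v c y z' N := by
  rw [serre_add, (serre_add_left hxy hz N).1, serre_add_right hv hxy N hz']

/-- Right factors that commute with everything else can be collected on the right. -/
theorem serre_mul_commute (v c : ℂ) {g h : R} (hxg : Commute g x) (hzg : Commute g z)
    (hxh : Commute h x) (hgh : Commute g h) (N : ℕ) :
    serre v c (x * g) (z * h) N = serre v c x z N * (g ^ N * h) := by
  induction N with
  | zero => simp [serre]
  | succ N ih =>
    have hg : Commute g (serre v c x z N) := by
      clear ih
      induction N with
      | zero => exact hzg
      | succ N ih => exact ((hxg.mul_right ih).sub_right ((ih.mul_right hxg).smul_right _))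
    rw [serre, ih, serre, sub_mul, smul_mul_assoc]
    congr 1
    · rw [mul_assoc x, ← mul_assoc g, hg.eq, pow_succ']
      simp only [mul_assoc]
    · congr 1
      have h1 : Commute (g ^ N * h) (x * g) :=
        ((hxg.pow_left N).mul_left hxh).mul_right (((Commute.refl g).pow_left N).mul_left hgh.symm)
      rw [mul_assoc, h1.eq, pow_succ']
      simp only [mul_assoc]

/-- The Serre expression in the opposite algebra of the elements `x g` and `z h`, where `g` and `h`
commute with the others up to scalars. -/
theorem exists_serre_op_mul {α β μ c' : ℂ} {g h : R} (hv : v ≠ 0) (hgx : g * x = α • (x * g))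
    (hhx : h * x = β • (x * h)) (hgz : g * z = μ • (z * g)) (hgh : Commute g h)
    (hβ : β = c * c' * μ) (N : ℕ) :
    ∃ κ : ℂ, serre v c (MulOpposite.op (x * g)) (MulOpposite.op (z * h)) N =
      κ • MulOpposite.op (serre v⁻¹ c' x z N * (g ^ N * h)) := by
  induction N with
  | zero => exact ⟨1, by simp [serre]⟩
  | succ N ih =>
    obtain ⟨κ, hκ⟩ := ih
    set u := serre v⁻¹ c' x z N with hu
    have h1 : ∀ N, g * serre v⁻¹ c' x z N = (μ * α ^ N) • (serre v⁻¹ c' x z N * g) := fun N => by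
      induction N with
      | zero => simpa [serre] using hgz
      | succ N ih =>
        simp only [serre, mul_sub, sub_mul, mul_smul_comm, smul_mul_assoc]
        rw [← mul_assoc g x, hgx, ← mul_assoc g _ x, ih, smul_mul_assoc, smul_mul_assoc,
          mul_assoc x g, ih, mul_assoc _ g x, hgx]
        simp only [mul_smul_comm, smul_smul, smul_sub, mul_assoc]
        congr 2 <;> ring
    have h2 : ∀ N, g ^ N * h * x = (α ^ N * β) • (x * (g ^ N * h)) := fun N => by
      induction N with
      | zero => simpa using hhx
      | succ N ih =>
        rw [pow_succ', mul_assoc, mul_assoc, ← mul_assoc (g ^ N), ih, mul_smul_comm, ← mul_assoc,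
          hgx, smul_mul_assoc, smul_smul, mul_assoc, mul_assoc g]
        congr 1
        · ring
        · rw [mul_assoc]
    refine ⟨-(κ * (v ^ N * c * μ * α ^ N)), ?_⟩
    have h3 : (g ^ N * h) * g = g ^ (N + 1) * h := by
      rw [mul_assoc, hgh.symm.eq, ← mul_assoc, pow_succ]
    rw [serre, hκ, serre, ← hu]
    simp only [smul_mul_assoc, mul_smul_comm, ← MulOpposite.op_mul, ← MulOpposite.op_smul,
      ← MulOpposite.op_sub]
    congr 1
    have e1 : u * (g ^ N * h) * (x * g) = (α ^ N * β) • (u * x * (g ^ (N + 1) * h)) := by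
      rw [mul_assoc, ← mul_assoc _ x, h2, smul_mul_assoc, mul_smul_comm, mul_assoc x, h3, mul_assoc]
    have e2 : x * g * (u * (g ^ N * h)) = (μ * α ^ N) • (x * u * (g ^ (N + 1) * h)) := by
      rw [mul_assoc, ← mul_assoc g, hu, h1, ← hu, smul_mul_assoc, mul_smul_comm, pow_succ']
      simp only [mul_assoc]
    rw [e1, e2, sub_mul, smul_mul_assoc, hβ]
    have hv' : v⁻¹ ^ N * v ^ N = 1 := by rw [← mul_pow, inv_mul_cancel₀ hv, one_pow]
    simp only [smul_sub, smul_smul]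
    have e3 : -(κ * (v ^ N * c * μ * α ^ N)) * (v⁻¹ ^ N * c') = -(κ * (α ^ N * (c * c' * μ))) := by
      linear_combination -(κ * c * μ * α ^ N * c') * hv'
    rw [e3]
    module

end Serre

/-! ### Universal properties of `U^≥` and `U^≤` -/

namespace CartanDatum

variable {n : ℕ} (C : CartanDatum n) (r s : ℂ)

/-- The parameter `r_i s_i⁻¹` of the Gaussian binomial coefficients. -/
def v (i : Fin n) : ℂ := r ^ C.d i * (s ^ C.d i)⁻¹

variable {C r s}

theorem v_ne_zero (hr : r ≠ 0) (hs : s ≠ 0) (i : Fin n) : C.v r s i ≠ 0 :=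
  mul_ne_zero (pow_ne_zero _ hr) (inv_ne_zero (pow_ne_zero _ hs))

theorem v_pow_ne_one (hrs : ∀ m : ℕ, 0 < m → (r * s⁻¹) ^ m ≠ 1) (i : Fin n) (m : ℕ) (hm : 0 < m) :
    C.v r s i ^ m ≠ 1 := by
  rw [v, ← inv_pow, ← mul_pow, ← pow_mul]
  exact hrs _ (Nat.mul_pos (C.d_pos i) hm)

/-- The diagonal entry `q_ii` is the inverse of `r_i s_i⁻¹`. -/
theorem q_self (i : Fin n) : C.q r s i i = (C.v r s i)⁻¹ := by
  rw [q, v, euler, if_neg (lt_irrefl i), if_pos rfl, mul_inv, inv_inv, zpow_neg, zpow_natCast,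
    zpow_natCast]

theorem serreDeg_ne_zero {i j : Fin n} (h : i ≠ j) : C.serreDeg i j ≠ 0 := by
  have := C.offDiag i j h
  rw [serreDeg]
  omega

theorem euler_add_euler {i j : Fin n} (h : i ≠ j) :
    C.euler i j + C.euler j i = C.d i * C.a i j := by
  rcases lt_or_gt_of_ne h with h' | h'
  · simp [euler, h', h'.not_gt, h.symm]
  · simp [euler, h', h'.not_gt, h, C.symm i j]

/-- For `N = 1 - a_ij` this is `v_i q_ij = v_i^N q_ji⁻¹`, under which the mixed terms of the Serre
expression of a comultiplication vanish. -/
theorem v_mul_q_mul_q (hr : r ≠ 0) (hs : s ≠ 0) {i j : Fin n} (h : i ≠ j) :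
    C.v r s i * C.q r s i j = C.v r s i ^ C.serreDeg i j * (C.q r s j i)⁻¹ := by
  rw [eq_mul_inv_iff_mul_eq₀ (q_ne_zero hr hs _ _), ← zpow_natCast, serreDeg,
    Int.toNat_of_nonneg (by have := C.offDiag i j h; omega), sub_eq_add_neg,
    zpow_add₀ (v_ne_zero hr hs i), zpow_one, mul_assoc]
  congr 1
  have e1 : C.q r s i j * C.q r s j i =
      r ^ (-(C.euler i j + C.euler j i)) * s ^ (C.euler i j + C.euler j i) := by
    rw [q, q, neg_add, zpow_add₀ hr, zpow_add₀ hs]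
    ring
  rw [e1, euler_add_euler h, v, mul_zpow, inv_zpow', neg_neg, ← zpow_natCast, ← zpow_mul,
    ← zpow_natCast, ← zpow_mul, mul_neg]

theorem serreCoeff_eq (hrs : ∀ m : ℕ, 0 < m → (r * s⁻¹) ^ m ≠ 1) (i j : Fin n) {k : ℕ}
    (hk : k ≤ C.serreDeg i j) : C.serreCoeff r s i j k =
      (-1) ^ k * gauss (C.v r s i) (C.serreDeg i j) k *
        (C.v r s i ^ (k * (k - 1) / 2) * (C.q r s j i)⁻¹ ^ k) := by
  have e : (C.q r s j i)⁻¹ ^ k =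
      r ^ ((k : ℤ) * C.euler j i) * s ^ (-((k : ℤ) * C.euler i j)) := by
    rw [q, mul_inv, ← zpow_neg, ← zpow_neg, neg_neg, mul_pow, ← zpow_natCast, ← zpow_natCast,
      ← zpow_mul, ← zpow_mul, mul_comm (k : ℤ), mul_comm (k : ℤ), neg_mul]
  rw [serreCoeff, e, ← qBinom_eq_gauss (v_pow_ne_one hrs i) hk, v]
  ring

variable {R : Type*} [Ring R] [Algebra ℂ R]

theorem sum_serreCoeff (hrs : ∀ m : ℕ, 0 < m → (r * s⁻¹) ^ m ≠ 1) (i j : Fin n) (x z : R) :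
    ∑ k ∈ Finset.range (C.serreDeg i j + 1), C.serreCoeff r s i j k •
        (x ^ (C.serreDeg i j - k) * z * x ^ k) =
      serre (C.v r s i) (C.q r s j i)⁻¹ x z (C.serreDeg i j) := by
  rw [serre_eq_sum]
  refine Finset.sum_congr rfl fun k hk => ?_
  rw [serreCoeff_eq hrs i j (Nat.lt_succ_iff.1 (Finset.mem_range.1 hk))]

theorem sum_serreCoeff' (hrs : ∀ m : ℕ, 0 < m → (r * s⁻¹) ^ m ≠ 1) (i j : Fin n) (x z : R) :
    ∑ k ∈ Finset.range (C.serreDeg i j + 1), C.serreCoeff r s i j k •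
        (x ^ k * z * x ^ (C.serreDeg i j - k)) =
      (serre (C.v r s i) (C.q r s j i)⁻¹ (MulOpposite.op x) (MulOpposite.op z)
        (C.serreDeg i j)).unop := by
  rw [← sum_serreCoeff hrs]
  simp [mul_assoc, Finset.unop_sum]

theorem serre_E (hrs : ∀ m : ℕ, 0 < m → (r * s⁻¹) ^ m ≠ 1) {i j : Fin n} (h : i ≠ j) :
    serre (C.v r s i) (C.q r s j i)⁻¹ (C.E r s i) (C.E r s j) (C.serreDeg i j) = 0 := by
  have := RingQuot.mkAlgHom_rel ℂ (RelGe.serre (C := C) (r := r) (s := s) i j h)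
  simp only [map_sum, map_smul, map_mul, map_pow, map_zero] at this
  rw [← this, ← sum_serreCoeff hrs]
  rfl

theorem serre_F (hrs : ∀ m : ℕ, 0 < m → (r * s⁻¹) ^ m ≠ 1) {i j : Fin n} (h : i ≠ j) :
    serre (C.v r s i) (C.q r s j i)⁻¹ (MulOpposite.op (C.F r s i)) (MulOpposite.op (C.F r s j))
      (C.serreDeg i j) = 0 := by
  have := RingQuot.mkAlgHom_rel ℂ (RelLe.serre (C := C) (r := r) (s := s) i j h)
  simp only [map_sum, map_smul, map_mul, map_pow, map_zero] at this
  apply MulOpposite.unop_injective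
  rw [MulOpposite.unop_zero, ← this, ← sum_serreCoeff' hrs]
  rfl

section Lift

/-- The homomorphism from the free algebra with prescribed values on the generators. -/
def freeLift (X : Fin n → R) (g : Fin n → Rˣ) : FreeAlgebra ℂ (Gen n) →ₐ[ℂ] R :=
  FreeAlgebra.lift ℂ fun
    | .x i => X i
    | .k i => g i
    | .kinv i => ((g i)⁻¹ : Rˣ)

variable (X : Fin n → R) (g : Fin n → Rˣ)

@[simp] theorem freeLift_x (i : Fin n) : freeLift X g (FreeAlgebra.ι ℂ (.x i)) = X i :=
  FreeAlgebra.lift_ι_apply _ _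

@[simp] theorem freeLift_k (i : Fin n) : freeLift X g (FreeAlgebra.ι ℂ (.k i)) = g i :=
  FreeAlgebra.lift_ι_apply _ _

@[simp] theorem freeLift_kinv (i : Fin n) :
    freeLift X g (FreeAlgebra.ι ℂ (.kinv i)) = ((g i)⁻¹ : Rˣ) :=
  FreeAlgebra.lift_ι_apply _ _

theorem conj_eq_smul {u : Rˣ} {x : R} {a : ℂ} (h : (u : R) * x = a • (x * u)) :
    (u : R) * x * ((u⁻¹ : Rˣ) : R) = a • x := by
  rw [h, smul_mul_assoc, mul_assoc, Units.mul_inv, mul_one]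

/-- The universal property of `U^≥`. -/
theorem UGe_exists_lift (hrs : ∀ m : ℕ, 0 < m → (r * s⁻¹) ^ m ≠ 1)
    (hg : ∀ i j, Commute (g i) (g j)) (hX : ∀ i j, (g i : R) * X j = C.q r s i j • (X j * g i))
    (hS : ∀ i j, i ≠ j →
      serre (C.v r s i) (C.q r s j i)⁻¹ (X i) (X j) (C.serreDeg i j) = 0) :
    ∃ f : C.UGe r s →ₐ[ℂ] R, (∀ i, f (C.E r s i) = X i) ∧ (∀ i, f (C.K' r s i) = g i) ∧
      ∀ i, f (C.Kinv' r s i) = ((g i)⁻¹ : Rˣ) := by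
  have h : ∀ ⦃a b⦄, C.RelGe r s a b → freeLift X g a = freeLift X g b := by
    intro a b hab
    cases hab with
    | k_kinv i => simp
    | kinv_k i => simp
    | k_comm i j => simpa using congrArg Units.val (hg i j).eq
    | k_x i j => simpa [q] using conj_eq_smul (hX i j)
    | serre i j h =>
      simp only [map_sum, map_smul, map_mul, map_pow, map_zero, freeLift_x]
      rw [sum_serreCoeff hrs, hS i j h]
  refine ⟨RingQuot.liftAlgHom ℂ ⟨freeLift X g, h⟩, fun i => ?_, fun i => ?_, fun i => ?_⟩
  · exact (RingQuot.liftAlgHom_mkAlgHom_apply ℂ _ _ _).trans (freeLift_x X g i)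
  · exact (RingQuot.liftAlgHom_mkAlgHom_apply ℂ _ _ _).trans (freeLift_k X g i)
  · exact (RingQuot.liftAlgHom_mkAlgHom_apply ℂ _ _ _).trans (freeLift_kinv X g i)

/-- The universal property of `U^≤`. -/
theorem ULe_exists_lift (hrs : ∀ m : ℕ, 0 < m → (r * s⁻¹) ^ m ≠ 1)
    (hg : ∀ i j, Commute (g i) (g j)) (hX : ∀ i j, (g i : R) * X j = C.q r s j i • (X j * g i))
    (hS : ∀ i j, i ≠ j → serre (C.v r s i) (C.q r s j i)⁻¹ (MulOpposite.op (X i))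
      (MulOpposite.op (X j)) (C.serreDeg i j) = 0) :
    ∃ f : C.ULe r s →ₐ[ℂ] R, (∀ i, f (C.F r s i) = X i) ∧ (∀ i, f (C.K r s i) = g i) ∧
      ∀ i, f (C.Kinv r s i) = ((g i)⁻¹ : Rˣ) := by
  have h : ∀ ⦃a b⦄, C.RelLe r s a b → freeLift X g a = freeLift X g b := by
    intro a b hab
    cases hab with
    | k_kinv i => simp
    | kinv_k i => simp
    | k_comm i j => simpa using congrArg Units.val (hg i j).eq
    | k_x i j => simpa [q] using conj_eq_smul (hX i j)
    | serre i j h =>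
      simp only [map_sum, map_smul, map_mul, map_pow, map_zero, freeLift_x]
      rw [sum_serreCoeff' hrs, hS i j h, MulOpposite.unop_zero]
  refine ⟨RingQuot.liftAlgHom ℂ ⟨freeLift X g, h⟩, fun i => ?_, fun i => ?_, fun i => ?_⟩
  · exact (RingQuot.liftAlgHom_mkAlgHom_apply ℂ _ _ _).trans (freeLift_x X g i)
  · exact (RingQuot.liftAlgHom_mkAlgHom_apply ℂ _ _ _).trans (freeLift_k X g i)
  · exact (RingQuot.liftAlgHom_mkAlgHom_apply ℂ _ _ _).trans (freeLift_kinv X g i)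

end Lift

end CartanDatum

/-! ### Hopf algebra structures given on generators -/

section Construction

variable {U : Type*} [Ring U] [Algebra ℂ U]

/-- An algebra homomorphism to the opposite algebra, as a linear endomorphism. -/
def antiEnd (S : U →ₐ[ℂ] Uᵐᵒᵖ) : U →ₗ[ℂ] U :=
  (MulOpposite.opLinearEquiv ℂ).symm.toLinearMap ∘ₗ S.toLinearMap

theorem antiEnd_apply (S : U →ₐ[ℂ] Uᵐᵒᵖ) (x : U) : antiEnd S x = (S x).unop := rfl

theorem antiEnd_mul (S : U →ₐ[ℂ] Uᵐᵒᵖ) (x y : U) :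
    antiEnd S (x * y) = antiEnd S y * antiEnd S x := by
  simp [antiEnd_apply]

theorem antiEnd_algebraMap (S : U →ₐ[ℂ] Uᵐᵒᵖ) (c : ℂ) :
    antiEnd S (algebraMap ℂ U c) = algebraMap ℂ U c := by
  simp [antiEnd_apply]

theorem mul_antiEnd_rTensor (S : U →ₐ[ℂ] Uᵐᵒᵖ) (t u : U ⊗[ℂ] U) (c : ℂ)
    (h : LinearMap.mul' ℂ U ((antiEnd S).rTensor U t) = algebraMap ℂ U c) :
    LinearMap.mul' ℂ U ((antiEnd S).rTensor U (t * u)) =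
      c • LinearMap.mul' ℂ U ((antiEnd S).rTensor U u) := by
  induction u with
  | zero => simp
  | add u u' hu hu' => simp only [mul_add, map_add, hu, hu', smul_add]
  | tmul x y =>
    have e : LinearMap.mul' ℂ U ((antiEnd S).rTensor U (t * x ⊗ₜ y)) =
        antiEnd S x * LinearMap.mul' ℂ U ((antiEnd S).rTensor U t) * y := by
      clear h
      induction t with
      | zero => simp
      | add u u' hu hu' => simp only [add_mul, mul_add, map_add, hu, hu']
      | tmul a b => simp [antiEnd_mul, mul_assoc]
    rw [e, h, ← Algebra.commutes, mul_assoc, ← Algebra.smul_def]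
    simp

theorem mul_antiEnd_lTensor (S : U →ₐ[ℂ] Uᵐᵒᵖ) (t u : U ⊗[ℂ] U) (c : ℂ)
    (h : LinearMap.mul' ℂ U ((antiEnd S).lTensor U u) = algebraMap ℂ U c) :
    LinearMap.mul' ℂ U ((antiEnd S).lTensor U (t * u)) =
      c • LinearMap.mul' ℂ U ((antiEnd S).lTensor U t) := by
  induction t with
  | zero => simp
  | add u u' hu hu' => simp only [add_mul, map_add, hu, hu', smul_add]
  | tmul x y =>
    have e : LinearMap.mul' ℂ U ((antiEnd S).lTensor U (x ⊗ₜ y * u)) =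
        x * LinearMap.mul' ℂ U ((antiEnd S).lTensor U u) * antiEnd S y := by
      clear h
      induction u with
      | zero => simp
      | add u u' hu hu' => simp only [add_mul, mul_add, map_add, hu, hu']
      | tmul a b => simp [antiEnd_mul, mul_assoc]
    rw [e, h, ← Algebra.commutes, mul_assoc, ← Algebra.smul_def]
    simp

theorem antiEnd_comp_of_adjoin {S S' : U →ₐ[ℂ] Uᵐᵒᵖ} {G : Set U} (hG : Algebra.adjoin ℂ G = ⊤)
    (h : ∀ x ∈ G, antiEnd S' (antiEnd S x) = x) (x : U) : antiEnd S' (antiEnd S x) = x := by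
  refine Algebra.adjoin_induction (p := fun x _ => antiEnd S' (antiEnd S x) = x) h (fun c => ?_)
    (fun x y _ _ hx hy => ?_) (fun x y _ _ hx hy => ?_) (hG ▸ Algebra.mem_top : x ∈ _)
  · rw [antiEnd_algebraMap, antiEnd_algebraMap]
  · rw [map_add, map_add, hx, hy]
  · rw [antiEnd_mul, antiEnd_mul, hx, hy]

/-- A Hopf algebra structure given by homomorphisms of algebras; the antipode axioms only have to
be checked on generators. -/
def HopfStructure.ofAlgHom (Δ : U →ₐ[ℂ] U ⊗[ℂ] U) (ε : U →ₐ[ℂ] ℂ) (S S' : U →ₐ[ℂ] Uᵐᵒᵖ)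
    (coassoc : (Algebra.TensorProduct.assoc ℂ ℂ ℂ U U U).toAlgHom.comp
      ((Algebra.TensorProduct.map Δ (.id ℂ U)).comp Δ) =
        (Algebra.TensorProduct.map (.id ℂ U) Δ).comp Δ)
    (counit_left : (Algebra.TensorProduct.lid ℂ U).toAlgHom.comp
      ((Algebra.TensorProduct.map ε (.id ℂ U)).comp Δ) = .id ℂ U)
    (counit_right : (Algebra.TensorProduct.rid ℂ ℂ U).toAlgHom.comp
      ((Algebra.TensorProduct.map (.id ℂ U) ε).comp Δ) = .id ℂ U)
    {G : Set U} (hG : Algebra.adjoin ℂ G = ⊤)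
    (left : ∀ x ∈ G,
      LinearMap.mul' ℂ U ((antiEnd S).rTensor U (Δ x)) = algebraMap ℂ U (ε x))
    (right : ∀ x ∈ G,
      LinearMap.mul' ℂ U ((antiEnd S).lTensor U (Δ x)) = algebraMap ℂ U (ε x))
    (inv_left : ∀ x ∈ G, antiEnd S' (antiEnd S x) = x)
    (inv_right : ∀ x ∈ G, antiEnd S (antiEnd S' x) = x) : HopfStructure U where
  comul := Δ
  counit := ε
  antipode := LinearEquiv.ofLinearMap (antiEnd S) (antiEnd S')
    (LinearMap.ext (antiEnd_comp_of_adjoin hG inv_right))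
    (LinearMap.ext (antiEnd_comp_of_adjoin hG inv_left))
  isCoalgebra :=
    { coassoc := fun x => AlgHom.congr_fun coassoc x
      counit_left := fun x => AlgHom.congr_fun counit_left x
      counit_right := fun x => AlgHom.congr_fun counit_right x }
  antipode_left x := by
    refine Algebra.adjoin_induction (p := fun x _ =>
      LinearMap.mul' ℂ U ((antiEnd S).rTensor U (Δ x)) = algebraMap ℂ U (ε x)) left (fun c => ?_)
      (fun x y _ _ hx hy => ?_) (fun x y _ _ hx hy => ?_) (hG ▸ Algebra.mem_top : x ∈ _)
    · rw [AlgHom.commutes, AlgHom.commutes, Algebra.TensorProduct.algebraMap_apply]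
      simp [antiEnd_algebraMap]
    · simp only [map_add, hx, hy]
    · rw [map_mul, mul_antiEnd_rTensor S _ _ _ hx, hy, map_mul, map_mul, Algebra.smul_def]
  antipode_right x := by
    refine Algebra.adjoin_induction (p := fun x _ =>
      LinearMap.mul' ℂ U ((antiEnd S).lTensor U (Δ x)) = algebraMap ℂ U (ε x)) right (fun c => ?_)
      (fun x y _ _ hx hy => ?_) (fun x y _ _ hx hy => ?_) (hG ▸ Algebra.mem_top : x ∈ _)
    · rw [AlgHom.commutes, AlgHom.commutes, Algebra.TensorProduct.algebraMap_apply]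
      have := antiEnd_algebraMap S 1
      rw [map_one] at this
      simp [this]
    · simp only [map_add, hx, hy]
    · rw [map_mul, mul_antiEnd_lTensor S _ _ _ hy, hx, map_mul, map_mul, Algebra.smul_def,
        ← Algebra.commutes]

end Construction

/-! ### Serre expressions under comultiplication and antipode -/

section Relations

variable {A : Type*} [Ring A] [Algebra ℂ A]

theorem inv_mul_eq_smul {u : Aˣ} {x : A} {a : ℂ} (ha : a ≠ 0)
    (h : (u : A) * x = a • (x * u)) : ((u⁻¹ : Aˣ) : A) * x = a⁻¹ • (x * (u⁻¹ : Aˣ)) := by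
  rw [eq_comm, inv_smul_eq_iff₀ ha, Units.mul_inv_eq_iff_eq_mul, smul_mul_assoc, mul_assoc,
    ← mul_smul_comm, ← h, Units.inv_mul_cancel_left]

theorem mul_inv_eq_smul {u : Aˣ} {x : A} {a : ℂ}
    (h : (u : A) * x = a • (x * u)) : x * (u⁻¹ : Aˣ) = a • (((u⁻¹ : Aˣ) : A) * x) := by
  rw [Units.mul_inv_eq_iff_eq_mul, smul_mul_assoc, mul_assoc, ← mul_smul_comm, ← h,
    Units.inv_mul_cancel_left]

variable {v c a b : ℂ} {e e' : A} {k k' : Aˣ} {N : ℕ}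

/-- The comultiplication `E ↦ E ⊗ K' + 1 ⊗ E` respects the Serre relations. -/
theorem serre_comul_ge (hv : v ≠ 0) (hb : b ≠ 0) (hva : v * a = v ^ N * b⁻¹)
    (h11 : (k : A) * e = v⁻¹ • (e * k)) (h12 : (k : A) * e' = a • (e' * k))
    (h21 : (k' : A) * e = b • (e * k')) (hk : Commute k k')
    (h : serre v b⁻¹ e e' N = 0) :
    serre v b⁻¹ (e ⊗ₜ (k : A) + 1 ⊗ₜ e : A ⊗[ℂ] A) (e' ⊗ₜ (k' : A) + 1 ⊗ₜ e') N = 0 := by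
  have h1 : serre v b⁻¹ (e ⊗ₜ (k : A) : A ⊗[ℂ] A) (e' ⊗ₜ (k' : A)) N = 0 := by
    have h' := congrArg (Algebra.TensorProduct.includeLeft (R := ℂ) (S := ℂ) (B := A)) h
    rw [map_serre, map_zero] at h'
    have h'' := serre_mul_commute v b⁻¹ (x := (e ⊗ₜ (1 : A) : A ⊗[ℂ] A)) (z := e' ⊗ₜ 1)
      (g := 1 ⊗ₜ (k : A)) (h := 1 ⊗ₜ (k' : A)) (by simp [Commute, SemiconjBy])
      (by simp [Commute, SemiconjBy]) (by simp [Commute, SemiconjBy])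
      (by simpa [Commute, SemiconjBy] using congrArg (fun u : Aˣ => (1 : A) ⊗ₜ[ℂ] (u : A)) hk.eq) N
    simp only [Algebra.TensorProduct.tmul_mul_tmul, one_mul, mul_one] at h''
    rw [h'']
    exact (congrArg (· * _) h').trans (zero_mul _)
  have h2 : serre v b⁻¹ (1 ⊗ₜ e : A ⊗[ℂ] A) (1 ⊗ₜ e') N = 0 := by
    have h' := congrArg (Algebra.TensorProduct.includeRight (R := ℂ) (A := A)) h
    rwa [map_serre, map_zero] at h'
  rw [serre_add_add hv, h1, h2, add_zero]
  · simp [h11, smul_smul, hv]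
  · simp [h21, smul_smul, hb]
  · simp [h12, smul_smul, hva]

/-- The Serre expression of the skew primitive elements `e ⊗ 1 + k ⊗ e` is again skew primitive. -/
theorem serre_comul_le_eq (hv : v ≠ 0) (hb : b ≠ 0) (hva : v * a = v ^ N * b⁻¹)
    (h11 : (k : A) * e = v⁻¹ • (e * k)) (h12 : (k : A) * e' = b • (e' * k))
    (h21 : (k' : A) * e = a • (e * k')) (hk : Commute k k') :
    serre v b⁻¹ (op (e ⊗ₜ 1 + (k : A) ⊗ₜ e : A ⊗[ℂ] A)) (op (e' ⊗ₜ 1 + (k' : A) ⊗ₜ e')) N =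
      op ((serre v b⁻¹ (op e) (op e') N).unop ⊗ₜ 1 +
        ((k' : A) * (k : A) ^ N) ⊗ₜ (serre v b⁻¹ (op e) (op e') N).unop) := by
  have h1 := map_serre
    (AlgHom.op (Algebra.TensorProduct.includeLeft (R := ℂ) (S := ℂ) (A := A) (B := A)))
    v b⁻¹ (op e) (op e') N
  have h2 := map_serre
    (AlgHom.op (Algebra.TensorProduct.includeRight (R := ℂ) (A := A) (B := A)))
    v b⁻¹ (op e) (op e') N
  have h3 := serre_mul_commute v b⁻¹ (x := op (1 ⊗ₜ e : A ⊗[ℂ] A)) (z := op (1 ⊗ₜ e'))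
    (g := op ((k : A) ⊗ₜ 1)) (h := op ((k' : A) ⊗ₜ 1))
    (by simp [Commute, SemiconjBy, ← op_mul])
    (by simp [Commute, SemiconjBy, ← op_mul]) (by simp [Commute, SemiconjBy, ← op_mul])
    (by simpa [Commute, SemiconjBy, ← op_mul] using
      congrArg (fun u : Aˣ => (u : A) ⊗ₜ[ℂ] (1 : A)) hk.eq.symm) N
  simp only [AlgHom.op_apply_apply, unop_op, Algebra.TensorProduct.includeLeft_apply,
    Algebra.TensorProduct.includeRight_apply] at h1 h2
  rw [← h2] at h3
  simp only [← op_mul, ← op_pow, Algebra.TensorProduct.tmul_mul_tmul, one_mul, mul_one,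
    Algebra.TensorProduct.tmul_pow, one_pow] at h3
  rw [op_add, op_add, serre_add_add hv, h3, ← h1, op_add]
  · simp [← op_mul, ← op_smul, ← TensorProduct.smul_tmul', h11, smul_smul, hv]
  · simp [← op_mul, ← op_smul, ← TensorProduct.smul_tmul', h12, smul_smul, hb]
  · simp [← op_mul, ← op_smul, ← TensorProduct.smul_tmul', h21, smul_smul, hva]

theorem serre_comul_le (hv : v ≠ 0) (hb : b ≠ 0) (hva : v * a = v ^ N * b⁻¹)
    (h11 : (k : A) * e = v⁻¹ • (e * k)) (h12 : (k : A) * e' = b • (e' * k))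
    (h21 : (k' : A) * e = a • (e * k')) (hk : Commute k k')
    (h : serre v b⁻¹ (op e) (op e') N = 0) :
    serre v b⁻¹ (op (e ⊗ₜ 1 + (k : A) ⊗ₜ e : A ⊗[ℂ] A)) (op (e' ⊗ₜ 1 + (k' : A) ⊗ₜ e')) N = 0 := by
  rw [serre_comul_le_eq hv hb hva h11 h12 h21 hk, h]
  simp

/-- The antipode and its inverse respect the Serre relations; the scalars `t`, `t'` cover both. -/
theorem serre_antipode_ge (hv : v ≠ 0) (ha : a ≠ 0) (hb : b ≠ 0) (hva : v * a = v ^ N * b⁻¹)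
    (h11 : (k : A) * e = v⁻¹ • (e * k)) (h12 : (k : A) * e' = a • (e' * k))
    (h21 : (k' : A) * e = b • (e * k')) (hk : Commute k k')
    (h : serre v b⁻¹ e e' N = 0) (t t' : ℂ) :
    serre v b⁻¹ (op (t • (e * (k⁻¹ : Aˣ)))) (op (t' • (e' * (k'⁻¹ : Aˣ)))) N = 0 := by
  have hva' : v⁻¹ * v ^ N * b⁻¹ = a := by rw [mul_assoc, ← hva, inv_mul_cancel_left₀ hv]
  obtain ⟨κ, hκ⟩ := exists_serre_op_mul (c := b⁻¹) (c' := a) (N := N) hv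
    (inv_mul_eq_smul (inv_ne_zero hv) h11) (inv_mul_eq_smul hb h21) (inv_mul_eq_smul ha h12)
    (by simpa [Commute, SemiconjBy] using congrArg Units.val hk.inv_inv.eq)
    (by rw [mul_assoc, mul_inv_cancel₀ ha, mul_one])
  rw [op_smul, op_smul, serre_smul, hκ, ← hva', serre_reverse hv, h]
  simp

/-- The antipode and its inverse respect the Serre relations; the scalars `t`, `t'` cover both. -/
theorem serre_antipode_le (hv : v ≠ 0) (ha : a ≠ 0) (hb : b ≠ 0) (hva : v * a = v ^ N * b⁻¹)
    (h11 : (k : A) * e = v⁻¹ • (e * k)) (h12 : (k : A) * e' = b • (e' * k))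
    (h21 : (k' : A) * e = a • (e * k')) (hk : Commute k k')
    (h : serre v b⁻¹ (op e) (op e') N = 0) (t t' : ℂ) :
    serre v b⁻¹ (op (op (t • (((k⁻¹ : Aˣ) : A) * e)))) (op (op (t' • (((k'⁻¹ : Aˣ) : A) * e')))) N
      = 0 := by
  have hva' : v⁻¹ * v ^ N * b⁻¹ = a := by rw [mul_assoc, ← hva, inv_mul_cancel_left₀ hv]
  have h' : ∀ {k : Aˣ} {e : A} {a : ℂ}, (k : A) * e = a • (e * k) →
      op ((k⁻¹ : Aˣ) : A) * op e = a • (op e * op ((k⁻¹ : Aˣ) : A)) := fun h => by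
    rw [← op_mul, ← op_mul, ← op_smul, mul_inv_eq_smul h]
  obtain ⟨κ, hκ⟩ := exists_serre_op_mul (c := b⁻¹) (c' := a) (N := N) hv
    (h' h11) (h' h21) (h' h12)
    (by simpa [Commute, SemiconjBy, ← op_mul] using congrArg Units.val hk.inv_inv.eq.symm)
    (by field_simp)
  rw [op_smul, op_smul, op_smul, op_smul, serre_smul,
    op_mul ((k⁻¹ : Aˣ) : A) e, op_mul ((k'⁻¹ : Aˣ) : A) e', hκ, ← hva',
    serre_reverse hv, h]
  simp

end Relations

section GroupLikes

variable {A : Type*} [Ring A] [Algebra ℂ A]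

/-- The unit `u ⊗ u` of `A ⊗ A`. -/
def tmulUnit (u : Aˣ) : (A ⊗[ℂ] A)ˣ where
  val := (u : A) ⊗ₜ (u : A)
  inv := ((u⁻¹ : Aˣ) : A) ⊗ₜ ((u⁻¹ : Aˣ) : A)
  val_inv := by simp [Algebra.TensorProduct.one_def]
  inv_val := by simp [Algebra.TensorProduct.one_def]

/-- The inverse of the unit `u`, as a unit of the opposite algebra. -/
def opInv (u : Aˣ) : Aᵐᵒᵖˣ where
  val := op ((u⁻¹ : Aˣ) : A)
  inv := op (u : A)
  val_inv := by rw [← op_mul, Units.mul_inv, op_one]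
  inv_val := by rw [← op_mul, Units.inv_mul, op_one]

theorem commute_tmulUnit {u w : Aˣ} (h : Commute u w) : Commute (tmulUnit u) (tmulUnit w) := by
  apply Units.ext
  change (u : A) ⊗ₜ[ℂ] (u : A) * (w : A) ⊗ₜ[ℂ] (w : A) = (w : A) ⊗ₜ (w : A) * (u : A) ⊗ₜ (u : A)
  simp only [Algebra.TensorProduct.tmul_mul_tmul, ← Units.val_mul, h.eq]

omit [Algebra ℂ A] in
theorem commute_opInv {u w : Aˣ} (h : Commute u w) : Commute (opInv u) (opInv w) := by
  apply Units.ext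
  exact congrArg (fun u : Aˣ => op (u : A)) h.inv_inv.eq.symm

variable {k k' : Aˣ} {e : A} {a : ℂ}

theorem tmulUnit_mul_ge (hk : Commute k k') (h : (k : A) * e = a • (e * k)) :
    (tmulUnit k).val * (e ⊗ₜ[ℂ] (k' : A) + 1 ⊗ₜ e) =
      a • ((e ⊗ₜ (k' : A) + 1 ⊗ₜ e) * (tmulUnit k).val) := by
  have hk' := congrArg Units.val hk.eq
  simp only [Units.val_mul] at hk'
  simp [tmulUnit, mul_add, add_mul, h, hk', TensorProduct.smul_tmul']

theorem tmulUnit_mul_le (hk : Commute k k') (h : (k : A) * e = a • (e * k)) :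
    (tmulUnit k).val * (e ⊗ₜ[ℂ] 1 + (k' : A) ⊗ₜ e) =
      a • ((e ⊗ₜ 1 + (k' : A) ⊗ₜ e) * (tmulUnit k).val) := by
  have hk' := congrArg Units.val hk.eq
  simp only [Units.val_mul] at hk'
  simp [tmulUnit, mul_add, add_mul, h, hk', TensorProduct.smul_tmul']

theorem opInv_mul_ge (hk : Commute k k') (h : (k : A) * e = a • (e * k)) (t : ℂ) :
    (opInv k : Aᵐᵒᵖ) * op (t • (e * (k'⁻¹ : Aˣ))) =
      a • (op (t • (e * (k'⁻¹ : Aˣ))) * (opInv k : Aᵐᵒᵖ)) := by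
  have hk' := congrArg Units.val hk.inv_inv.eq
  simp only [Units.val_mul] at hk'
  rw [opInv, ← op_mul, ← op_mul, ← op_smul, smul_mul_assoc, mul_assoc, ← hk', ← mul_assoc,
    mul_inv_eq_smul h, mul_smul_comm, smul_comm a, ← mul_assoc, smul_mul_assoc]

theorem opInv_mul_le (hk : Commute k k') (h : (k : A) * e = a • (e * k)) (t : ℂ) :
    (opInv k : Aᵐᵒᵖ) * op (t • (((k'⁻¹ : Aˣ) : A) * e)) =
      a • (op (t • (((k'⁻¹ : Aˣ) : A) * e)) * (opInv k : Aᵐᵒᵖ)) := by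
  have hk' := congrArg Units.val hk.inv_inv.eq
  simp only [Units.val_mul] at hk'
  rw [opInv, ← op_mul, ← op_mul, ← op_smul, smul_mul_assoc, mul_assoc, mul_inv_eq_smul h,
    mul_smul_comm, mul_smul_comm, smul_comm a, ← mul_assoc, ← mul_assoc, hk']

end GroupLikes

/-! ### The Hopf algebra structures of `U^≥` and `U^≤` -/

section GeneratorChecks

variable {I U : Type*} [Ring U] [Algebra ℂ U] {X : I → U} {g : I → Uˣ}

/-- The algebra is generated by the elements `X i` and `(g i)^±1`. -/
def IsGenerating (X : I → U) (g : I → Uˣ) : Prop :=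
  Algebra.adjoin ℂ (Set.range X ∪ Set.range (fun i => (g i : U)) ∪
    Set.range (fun i => ((g i)⁻¹ : Uˣ).val)) = ⊤

/-- Homomorphisms that agree on the `X i` and `g i` are equal. -/
theorem IsGenerating.hom_ext (h : IsGenerating X g) {R : Type*} [Ring R] [Algebra ℂ R]
    {f f' : U →ₐ[ℂ] R} (hX : ∀ i, f (X i) = f' (X i)) (hg : ∀ i, f (g i) = f' (g i)) : f = f' := by
  refine AlgHom.ext_of_adjoin_eq_top h ?_
  rintro x ((⟨i, rfl⟩ | ⟨i, rfl⟩) | ⟨i, rfl⟩)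
  · exact hX i
  · exact hg i
  · refine left_inv_eq_right_inv (a := f (g i)) ?_ ?_
    · rw [← map_mul, Units.inv_mul, map_one]
    · rw [hg, ← map_mul, Units.mul_inv, map_one]

variable {Δ : U →ₐ[ℂ] U ⊗[ℂ] U} {ε : U →ₐ[ℂ] ℂ} {S S' : U →ₐ[ℂ] Uᵐᵒᵖ}

/-- Homomorphisms with the values of the comultiplication, counit, antipode and inverse antipode of
`U^≥` on the generators form a Hopf algebra structure. -/
theorem IsGenerating.exists_hopfStructure_ge (h : IsGenerating X g)
    (ΔX : ∀ i, Δ (X i) = X i ⊗ₜ (g i : U) + 1 ⊗ₜ X i) (Δg : ∀ i, Δ (g i) = (tmulUnit (g i)).val)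
    (Δg' : ∀ i, Δ ((g i)⁻¹ : Uˣ) = ((tmulUnit (g i))⁻¹ : (U ⊗[ℂ] U)ˣ).val)
    (εX : ∀ i, ε (X i) = 0) (εg : ∀ i, ε (g i) = (1 : ℂˣ))
    (εg' : ∀ i, ε ((g i)⁻¹ : Uˣ) = (1⁻¹ : ℂˣ))
    (SX : ∀ i, S (X i) = op ((-1 : ℂ) • (X i * ((g i)⁻¹ : Uˣ))))
    (Sg : ∀ i, S (g i) = (opInv (g i)).val)
    (Sg' : ∀ i, S ((g i)⁻¹ : Uˣ) = ((opInv (g i))⁻¹ : Uᵐᵒᵖˣ).val)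
    (SX' : ∀ i, S' (X i) = op (-(((g i)⁻¹ : Uˣ) * X i))) (Sg'' : ∀ i, S' (g i) = (opInv (g i)).val)
    (Sg''' : ∀ i, S' ((g i)⁻¹ : Uˣ) = ((opInv (g i))⁻¹ : Uᵐᵒᵖˣ).val) :
    ∃ H : HopfStructure U, H.comul = Δ ∧ H.counit = ε ∧ ∀ x, H.antipode x = antiEnd S x := by
  have Δg : ∀ i, Δ (g i) = (g i : U) ⊗ₜ (g i : U) := Δg
  have Δg' : ∀ i, Δ ((g i)⁻¹ : Uˣ) = ((g i)⁻¹ : Uˣ).val ⊗ₜ ((g i)⁻¹ : Uˣ).val := Δg'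
  have εg : ∀ i, ε (g i) = 1 := εg
  have εg' : ∀ i, ε ((g i)⁻¹ : Uˣ) = 1 := fun i => (εg' i).trans (by simp)
  have SX : ∀ i, antiEnd S (X i) = -(X i * ((g i)⁻¹ : Uˣ)) := fun i => by simp [antiEnd_apply, SX]
  have Sg : ∀ i, antiEnd S (g i) = ((g i)⁻¹ : Uˣ).val := fun i => by rw [antiEnd_apply, Sg]; rfl
  have Sg' : ∀ i, antiEnd S ((g i)⁻¹ : Uˣ) = g i := fun i => by rw [antiEnd_apply, Sg']; rfl
  have SX' : ∀ i, antiEnd S' (X i) = -(((g i)⁻¹ : Uˣ) * X i) := fun i => by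
    simp [antiEnd_apply, SX']
  have Sg'' : ∀ i, antiEnd S' (g i) = ((g i)⁻¹ : Uˣ).val := fun i => by
    rw [antiEnd_apply, Sg'']; rfl
  have Sg''' : ∀ i, antiEnd S' ((g i)⁻¹ : Uˣ) = g i := fun i => by rw [antiEnd_apply, Sg''']; rfl
  have S1 : antiEnd S 1 = 1 := by simp [antiEnd_apply]
  refine ⟨HopfStructure.ofAlgHom Δ ε S S' (h.hom_ext (fun i => ?_) fun i => ?_)
    (h.hom_ext (fun i => ?_) fun i => ?_) (h.hom_ext (fun i => ?_) fun i => ?_) h ?_ ?_ ?_ ?_,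
    rfl, rfl, fun x => rfl⟩
  · simp [ΔX, Δg, TensorProduct.add_tmul, TensorProduct.tmul_add, add_assoc]
    rfl
  · simp [Δg]
  · simp [ΔX, εX]
  · simp [Δg, εg]
  · simp [ΔX, εX, εg]
  · simp [Δg, εg]
  · rintro x ((⟨i, rfl⟩ | ⟨i, rfl⟩) | ⟨i, rfl⟩)
    · simp [ΔX, SX, S1, εX]
    · simp [Δg, Sg, εg]
    · simp [Δg', Sg', εg']
  · rintro x ((⟨i, rfl⟩ | ⟨i, rfl⟩) | ⟨i, rfl⟩)
    · simp [ΔX, SX, Sg, εX]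
    · simp [Δg, Sg, εg]
    · simp [Δg', Sg', εg']
  · rintro x ((⟨i, rfl⟩ | ⟨i, rfl⟩) | ⟨i, rfl⟩)
    · simp only [SX, map_neg, antiEnd_mul, Sg''', SX', mul_neg, neg_neg, Units.mul_inv_cancel_left]
    · simp only [Sg, Sg''']
    · simp only [Sg', Sg'']
  · rintro x ((⟨i, rfl⟩ | ⟨i, rfl⟩) | ⟨i, rfl⟩)
    · simp only [SX', map_neg, antiEnd_mul, Sg', SX, neg_mul, neg_neg, Units.inv_mul_cancel_right]
    · simp only [Sg'', Sg']
    · simp only [Sg''', Sg]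

/-- Homomorphisms with the values of the comultiplication, counit, antipode and inverse antipode of
`U^≤` on the generators form a Hopf algebra structure. -/
theorem IsGenerating.exists_hopfStructure_le (h : IsGenerating X g)
    (ΔX : ∀ i, Δ (X i) = X i ⊗ₜ 1 + (g i : U) ⊗ₜ X i) (Δg : ∀ i, Δ (g i) = (tmulUnit (g i)).val)
    (Δg' : ∀ i, Δ ((g i)⁻¹ : Uˣ) = ((tmulUnit (g i))⁻¹ : (U ⊗[ℂ] U)ˣ).val)
    (εX : ∀ i, ε (X i) = 0) (εg : ∀ i, ε (g i) = (1 : ℂˣ))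
    (εg' : ∀ i, ε ((g i)⁻¹ : Uˣ) = (1⁻¹ : ℂˣ))
    (SX : ∀ i, S (X i) = op ((-1 : ℂ) • (((g i)⁻¹ : Uˣ) * X i)))
    (Sg : ∀ i, S (g i) = (opInv (g i)).val)
    (Sg' : ∀ i, S ((g i)⁻¹ : Uˣ) = ((opInv (g i))⁻¹ : Uᵐᵒᵖˣ).val)
    (SX' : ∀ i, S' (X i) = op (-(X i * ((g i)⁻¹ : Uˣ)))) (Sg'' : ∀ i, S' (g i) = (opInv (g i)).val)
    (Sg''' : ∀ i, S' ((g i)⁻¹ : Uˣ) = ((opInv (g i))⁻¹ : Uᵐᵒᵖˣ).val) :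
    ∃ H : HopfStructure U, H.comul = Δ ∧ H.counit = ε ∧ ∀ x, H.antipode x = antiEnd S x := by
  have Δg : ∀ i, Δ (g i) = (g i : U) ⊗ₜ (g i : U) := Δg
  have Δg' : ∀ i, Δ ((g i)⁻¹ : Uˣ) = ((g i)⁻¹ : Uˣ).val ⊗ₜ ((g i)⁻¹ : Uˣ).val := Δg'
  have εg : ∀ i, ε (g i) = 1 := εg
  have εg' : ∀ i, ε ((g i)⁻¹ : Uˣ) = 1 := fun i => (εg' i).trans (by simp)
  have SX : ∀ i, antiEnd S (X i) = -(((g i)⁻¹ : Uˣ) * X i) := fun i => by simp [antiEnd_apply, SX]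
  have Sg : ∀ i, antiEnd S (g i) = ((g i)⁻¹ : Uˣ).val := fun i => by rw [antiEnd_apply, Sg]; rfl
  have Sg' : ∀ i, antiEnd S ((g i)⁻¹ : Uˣ) = g i := fun i => by rw [antiEnd_apply, Sg']; rfl
  have SX' : ∀ i, antiEnd S' (X i) = -(X i * ((g i)⁻¹ : Uˣ)) := fun i => by
    simp [antiEnd_apply, SX']
  have Sg'' : ∀ i, antiEnd S' (g i) = ((g i)⁻¹ : Uˣ).val := fun i => by
    rw [antiEnd_apply, Sg'']; rfl
  have Sg''' : ∀ i, antiEnd S' ((g i)⁻¹ : Uˣ) = g i := fun i => by rw [antiEnd_apply, Sg''']; rfl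
  have S1 : antiEnd S 1 = 1 := by simp [antiEnd_apply]
  refine ⟨HopfStructure.ofAlgHom Δ ε S S' (h.hom_ext (fun i => ?_) fun i => ?_)
    (h.hom_ext (fun i => ?_) fun i => ?_) (h.hom_ext (fun i => ?_) fun i => ?_) h ?_ ?_ ?_ ?_,
    rfl, rfl, fun x => rfl⟩
  · simp [ΔX, Δg, TensorProduct.add_tmul, TensorProduct.tmul_add, add_assoc]
    rfl
  · simp [Δg]
  · simp [ΔX, εX, εg]
  · simp [Δg, εg]
  · simp [ΔX, εX]
  · simp [Δg, εg]
  · rintro x ((⟨i, rfl⟩ | ⟨i, rfl⟩) | ⟨i, rfl⟩)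
    · simp [ΔX, SX, Sg, εX]
    · simp [Δg, Sg, εg]
    · simp [Δg', Sg', εg']
  · rintro x ((⟨i, rfl⟩ | ⟨i, rfl⟩) | ⟨i, rfl⟩)
    · simp [ΔX, SX, S1, εX]
    · simp [Δg, Sg, εg]
    · simp [Δg', Sg', εg']
  · rintro x ((⟨i, rfl⟩ | ⟨i, rfl⟩) | ⟨i, rfl⟩)
    · simp only [SX, map_neg, antiEnd_mul, Sg''', SX', neg_mul, neg_neg, Units.inv_mul_cancel_right]
    · simp only [Sg, Sg''']
    · simp only [Sg', Sg'']
  · rintro x ((⟨i, rfl⟩ | ⟨i, rfl⟩) | ⟨i, rfl⟩)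
    · simp only [SX', map_neg, antiEnd_mul, Sg', SX, mul_neg, neg_neg, Units.mul_inv_cancel_left]
    · simp only [Sg'', Sg']
    · simp only [Sg''', Sg]

end GeneratorChecks

namespace CartanDatum

variable {n : ℕ} {C : CartanDatum n} {r s : ℂ}

theorem isGenerating_UGe : IsGenerating (C.E r s) (C.K' r s) :=
  Algebra.eq_top_iff.2 (UGe_generated _
    (fun i => Algebra.subset_adjoin (Or.inl (Or.inl ⟨i, rfl⟩)))
    (fun i => Algebra.subset_adjoin (Or.inl (Or.inr ⟨i, rfl⟩)))
    (fun i => Algebra.subset_adjoin (Or.inr ⟨i, rfl⟩)))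

theorem isGenerating_ULe : IsGenerating (C.F r s) (C.K r s) :=
  Algebra.eq_top_iff.2 (ULe_generated _
    (fun i => Algebra.subset_adjoin (Or.inl (Or.inl ⟨i, rfl⟩)))
    (fun i => Algebra.subset_adjoin (Or.inl (Or.inr ⟨i, rfl⟩)))
    (fun i => Algebra.subset_adjoin (Or.inr ⟨i, rfl⟩)))

/-- `neg_smul` for the module underlying an algebra. Being stated for an arbitrary algebra, it
applies to `U^≥` and `U^≤` without unfolding these quotients. -/
theorem algebra_neg_smul {R : Type*} [Ring R] [Algebra ℂ R] (c : ℂ) (x : R) :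
    (-c) • x = -(c • x) := neg_smul c x

theorem algebra_neg_one_smul {R : Type*} [Ring R] [Algebra ℂ R] (x : R) : (-1 : ℂ) • x = -x :=
  neg_one_smul ℂ x

section Existence

variable (hr : r ≠ 0) (hs : s ≠ 0) (hrs : ∀ m : ℕ, 0 < m → (r * s⁻¹) ^ m ≠ 1)

include hr hs hrs

theorem exists_hopfStructure_UGe : ∃ H : HopfStructure (C.UGe r s),
    (∀ i, H.comul (C.K' r s i) = (C.K' r s i : C.UGe r s) ⊗ₜ (C.K' r s i : C.UGe r s)) ∧
    (∀ i, H.comul (C.E r s i) = C.E r s i ⊗ₜ (C.K' r s i : C.UGe r s) + 1 ⊗ₜ C.E r s i) ∧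
    (∀ i, H.counit (C.K' r s i) = 1) ∧ (∀ i, H.counit (C.E r s i) = 0) ∧
    (∀ i, H.antipode (C.K' r s i) = C.Kinv' r s i) ∧
    ∀ i, H.antipode (C.E r s i) = -(C.E r s i * C.Kinv' r s i) := by
  have hq : ∀ i : Fin n, (C.K' r s i : C.UGe r s) * C.E r s i =
      (C.v r s i)⁻¹ • (C.E r s i * C.K' r s i) := fun i => q_self (C := C) i ▸ K'_mul_E i i
  obtain ⟨Δ, ΔX, Δg, Δg'⟩ := UGe_exists_lift (R := C.UGe r s ⊗[ℂ] C.UGe r s)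
    (fun i => C.E r s i ⊗ₜ (C.K' r s i : C.UGe r s) + 1 ⊗ₜ C.E r s i)
    (fun i => tmulUnit (C.K' r s i)) hrs (fun i j => commute_tmulUnit (K'_comm i j))
    (fun i j => tmulUnit_mul_ge (K'_comm i j) (K'_mul_E i j))
    (fun i j h => serre_comul_ge (v_ne_zero hr hs i) (q_ne_zero hr hs j i)
      (v_mul_q_mul_q hr hs h) (hq i) (K'_mul_E i j) (K'_mul_E j i) (K'_comm i j) (serre_E hrs h))
  obtain ⟨ε, εX, εg, εg'⟩ := UGe_exists_lift (C := C) (r := r) (s := s) (R := ℂ)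
    (fun _ => 0) (fun _ => 1) hrs (fun _ _ => Commute.one_right _) (by simp)
    (fun i j _ => serre_zero _ _ _ _)
  obtain ⟨S, SX, Sg, Sg'⟩ := UGe_exists_lift (R := (C.UGe r s)ᵐᵒᵖ)
    (fun i => op ((-1 : ℂ) • (C.E r s i * C.Kinv' r s i)))
    (fun i => opInv (C.K' r s i)) hrs (fun i j => commute_opInv (K'_comm i j))
    (fun i j => opInv_mul_ge (K'_comm i j) (K'_mul_E i j) _)
    (fun i j h => serre_antipode_ge (v_ne_zero hr hs i) (q_ne_zero hr hs i j) (q_ne_zero hr hs j i)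
      (v_mul_q_mul_q hr hs h) (hq i) (K'_mul_E i j) (K'_mul_E j i) (K'_comm i j)
      (serre_E hrs h) _ _)
  -- the inverse antipode `E ↦ -K'⁻¹ E = -v E K'⁻¹` has the form of the antipode up to a scalar
  obtain ⟨S', SX', Sg'', Sg'''⟩ := UGe_exists_lift (R := (C.UGe r s)ᵐᵒᵖ)
    (fun i => op ((-C.v r s i) • (C.E r s i * C.Kinv' r s i)))
    (fun i => opInv (C.K' r s i)) hrs (fun i j => commute_opInv (K'_comm i j))
    (fun i j => opInv_mul_ge (K'_comm i j) (K'_mul_E i j) _)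
    (fun i j h => serre_antipode_ge (v_ne_zero hr hs i) (q_ne_zero hr hs i j) (q_ne_zero hr hs j i)
      (v_mul_q_mul_q hr hs h) (hq i) (K'_mul_E i j) (K'_mul_E j i) (K'_comm i j)
      (serre_E hrs h) _ _)
  have SX'' : ∀ i, S' (C.E r s i) = op (-(C.Kinv' r s i * C.E r s i)) := fun i => by
    rw [SX', inv_mul_eq_smul (inv_ne_zero (v_ne_zero hr hs i)) (hq i), inv_inv]
    exact congrArg op (algebra_neg_smul (R := C.UGe r s) _ _)
  obtain ⟨H, h1, h2, h3⟩ := (isGenerating_UGe (C := C) (r := r) (s := s)).exists_hopfStructure_ge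
    ΔX Δg Δg' εX εg εg' SX Sg Sg' SX'' Sg'' Sg'''
  refine ⟨H, fun i => ?_, fun i => ?_, fun i => ?_, fun i => ?_, fun i => ?_, fun i => ?_⟩
  · rw [h1, Δg]; rfl
  · rw [h1, ΔX]
  · rw [h2, εg]; rfl
  · rw [h2, εX]
  · rw [h3, antiEnd_apply, Sg]; rfl
  · rw [h3, antiEnd_apply, SX, unop_op]
    exact algebra_neg_one_smul (R := C.UGe r s) _

theorem exists_hopfStructure_ULe : ∃ H : HopfStructure (C.ULe r s),
    (∀ i, H.comul (C.K r s i) = (C.K r s i : C.ULe r s) ⊗ₜ (C.K r s i : C.ULe r s)) ∧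
    (∀ i, H.comul (C.F r s i) = C.F r s i ⊗ₜ 1 + (C.K r s i : C.ULe r s) ⊗ₜ C.F r s i) ∧
    (∀ i, H.counit (C.K r s i) = 1) ∧ (∀ i, H.counit (C.F r s i) = 0) ∧
    (∀ i, H.antipode (C.K r s i) = C.Kinv r s i) ∧
    ∀ i, H.antipode (C.F r s i) = -(C.Kinv r s i * C.F r s i) := by
  have hq : ∀ i : Fin n, (C.K r s i : C.ULe r s) * C.F r s i =
      (C.v r s i)⁻¹ • (C.F r s i * C.K r s i) := fun i => q_self (C := C) i ▸ K_mul_F i i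
  obtain ⟨Δ, ΔX, Δg, Δg'⟩ := ULe_exists_lift (R := C.ULe r s ⊗[ℂ] C.ULe r s)
    (fun i => C.F r s i ⊗ₜ 1 + (C.K r s i : C.ULe r s) ⊗ₜ C.F r s i)
    (fun i => tmulUnit (C.K r s i)) hrs (fun i j => commute_tmulUnit (K_comm i j))
    (fun i j => tmulUnit_mul_le (K_comm i j) (K_mul_F i j))
    (fun i j h => serre_comul_le (v_ne_zero hr hs i) (q_ne_zero hr hs j i)
      (v_mul_q_mul_q hr hs h) (hq i) (K_mul_F i j) (K_mul_F j i) (K_comm i j) (serre_F hrs h))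
  obtain ⟨ε, εX, εg, εg'⟩ := ULe_exists_lift (C := C) (r := r) (s := s) (R := ℂ)
    (fun _ => 0) (fun _ => 1) hrs (fun _ _ => Commute.one_right _) (by simp)
    (fun i j _ => serre_zero _ _ _ _)
  obtain ⟨S, SX, Sg, Sg'⟩ := ULe_exists_lift (R := (C.ULe r s)ᵐᵒᵖ)
    (fun i => op ((-1 : ℂ) • (C.Kinv r s i * C.F r s i)))
    (fun i => opInv (C.K r s i)) hrs (fun i j => commute_opInv (K_comm i j))
    (fun i j => opInv_mul_le (K_comm i j) (K_mul_F i j) _)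
    (fun i j h => serre_antipode_le (v_ne_zero hr hs i) (q_ne_zero hr hs i j) (q_ne_zero hr hs j i)
      (v_mul_q_mul_q hr hs h) (hq i) (K_mul_F i j) (K_mul_F j i) (K_comm i j) (serre_F hrs h) _ _)
  -- the inverse antipode `F ↦ -F K⁻¹ = -v⁻¹ K⁻¹ F` has the form of the antipode up to a scalar
  obtain ⟨S', SX', Sg'', Sg'''⟩ := ULe_exists_lift (R := (C.ULe r s)ᵐᵒᵖ)
    (fun i => op ((-(C.v r s i)⁻¹) • (C.Kinv r s i * C.F r s i)))
    (fun i => opInv (C.K r s i)) hrs (fun i j => commute_opInv (K_comm i j))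
    (fun i j => opInv_mul_le (K_comm i j) (K_mul_F i j) _)
    (fun i j h => serre_antipode_le (v_ne_zero hr hs i) (q_ne_zero hr hs i j) (q_ne_zero hr hs j i)
      (v_mul_q_mul_q hr hs h) (hq i) (K_mul_F i j) (K_mul_F j i) (K_comm i j) (serre_F hrs h) _ _)
  have SX'' : ∀ i, S' (C.F r s i) = op (-(C.F r s i * C.Kinv r s i)) := fun i => by
    rw [SX', mul_inv_eq_smul (hq i)]
    exact congrArg op (algebra_neg_smul (R := C.ULe r s) _ _)
  obtain ⟨H, h1, h2, h3⟩ := (isGenerating_ULe (C := C) (r := r) (s := s)).exists_hopfStructure_le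
    ΔX Δg Δg' εX εg εg' SX Sg Sg' SX'' Sg'' Sg'''
  refine ⟨H, fun i => ?_, fun i => ?_, fun i => ?_, fun i => ?_, fun i => ?_, fun i => ?_⟩
  · rw [h1, Δg]; rfl
  · rw [h1, ΔX]
  · rw [h2, εg]; rfl
  · rw [h2, εX]
  · rw [h3, antiEnd_apply, Sg]; rfl
  · rw [h3, antiEnd_apply, SX, unop_op]
    exact algebra_neg_one_smul (R := C.ULe r s) _

end Existence

end CartanDatum

/-! ### The functionals dual to the generators -/

/-- The defect of a commutation relation between a group-like and a skew primitive element is again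
skew primitive. -/
theorem tmul_self_sub_smul {R : Type*} [Ring R] [Algebra ℂ R] {g g' x : R} (h : g' * g = g * g')
    (t : ℂ) : (g ⊗ₜ[ℂ] g) * (x ⊗ₜ 1 + g' ⊗ₜ x) - t • ((x ⊗ₜ 1 + g' ⊗ₜ x) * (g ⊗ₜ g)) =
      (g * x - t • (x * g)) ⊗ₜ g + (g * g') ⊗ₜ (g * x - t • (x * g)) := by
  simp only [mul_add, add_mul, Algebra.TensorProduct.tmul_mul_tmul, one_mul, mul_one, h,
    TensorProduct.sub_tmul, TensorProduct.tmul_sub, ← TensorProduct.smul_tmul',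
    TensorProduct.tmul_smul, smul_add]
  abel

section Dual

variable {A : Type*} [Ring A] [Algebra ℂ A] [HopfStr A]

/-- The transpose `f ↦ (a ⊗ a' ↦ f(a a'))` of the multiplication of `A`. -/
def mulTranspose : Conv A ℂ →ₐ[ℂ] Conv (A ⊗[ℂ] A) ℂ :=
  AlgHom.ofLinearMap
    { toFun := fun f => toConv (f.ofConv ∘ₗ LinearMap.mul' ℂ A)
      map_add' := fun _ _ => rfl
      map_smul' := fun _ _ => rfl }
    (conv_tensor_ext fun a b => by
      change (1 : Conv A ℂ) (a * b) = (1 : Conv (A ⊗[ℂ] A) ℂ) (a ⊗ₜ b)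
      simp [mul_comm])
    fun f g => conv_tensor_ext fun a b => by
      change (f * g) (a * b) = _
      rw [conv_tensor_apply, LinearMap.convMul_apply, Bialgebra.comul_mul]
      conv_lhs => rw [← (ℛ ℂ a).eq, ← (ℛ ℂ b).eq]
      simp [Finset.sum_mul_sum]
      rfl

@[simp] theorem mulTranspose_apply (f : Conv A ℂ) (a b : A) :
    mulTranspose f (a ⊗ₜ b) = f (a * b) := rfl

/-- The homomorphism that sends `f ⊗ g` to the functional `a ⊗ a' ↦ g(a) f(a')`. -/
def dualTensor : Conv A ℂ ⊗[ℂ] Conv A ℂ →ₐ[ℂ] Conv (A ⊗[ℂ] A) ℂ :=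
  Algebra.TensorProduct.lift
    (AlgHom.ofLinearMap
      { toFun := fun f => inr A f
        map_add' := fun f g => conv_tensor_ext fun a b => by simp [mul_add]
        map_smul' := fun c f => conv_tensor_ext fun a b => by simp [mul_left_comm] }
      inr_one inr_mul)
    (AlgHom.ofLinearMap
      { toFun := fun f => inl A f
        map_add' := fun f g => conv_tensor_ext fun a b => by simp [mul_add]
        map_smul' := fun c f => conv_tensor_ext fun a b => by simp [mul_left_comm] }
      inl_one inl_mul)
    fun f g => (inl_inr_comm g f fun _ _ => Commute.all _ _).symm

@[simp] theorem dualTensor_apply (f g : Conv A ℂ) (a b : A) :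
    dualTensor (f ⊗ₜ g) (a ⊗ₜ b) = g a * f b := by
  have : dualTensor (f ⊗ₜ[ℂ] g) = inr A f * inl A g := Algebra.TensorProduct.lift_tmul _ _ _ _ _
  rw [this, inr_mul_inl_apply, mul_comm]

/-- Evaluation at a group-like element is a character of the convolution algebra. -/
def evalGroupLike {k : A} (h : comul (R := ℂ) k = k ⊗ₜ k) (h' : counit (R := ℂ) k = 1) :
    Conv A ℂ →ₐ[ℂ] ℂ :=
  AlgHom.ofLinearMap
    { toFun := fun f => f k
      map_add' := fun _ _ => rfl
      map_smul' := fun _ _ => rfl }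
    (by
      change (1 : Conv A ℂ) k = 1
      simp [h'])
    fun f g => by
      change (f * g) k = f k * g k
      rw [LinearMap.convMul_apply, h]
      rfl

theorem evalGroupLike_apply {k : A} (h : comul (R := ℂ) k = k ⊗ₜ k) (h' : counit (R := ℂ) k = 1)
    (f : Conv A ℂ) : evalGroupLike h h' f = f k := rfl

theorem convMul_skewPrimitive {e k : A} (h : comul (R := ℂ) e = e ⊗ₜ k + 1 ⊗ₜ e) (f g : Conv A ℂ) :
    (f * g) e = f e * g k + f 1 * g e := by
  rw [LinearMap.convMul_apply, h, map_add, map_add]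
  rfl

theorem convMul_groupLike {k : A} (h : comul (R := ℂ) k = k ⊗ₜ k) (f g : Conv A ℂ) :
    (f * g) k = f k * g k := by
  rw [LinearMap.convMul_apply, h]
  rfl

/-- The product of two characters in the convolution algebra is a character. -/
def convChar (χ χ' : A →ₐ[ℂ] ℂ) : A →ₐ[ℂ] ℂ :=
  (Algebra.TensorProduct.lift χ χ' fun _ _ => Commute.all _ _).comp (Bialgebra.comulAlgHom ℂ A)

theorem hom_mul_hom (χ χ' : A →ₐ[ℂ] ℂ) : hom χ * hom χ' = hom (convChar χ χ') := by
  refine conv_ext fun a => ?_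
  rw [(ℛ ℂ a).convMul_apply, hom_apply, convChar, AlgHom.comp_apply, Bialgebra.comulAlgHom_apply]
  conv_rhs => rw [← (ℛ ℂ a).eq]
  simp

/-- A character, as a unit of the convolution algebra. -/
def charUnit (χ : A →ₐ[ℂ] ℂ) : (Conv A ℂ)ˣ := ⟨hom χ, homInv χ, hom_mul_homInv χ, homInv_mul_hom χ⟩

/-- Characters `χ_j` and skew derivations `ξ_j` of the Hopf algebra `A` with generators `E_i` and
`K'_i`, which will be the functionals `φ(-, K_j)` and `φ(-, F_j)`. -/
structure DualGenerators {I : Type*} (E : I → A) (K' : I → Aˣ) (q : I → I → ℂ) where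
  gen : IsGenerating E K'
  comul_K' : ∀ i, comul (R := ℂ) (K' i : A) = (K' i : A) ⊗ₜ (K' i : A)
  counit_K' : ∀ i, counit (R := ℂ) (K' i : A) = 1
  comul_E : ∀ i, comul (R := ℂ) (E i) = E i ⊗ₜ (K' i : A) + 1 ⊗ₜ E i
  χ : I → A →ₐ[ℂ] ℂ
  ξ : I → Conv A ℂ
  χ_E : ∀ i j, χ j (E i) = 0
  χ_K' : ∀ i j, q i j * χ j (K' i) = 1
  ξ_E : ∀ i j, i ≠ j → ξ j (E i) = 0
  ξ_K' : ∀ i j, ξ j (K' i) = 0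
  ξ_mul : ∀ j a a', ξ j (a * a') = counit (R := ℂ) a * ξ j a' + ξ j a * χ j a'

namespace DualGenerators

variable {I : Type*} {E : I → A} {K' : I → Aˣ} {q : I → I → ℂ} (D : DualGenerators E K' q)

include D

/-- The characters commute: their products in the two orders agree on the generators. -/
theorem commute_charUnit (i j : I) : Commute (charUnit (D.χ i)) (charUnit (D.χ j)) := by
  apply Units.ext
  change hom (D.χ i) * hom (D.χ j) = hom (D.χ j) * hom (D.χ i)
  have h : convChar (D.χ i) (D.χ j) = convChar (D.χ j) (D.χ i) := by
    refine D.gen.hom_ext (fun k => ?_) (fun k => ?_)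
    · rw [← hom_apply, ← hom_apply, ← hom_mul_hom, ← hom_mul_hom,
        convMul_skewPrimitive (D.comul_E k), convMul_skewPrimitive (D.comul_E k)]
      simp [D.χ_E]
    · rw [← hom_apply, ← hom_apply, ← hom_mul_hom, ← hom_mul_hom,
        convMul_groupLike (D.comul_K' k), convMul_groupLike (D.comul_K' k), mul_comm]
  rw [hom_mul_hom, hom_mul_hom, h]

theorem ξ_one (j : I) : D.ξ j 1 = 0 := by
  have := D.ξ_mul j 1 1
  simpa using this

/-- A functional that is a skew derivation vanishes as soon as it vanishes on the generators. -/
theorem eq_zero_of_skew {η G G' : Conv A ℂ} (h : mulTranspose η = dualTensor (η ⊗ₜ G + G' ⊗ₜ η))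
    (h1 : η 1 = 0) (hE : ∀ i, η (E i) = 0) (hK : ∀ i, η (K' i) = 0)
    (hK' : ∀ i, η ((K' i)⁻¹ : Aˣ) = 0) : η = 0 := by
  have hm : ∀ a a', η (a * a') = G a * η a' + η a * G' a' := fun a a' => by
    rw [← mulTranspose_apply, h, map_add]
    change dualTensor (η ⊗ₜ G) (a ⊗ₜ a') + dualTensor (G' ⊗ₜ η) (a ⊗ₜ a') = _
    rw [dualTensor_apply, dualTensor_apply]
  refine conv_ext fun a => ?_
  refine Algebra.adjoin_induction (p := fun a _ => η a = 0) ?_ (fun c => ?_)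
    (fun x y _ _ hx hy => ?_) (fun x y _ _ hx hy => ?_) (D.gen ▸ Algebra.mem_top : a ∈ _)
  · rintro x ((⟨i, rfl⟩ | ⟨i, rfl⟩) | ⟨i, rfl⟩)
    · exact hE i
    · exact hK i
    · exact hK' i
  · rw [Algebra.algebraMap_eq_smul_one]
    exact (map_smul η.ofConv c 1).trans (by rw [h1, smul_zero])
  · exact (map_add η.ofConv x y).trans (by rw [hx, hy, add_zero])
  · rw [hm, hx, hy, mul_zero, zero_mul, add_zero]

theorem mulTranspose_χ (i : I) :
    mulTranspose (hom (D.χ i)) = dualTensor (hom (D.χ i) ⊗ₜ hom (D.χ i)) :=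
  conv_tensor_ext fun a b => by simp

theorem mulTranspose_ξ (i : I) :
    mulTranspose (D.ξ i) = dualTensor (D.ξ i ⊗ₜ 1 + hom (D.χ i) ⊗ₜ D.ξ i) :=
  conv_tensor_ext fun a b => by
    rw [map_add]
    change D.ξ i (a * b) = dualTensor (D.ξ i ⊗ₜ 1) (a ⊗ₜ b) +
      dualTensor (hom (D.χ i) ⊗ₜ D.ξ i) (a ⊗ₜ b)
    rw [dualTensor_apply, dualTensor_apply, D.ξ_mul]
    simp

theorem counit_Kinv' (i : I) : counit (R := ℂ) (((K' i)⁻¹ : Aˣ) : A) = 1 := by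
  have := Bialgebra.counit_mul (R := ℂ) (K' i : A) ((K' i)⁻¹ : Aˣ)
  rw [Units.mul_inv, Bialgebra.counit_one, D.counit_K', one_mul] at this
  exact this.symm

theorem ξ_Kinv' (i j : I) : D.ξ j ((K' i)⁻¹ : Aˣ) = 0 := by
  have := D.ξ_mul j (K' i) ((K' i)⁻¹ : Aˣ)
  rw [Units.mul_inv, D.ξ_one, D.ξ_K', D.counit_K', one_mul, zero_mul, add_zero] at this
  exact this.symm

/-- The functionals satisfy the relations between the `K_i` and the `F_j` in `U^≤`. -/
theorem χ_mul_ξ (i j : I) : hom (D.χ i) * D.ξ j = q j i • (D.ξ j * hom (D.χ i)) := by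
  have hc : hom (D.χ j) * hom (D.χ i) = hom (D.χ i) * hom (D.χ j) :=
    congrArg Units.val (D.commute_charUnit j i).eq
  rw [← sub_eq_zero]
  refine D.eq_zero_of_skew (G := hom (D.χ i)) (G' := hom (D.χ i) * hom (D.χ j)) ?_ ?_ (fun k => ?_)
    (fun k => ?_) (fun k => ?_)
  · rw [map_sub, map_smul, map_mul, map_mul, D.mulTranspose_χ, D.mulTranspose_ξ, ← map_mul,
      ← map_mul, ← map_smul, ← map_sub]
    exact congrArg dualTensor (tmul_self_sub_smul hc (q j i))
  · change (hom (D.χ i) * D.ξ j) 1 - q j i • (D.ξ j * hom (D.χ i)) 1 = 0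
    rw [convMul_groupLike Bialgebra.comul_one, convMul_groupLike Bialgebra.comul_one, D.ξ_one]
    simp
  · change (hom (D.χ i) * D.ξ j) (E k) - q j i • (D.ξ j * hom (D.χ i)) (E k) = 0
    rw [convMul_skewPrimitive (D.comul_E k), convMul_skewPrimitive (D.comul_E k), D.ξ_one, D.ξ_K']
    by_cases h : k = j
    · subst h
      simp only [hom_apply, D.χ_E, map_one, smul_eq_mul]
      linear_combination (-D.ξ k (E k)) * D.χ_K' k i
    · simp [D.ξ_E k j h, D.χ_E]
  · change (hom (D.χ i) * D.ξ j) (K' k) - q j i • (D.ξ j * hom (D.χ i)) (K' k) = 0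
    rw [convMul_groupLike (D.comul_K' k), convMul_groupLike (D.comul_K' k), D.ξ_K']
    simp
  · change (hom (D.χ i) * D.ξ j) ((K' k)⁻¹ : Aˣ) -
      q j i • (D.ξ j * hom (D.χ i)) ((K' k)⁻¹ : Aˣ) = 0
    rw [convMul_groupLike (comul_inv _ (D.comul_K' k)),
      convMul_groupLike (comul_inv _ (D.comul_K' k)), D.ξ_Kinv']
    simp

/-- At a group-like element the Serre expression of two functionals that vanish there is zero. -/
theorem serre_ξ_groupLike (v c : ℂ) {k : A} (h : comul (R := ℂ) k = k ⊗ₜ k)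
    (h' : counit (R := ℂ) k = 1) {i j : I} (hi : D.ξ i k = 0) (hj : D.ξ j k = 0) (N : ℕ) :
    (serre v c (op (D.ξ i)) (op (D.ξ j)) N).unop k = 0 := by
  have := map_serre (AlgHom.op (evalGroupLike h h')) v c (op (D.ξ i)) (op (D.ξ j)) N
  simp only [AlgHom.op_apply_apply, unop_op, evalGroupLike_apply, hi, hj, op_zero] at this
  rw [serre_zero] at this
  exact op_injective this

/-- The outermost of the operators that form the Serre expression vanishes at `E_k`, since
`Δ(E_k) = E_k ⊗ K'_k + 1 ⊗ E_k` and all functionals concerned vanish at `1` and `K'_k`. -/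
theorem serre_ξ_E (v c : ℂ) {i j : I} (k : I) {N : ℕ} (hN : N ≠ 0) :
    (serre v c (op (D.ξ i)) (op (D.ξ j)) N).unop (E k) = 0 := by
  obtain ⟨N, rfl⟩ := Nat.exists_eq_succ_of_ne_zero hN
  have h1 : (serre v c (op (D.ξ i)) (op (D.ξ j)) N).unop 1 = 0 :=
    D.serre_ξ_groupLike v c Bialgebra.comul_one Bialgebra.counit_one (D.ξ_one i) (D.ξ_one j) N
  have h2 : (serre v c (op (D.ξ i)) (op (D.ξ j)) N).unop (K' k) = 0 :=
    D.serre_ξ_groupLike v c (D.comul_K' k) (D.counit_K' k) (D.ξ_K' k i) (D.ξ_K' k j) N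
  rw [Nat.succ_eq_add_one, serre, unop_sub, unop_smul, unop_mul, unop_mul, unop_op]
  change ((serre v c (op (D.ξ i)) (op (D.ξ j)) N).unop * D.ξ i) (E k) -
    (v ^ N * c) • (D.ξ i * (serre v c (op (D.ξ i)) (op (D.ξ j)) N).unop) (E k) = 0
  rw [convMul_skewPrimitive (D.comul_E k), convMul_skewPrimitive (D.comul_E k), h1, h2, D.ξ_K',
    D.ξ_one]
  simp

/-- The functionals satisfy the Serre relations of `U^≤`. The Serre expression is a skew derivation
by `serre_comul_le_eq`, and it vanishes on the generators. -/
theorem serre_ξ {v : ℂ} {i j : I} {N : ℕ} (hv : v ≠ 0) (hq : q j i ≠ 0) (hN : N ≠ 0)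
    (hva : v * q i j = v ^ N * (q j i)⁻¹) (hii : q i i = v⁻¹) :
    serre v (q j i)⁻¹ (op (D.ξ i)) (op (D.ξ j)) N = 0 := by
  apply unop_injective
  rw [unop_zero]
  refine D.eq_zero_of_skew (G := 1) (G' := hom (D.χ j) * hom (D.χ i) ^ N) ?_ ?_ (fun k => ?_)
    (fun k => ?_) (fun k => ?_)
  · have h1 := map_serre (AlgHom.op mulTranspose) v (q j i)⁻¹ (op (D.ξ i)) (op (D.ξ j)) N
    have h2 := map_serre (AlgHom.op (dualTensor (A := A))) v (q j i)⁻¹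
      (op (D.ξ i ⊗ₜ[ℂ] 1 + hom (D.χ i) ⊗ₜ D.ξ i)) (op (D.ξ j ⊗ₜ[ℂ] 1 + hom (D.χ j) ⊗ₜ D.ξ j)) N
    have h3 := serre_comul_le_eq (k := charUnit (D.χ i)) (k' := charUnit (D.χ j)) (e := D.ξ i)
      (e' := D.ξ j) hv hq hva (hii ▸ D.χ_mul_ξ i i) (D.χ_mul_ξ i j) (D.χ_mul_ξ j i)
      (D.commute_charUnit i j)
    simp only [AlgHom.op_apply_apply, unop_op, D.mulTranspose_ξ] at h1 h2
    rw [← h2] at h1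
    have h4 := op_injective h1
    rw [h4]
    exact congrArg (fun x => dualTensor (unop x)) h3
  · exact D.serre_ξ_groupLike _ _ Bialgebra.comul_one Bialgebra.counit_one (D.ξ_one i) (D.ξ_one j) N
  · exact D.serre_ξ_E _ _ k hN
  · exact D.serre_ξ_groupLike _ _ (D.comul_K' k) (D.counit_K' k) (D.ξ_K' k i) (D.ξ_K' k j) N
  · exact D.serre_ξ_groupLike _ _ (comul_inv _ (D.comul_K' k)) (D.counit_Kinv' k) (D.ξ_Kinv' k i)
      (D.ξ_Kinv' k j) N

end DualGenerators

end Dual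

/-! ### Existence of the pairing -/

section Triangular

variable {U : Type*} [Ring U] [Algebra ℂ U]

/-- The diagonal entries of a representation by upper triangular matrices are characters. -/
theorem exists_diagonal_characters (f : U →ₐ[ℂ] Matrix (Fin 2) (Fin 2) ℂ) (hf : ∀ a, f a 1 0 = 0) :
    ∃ χ χ' : U →ₐ[ℂ] ℂ, (∀ a, χ a = f a 0 0) ∧ ∀ a, χ' a = f a 1 1 := by
  refine ⟨AlgHom.ofLinearMap (Matrix.entryLinearMap ℂ ℂ 0 0 ∘ₗ f.toLinearMap) ?_ ?_,
    AlgHom.ofLinearMap (Matrix.entryLinearMap ℂ ℂ 1 1 ∘ₗ f.toLinearMap) ?_ ?_, fun _ => rfl,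
    fun _ => rfl⟩
  · simp
  · intro x y
    simp [Matrix.mul_apply, hf]
  · simp
  · intro x y
    simp [Matrix.mul_apply, hf]

theorem map_prod_zpow {n : ℕ} (θ : U →ₐ[ℂ] ℂ) (g : Fin n → Uˣ) (m : Fin n → ℤ) :
    θ ((List.ofFn fun i => g i ^ m i).prod : Uˣ) = ∏ i, θ (g i) ^ m i := by
  have h := map_list_prod (Units.map (θ : U →* ℂ)) (List.ofFn fun i => g i ^ m i)
  have h' := congrArg Units.val h
  rw [List.map_ofFn, List.prod_ofFn, Units.coe_prod] at h'
  refine Eq.trans h' (Finset.prod_congr rfl fun i _ => ?_)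
  simp

end Triangular

section Pairing

variable {A B : Type*} [Ring A] [Algebra ℂ A] [HopfStr A] [Ring B] [Algebra ℂ B]

/-- The units that are group-like. -/
def groupLikeUnits (A : Type*) [Ring A] [Algebra ℂ A] [HopfStr A] : Subgroup Aˣ where
  carrier := {u | comul (R := ℂ) (u : A) = (u : A) ⊗ₜ (u : A) ∧ counit (R := ℂ) (u : A) = 1}
  mul_mem' := fun {u w} hu hw => by
    refine ⟨?_, ?_⟩
    · rw [Units.val_mul, Bialgebra.comul_mul, hu.1, hw.1, Algebra.TensorProduct.tmul_mul_tmul]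
    · rw [Units.val_mul, Bialgebra.counit_mul, hu.2, hw.2, mul_one]
  one_mem' := ⟨Bialgebra.comul_one, Bialgebra.counit_one⟩
  inv_mem' := fun {u} hu => by
    refine ⟨comul_inv u hu.1, ?_⟩
    have := Bialgebra.counit_mul (R := ℂ) (u : A) (u⁻¹ : Aˣ)
    rw [Units.mul_inv, Bialgebra.counit_one, hu.2, one_mul] at this
    exact this.symm

/-- The bilinear form `φ(a, b) = ψ(b)(a)` that belongs to a homomorphism from `B` to the
convolution algebra of functionals on `A`. -/
def pairingOf (ψ : B →ₐ[ℂ] Conv A ℂ) : A →ₗ[ℂ] B →ₗ[ℂ] ℂ :=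
  LinearMap.flip
    { toFun := fun b => (ψ b).ofConv
      map_add' := fun x y => by rw [map_add]; rfl
      map_smul' := fun c x => by rw [map_smul]; rfl }

@[simp] theorem pairingOf_apply (ψ : B →ₐ[ℂ] Conv A ℂ) (a : A) (b : B) :
    pairingOf ψ a b = ψ b a := rfl

variable {I J : Type*} {E : I → A} {K' : I → Aˣ} {q : I → I → ℂ} {F : I → B} {K : I → Bˣ}

/-- The form of a homomorphism `ψ` with the prescribed values is a skew Hopf pairing: the
compatibility with the product of `B` is the multiplicativity of `ψ`, the compatibility with the
product of `A` is an equality of two homomorphisms from `B` to the functionals on `A ⊗ A`. -/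
theorem DualGenerators.isSkewHopfPairing (D : DualGenerators E K' q) (hB : HopfStructure B)
    (gen : IsGenerating F K)
    (comul_K : ∀ i, hB.comul (K i) = (K i : B) ⊗ₜ (K i : B))
    (comul_F : ∀ i, hB.comul (F i) = F i ⊗ₜ 1 + (K i : B) ⊗ₜ F i)
    (counit_K : ∀ i, hB.counit (K i) = 1) (counit_F : ∀ i, hB.counit (F i) = 0)
    {ψ : B →ₐ[ℂ] Conv A ℂ} (ψF : ∀ i, ψ (F i) = D.ξ i) (ψK : ∀ i, ψ (K i) = hom (D.χ i)) :
    IsSkewHopfPairing HopfStr.str hB (pairingOf ψ) where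
  apply_mul a b b' := by
    rw [pairingOf_apply, map_mul, LinearMap.convMul_apply]
    rfl
  mul_apply a a' b := by
    have h : mulTranspose.comp ψ =
        (dualTensor.comp (Algebra.TensorProduct.map ψ ψ)).comp hB.comul := by
      refine gen.hom_ext (fun i => ?_) (fun i => ?_)
      · rw [AlgHom.comp_apply, AlgHom.comp_apply, ψF, D.mulTranspose_ξ, comul_F, AlgHom.comp_apply,
          map_add (Algebra.TensorProduct.map ψ ψ), Algebra.TensorProduct.map_tmul,
          Algebra.TensorProduct.map_tmul, ψF, ψK, map_one]
      · rw [AlgHom.comp_apply, AlgHom.comp_apply, ψK, D.mulTranspose_χ, comul_K,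
          AlgHom.comp_apply, Algebra.TensorProduct.map_tmul, ψK]
    have h' := AlgHom.congr_fun h b
    rw [pairingOf_apply, ← mulTranspose_apply]
    refine (congrArg (fun f : Conv (A ⊗[ℂ] A) ℂ => f (a ⊗ₜ a')) h').trans ?_
    change dualTensor (Algebra.TensorProduct.map ψ ψ (hB.comul b)) (a ⊗ₜ a') = _
    induction hB.comul b with
    | zero => rw [map_zero, map_zero, map_zero, map_zero]; rfl
    | add x y hx hy =>
      rw [map_add, map_add, map_add, map_add, ← hx, ← hy]; rfl
    | tmul x y =>
      rw [Algebra.TensorProduct.map_tmul, dualTensor_apply, TensorProduct.map_tmul,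
        LinearMap.mul'_apply, mul_comm]
      rfl
  apply_one a := by
    rw [pairingOf_apply, map_one]
    exact LinearMap.convOne_apply a
  one_apply b := by
    have h : (evalGroupLike (A := A) Bialgebra.comul_one Bialgebra.counit_one).comp ψ =
        hB.counit := by
      refine gen.hom_ext (fun i => ?_) (fun i => ?_)
      · rw [AlgHom.comp_apply, evalGroupLike_apply, ψF, D.ξ_one, counit_F]
      · rw [AlgHom.comp_apply, evalGroupLike_apply, ψK, hom_apply, map_one, counit_K]
    exact AlgHom.congr_fun h b

/-- The pairing of monomials in the `K'_i` and the `K_j`. Both families are group-like, so the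
pairing is multiplicative in each argument. -/
theorem DualGenerators.pairing_prod {n : ℕ} {E : Fin n → A} {K' : Fin n → Aˣ} {K : Fin n → Bˣ}
    {q : Fin n → Fin n → ℂ} (D : DualGenerators E K' q)
    {ψ : B →ₐ[ℂ] Conv A ℂ} (ψK : ∀ i, ψ (K i) = hom (D.χ i)) (l m : Fin n → ℤ) :
    pairingOf ψ ((List.ofFn fun i => K' i ^ l i).prod : Aˣ)
      ((List.ofFn fun i => K i ^ m i).prod : Bˣ) = ∏ j, (∏ i, (q i j)⁻¹ ^ l i) ^ m j := by
  have hu : (List.ofFn fun i => K' i ^ l i).prod ∈ groupLikeUnits A := by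
    refine Subgroup.list_prod_mem _ fun u hu => ?_
    obtain ⟨i, rfl⟩ := (List.mem_ofFn' _ _).1 hu
    have hi : K' i ∈ groupLikeUnits A := ⟨D.comul_K' i, D.counit_K' i⟩
    exact Subgroup.zpow_mem _ hi _
  have h := map_prod_zpow ((evalGroupLike hu.1 hu.2).comp ψ) K m
  refine h.trans (Finset.prod_congr rfl fun j _ => ?_)
  rw [AlgHom.comp_apply, evalGroupLike_apply, ψK, hom_apply, map_prod_zpow]
  congr 1
  refine Finset.prod_congr rfl fun i _ => ?_
  rw [eq_inv_of_mul_eq_one_right (D.χ_K' i j)]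

end Pairing

namespace CartanDatum

variable {n : ℕ} {C : CartanDatum n} {r s : ℂ}

theorem serre_eq_zero_of_mul_eq_zero {R : Type*} [Ring R] [Algebra ℂ R] {v c : ℂ} {x z : R} {N : ℕ}
    (hN : N ≠ 0) (h : x * z = 0) (h' : z * x = 0) : serre v c x z N = 0 := by
  obtain ⟨N, rfl⟩ := Nat.exists_eq_succ_of_ne_zero hN
  rw [Nat.succ_eq_add_one, serre_shift, h, h', smul_zero, sub_zero, serre_zero]

/-- The functionals come from the representation of `U^≥` by upper triangular matrices with
`E_i ↦ δ_ij c e₁₂` and `K'_i ↦ diag(1, q_ij⁻¹)`. The Serre relations hold in it because all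
products of two of the `E_i` vanish. -/
theorem exists_skewDerivation (hr : r ≠ 0) (hs : s ≠ 0)
    (hrs : ∀ m : ℕ, 0 < m → (r * s⁻¹) ^ m ≠ 1) {ε : C.UGe r s →ₐ[ℂ] ℂ}
    (εK : ∀ i, ε (C.K' r s i) = 1) (εE : ∀ i, ε (C.E r s i) = 0) (j : Fin n) (c : ℂ) :
    ∃ (χ : C.UGe r s →ₐ[ℂ] ℂ) (ξ : C.UGe r s →ₗ[ℂ] ℂ), (∀ i, χ (C.E r s i) = 0) ∧
      (∀ i, χ (C.K' r s i) = (C.q r s i j)⁻¹) ∧ (∀ i, ξ (C.E r s i) = if i = j then c else 0) ∧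
      (∀ i, ξ (C.K' r s i) = 0) ∧ ∀ a a', ξ (a * a') = ε a * ξ a' + ξ a * χ a' := by
  let g : Fin n → (Matrix (Fin 2) (Fin 2) ℂ)ˣ := fun i =>
    { val := !![1, 0; 0, (C.q r s i j)⁻¹]
      inv := !![1, 0; 0, C.q r s i j]
      val_inv := by simp [q_ne_zero hr hs i j, Matrix.one_fin_two]
      inv_val := by simp [q_ne_zero hr hs i j, Matrix.one_fin_two] }
  have hX : ∀ i k, !![0, if i = j then c else 0; 0, 0] * !![0, if k = j then c else 0; 0, 0] =
      (0 : Matrix (Fin 2) (Fin 2) ℂ) := fun i k => by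
    ext a b
    fin_cases a <;> fin_cases b <;> simp [Matrix.mul_apply]
  obtain ⟨f, fE, fK, fK'⟩ := UGe_exists_lift (C := C) (r := r) (s := s)
    (R := Matrix (Fin 2) (Fin 2) ℂ) (fun i => !![0, if i = j then c else 0; 0, 0]) g hrs
    (fun i k => Units.ext (by simp [g, mul_comm]))
    (fun i k => by
      by_cases h : k = j
      · subst h
        have := q_ne_zero (C := C) hr hs i k
        simp [g, Matrix.smul_of, field]
      · simp [g, h])
    (fun i k h => serre_eq_zero_of_mul_eq_zero (serreDeg_ne_zero h) (hX i k) (hX k i))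
  have hf : ∀ a, f a 1 0 = 0 := fun a => by
    refine Algebra.adjoin_induction (p := fun a _ => f a 1 0 = 0) ?_ (fun c => ?_)
      (fun x y _ _ hx hy => ?_) (fun x y _ _ hx hy => ?_)
      ((isGenerating_UGe (C := C) (r := r) (s := s)) ▸ Algebra.mem_top : a ∈ _)
    · rintro x ((⟨i, rfl⟩ | ⟨i, rfl⟩) | ⟨i, rfl⟩)
      · simp [fE]
      · simp [fK, g]
      · simp only [fK']
        rfl
    · rw [AlgHom.commutes]; simp [Matrix.algebraMap_matrix_apply]
    · rw [map_add, Matrix.add_apply, hx, hy, add_zero]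
    · rw [map_mul]; simp [Matrix.mul_apply, hx, hy]
  obtain ⟨χ₀, χ, h0, h1⟩ := exists_diagonal_characters f hf
  have hε : χ₀ = ε := isGenerating_UGe.hom_ext (fun i => by rw [h0, fE, εE]; simp)
    (fun i => by rw [h0, fK, εK]; simp [g])
  refine ⟨χ, Matrix.entryLinearMap ℂ ℂ 0 1 ∘ₗ f.toLinearMap, fun i => ?_, fun i => ?_, fun i => ?_,
    fun i => ?_, fun a a' => ?_⟩
  · rw [h1, fE]; simp
  · rw [h1, fK]; simp [g]
  · simp [fE]
  · simp [fK, g]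
  · rw [← hε, h0, h1]
    simp [Matrix.mul_apply]

/-- The homomorphism `ψ` from `U^≤` to the functionals with `K_j ↦ χ_j` and `F_j ↦ ξ_j`. -/
theorem DualGenerators.exists_hom {A : Type} [Ring A] [Algebra ℂ A] [HopfStr A] (hr : r ≠ 0)
    (hs : s ≠ 0) (hrs : ∀ m : ℕ, 0 < m → (r * s⁻¹) ^ m ≠ 1) {E : Fin n → A} {K' : Fin n → Aˣ}
    (D : DualGenerators E K' (C.q r s)) : ∃ ψ : C.ULe r s →ₐ[ℂ] Conv A ℂ,
      (∀ i, ψ (C.F r s i) = D.ξ i) ∧ ∀ i, ψ (C.K r s i) = hom (D.χ i) := by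
  obtain ⟨ψ, h1, h2, -⟩ := ULe_exists_lift (C := C) (r := r) (s := s) (R := Conv A ℂ) D.ξ
    (fun i => charUnit (D.χ i)) hrs D.commute_charUnit D.χ_mul_ξ
    (fun i j h => D.serre_ξ (v_ne_zero hr hs i) (q_ne_zero hr hs j i) (serreDeg_ne_zero h)
      (v_mul_q_mul_q hr hs h) (q_self i))
  exact ⟨ψ, h1, h2⟩

/-- The value `φ(K'_λ, K_μ) = r^⟨λ,μ⟩ s^(-⟨μ,λ⟩)`. -/
theorem prod_q_inv (hr : r ≠ 0) (hs : s ≠ 0) (l m : Fin n → ℤ) :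
    ∏ j, (∏ i, (C.q r s i j)⁻¹ ^ l i) ^ m j =
      r ^ C.eulerForm l m * s ^ (-C.eulerForm m l) := by
  have hr' : ∀ f : Fin n → ℤ, ∏ i, r ^ f i = r ^ ∑ i, f i := fun f =>
    (Finset.prod_congr rfl fun _ _ => rfl).trans (by
      induction (Finset.univ : Finset (Fin n)) using Finset.induction_on with
      | empty => simp
      | insert i t hi ih => rw [Finset.prod_insert hi, Finset.sum_insert hi, zpow_add₀ hr, ih])
  have hs' : ∀ f : Fin n → ℤ, ∏ i, s ^ f i = s ^ ∑ i, f i := fun f =>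
    (Finset.prod_congr rfl fun _ _ => rfl).trans (by
      induction (Finset.univ : Finset (Fin n)) using Finset.induction_on with
      | empty => simp
      | insert i t hi ih => rw [Finset.prod_insert hi, Finset.sum_insert hi, zpow_add₀ hs, ih])
  have e : ∀ i j, (C.q r s i j)⁻¹ ^ l i =
      r ^ (C.euler i j * l i) * s ^ (-C.euler j i * l i) := fun i j => by
    rw [q, mul_inv, ← zpow_neg, ← zpow_neg, neg_neg, mul_zpow, ← zpow_mul, ← zpow_mul]
  simp only [e, Finset.prod_mul_distrib, hr', hs', mul_zpow, ← zpow_mul]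
  congr 2
  · rw [eulerForm, Finset.sum_comm]
    refine Finset.sum_congr rfl fun j _ => ?_
    rw [Finset.sum_mul]
    exact Finset.sum_congr rfl fun i _ => by ring
  · rw [eulerForm, ← Finset.sum_neg_distrib]
    refine Finset.sum_congr rfl fun j _ => ?_
    rw [Finset.sum_mul, ← Finset.sum_neg_distrib]
    exact Finset.sum_congr rfl fun i _ => by ring

theorem nonempty_hopfPairing (hr : r ≠ 0) (hs : s ≠ 0)
    (hrs : ∀ m : ℕ, 0 < m → (r * s⁻¹) ^ m ≠ 1) : Nonempty (C.HopfPairing r s) := by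
  obtain ⟨ge, comul_K', comul_E, counit_K', counit_E, antipode_K', antipode_E⟩ :=
    exists_hopfStructure_UGe (C := C) hr hs hrs
  obtain ⟨le, comul_K, comul_F, counit_K, counit_F, antipode_K, antipode_F⟩ :=
    exists_hopfStructure_ULe (C := C) hr hs hrs
  choose χ ξ χE χK' ξE ξK' ξmul using fun j => exists_skewDerivation hr hs hrs counit_K' counit_E j
    (1 / (s ^ C.d j - r ^ C.d j))
  let _ : HopfStr (C.UGe r s) := ⟨ge⟩
  let D : DualGenerators (C.E r s) (C.K' r s) (C.q r s) :=
    { gen := isGenerating_UGe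
      comul_K' := comul_K'
      counit_K' := counit_K'
      comul_E := comul_E
      χ := χ
      ξ := fun j => toConv (ξ j)
      χ_E := fun i j => χE j i
      χ_K' := fun i j => by rw [χK', mul_inv_cancel₀ (q_ne_zero hr hs i j)]
      ξ_E := fun i j h => (ξE j i).trans (if_neg h)
      ξ_K' := fun i j => ξK' j i
      ξ_mul := fun j => ξmul j }
  obtain ⟨ψ, ψF, ψK⟩ := DualGenerators.exists_hom hr hs hrs D
  exact ⟨{
    ge := ge
    le := le
    φ := pairingOf ψ
    comul_K' := comul_K'
    comul_E := comul_E
    counit_K' := counit_K'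
    counit_E := counit_E
    antipode_K' := antipode_K'
    antipode_E := antipode_E
    comul_K := comul_K
    comul_F := comul_F
    counit_K := counit_K
    counit_F := counit_F
    antipode_K := antipode_K
    antipode_F := antipode_F
    isSkewHopfPairing := D.isSkewHopfPairing le isGenerating_ULe comul_K comul_F counit_K counit_F
      ψF ψK
    φ_E_F := fun i j => by
      refine (congrArg (fun f : Conv (C.UGe r s) ℂ => f.ofConv (C.E r s i)) (ψF j)).trans ?_
      refine (ξE j i).trans ?_
      split_ifs with h
      · rw [h]
      · rfl
    φ_K'_K := fun l m => (D.pairing_prod ψK l m).trans (prod_q_inv hr hs l m)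
    φ_E_K := fun i j =>
      (congrArg (fun f : Conv (C.UGe r s) ℂ => f.ofConv (C.E r s i)) (ψK j)).trans (χE j i)
    φ_K'_F := fun i j =>
      (congrArg (fun f : Conv (C.UGe r s) ℂ => f.ofConv (C.K' r s i)) (ψF j)).trans (ξK' j i) }⟩

end CartanDatum

end TwoParam

end

open TwoParam in
theorem proposition3p1 {n : ℕ} (C : CartanDatum n) (r s : ℂ) (hr : r ≠ 0) (hs : s ≠ 0)
    (hrs : ∀ m : ℕ, 0 < m → (r * s⁻¹) ^ m ≠ 1) :
    -- the Hopf algebras and the pairing with the prescribed values on generators exist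
    Nonempty (C.HopfPairing r s) ∧
    ∀ P : C.HopfPairing r s,
      P.quantumGroup.IsHopfAlgebra ∧
      -- the Kashiwara algebra
      IsModuleAlgebra P.quantumGroup P.kashiwaraMul P.kashiwaraOne P.kashiwaraAction ∧
      IsYetterDrinfeld P.quantumGroup P.kashiwaraAction P.kashiwaraCoaction ∧
      -- the quantized Weyl algebra, with the restrictions of the structure maps
      ∃ (mulW : P.weyl ⊗[ℂ] P.weyl →ₗ[ℂ] P.weyl) (oneW : P.weyl)
        (actW : C.UGe r s ⊗[ℂ] C.ULe r s →ₗ[ℂ] P.weyl →ₗ[ℂ] P.weyl)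
        (coactW : P.weyl →ₗ[ℂ] (C.UGe r s ⊗[ℂ] C.ULe r s) ⊗[ℂ] P.weyl),
        (∀ x y : P.weyl, (mulW (x ⊗ₜ y) : C.ULe r s ⊗[ℂ] C.UGe r s) =
          P.kashiwaraMul ((x : C.ULe r s ⊗[ℂ] C.UGe r s) ⊗ₜ (y : C.ULe r s ⊗[ℂ] C.UGe r s))) ∧
        (oneW : C.ULe r s ⊗[ℂ] C.UGe r s) = P.kashiwaraOne ∧
        (∀ u (x : P.weyl), (actW u x : C.ULe r s ⊗[ℂ] C.UGe r s) = P.kashiwaraAction u x) ∧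
        (∀ x : P.weyl, P.weyl.subtype.lTensor (C.UGe r s ⊗[ℂ] C.ULe r s) (coactW x) =
          P.kashiwaraCoaction x) ∧
        IsModuleAlgebra P.quantumGroup mulW oneW actW ∧
        IsYetterDrinfeld P.quantumGroup actW coactW :=
  ⟨CartanDatum.nonempty_hopfPairing hr hs hrs, fun P =>
    ⟨P.isHopfAlgebra, P.isModuleAlgebra_kashiwara, P.isYetterDrinfeld_kashiwara,
      P.exists_restriction_weyl hr hs hrs⟩⟩
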